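/- Let $n\ge 2$, $T>0$, let $S_n$ be the unit sphere of $\mathbb R^n$ with surface measure $m_n$, and let $Y_m^l$, $m\ge 0$, $1\le l\le h(m,n)$, be an orthonormal basis in $L_2(S_n,m_n)$ of the real spherical harmonics of degree $m$. Let $\zeta(t,x)$, $t\in\mathbb R$, $x\in S_n$, be a complex zero-mean, mean-square continuous random field with values in $L_2(\Omega,\mathcal F,\mathbb P)$ that is periodically correlated in time with period $T$ and isotropic on the sphere: $\mathbb E\,\zeta(t,x)\overline{\zeta(s,y)}=\mathbb E\,\zeta(t+T,x)\overline{\zeta(s+T,y)}=B(t,s,\langle x,y\rangle)$. Let $\widetilde e_k(u)=T^{-1/2}e^{2\pi i\,q_k u/T}$, $q_k=(-1)^k[k/2]$, $k=1,2,\dots$, be the trigonometric basis of $L_2([0,T))$, and put $\zeta_m^l(t)=\int_{S_n}\zeta(t,x)Y_m^l(x)\,m_n(dx)$, $\zeta_{mk}^l(j)=\int_0^T\zeta_m^l(u+jT)\overline{\widetilde e_k(u)}\,du$ and $\vec\zeta_m^l(j)=(\zeta_{mk}^l(j))_{k\ge1}$. For a weight $a(t,x)$, $t\ge0$, square integrable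 over $[jT,(j+1)T)\times S_n$ for every $j\ge 0$, put $a_m^l(t)=\int_{S_n}a(t,x)Y_m^l(x)\,m_n(dx)$ and $\vec a_m^l(j)=\big(\int_0^T a_m^l(u+jT)\,\widetilde e_k(u)\,du\big)_{k\ge 1}$, $j\ge 0$, and assume $$\sum_{m,l}\sum_{j\ge0}\|\vec a_m^l(j)\|<\infty,\qquad \sum_{m,l}\sum_{j\ge0}(j+1)\|\vec a_m^l(j)\|^2<\infty .$$ Let $A\zeta=\int_0^\infty\int_{S_n}a(t,x)\zeta(t,x)\,m_n(dx)\,dt$. Assume that, for each $m$, the sequences $\vec\zeta_m^l$ have the spectral density $F_m=\{f_m^{kk'}\}$, that is $\mathbb E\,\zeta_{mk}^l(j_1)\overline{\zeta_{mk'}^l(j_2)}=\frac1{2\pi}\int_{-\pi}^{\pi}e^{i(j_1-j_2)\lambda}f_m^{kk'}(\lambda)\,d\lambda$, and that $F_m$ admits a canonical factorization $$F_m(\lambda)=P_m(\lambda)P_m(\lambda)^*,\qquad P_m(\lambda)=\sum_{u\ge0}d_m(u)e^{-iu\lambda},$$ with matrices $d_m(u)=\{d_{mk}^r(u)\}$,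 $k=1,2,\dots$, $r=1,\dots,M_m$, $M_m\le\infty$, the series converging in mean square. Canonical means that the noise is contained in the past and present of the sequence: every constant unit vector of $\ell_2^{M_m}$ is a limit in $L_2([-\pi,\pi);\ell_2^{M_m})$ of finite linear combinations of the functions $e^{-ij\lambda}P_m(\lambda)^\top\delta_k$, $j\ge0$, $k\ge1$. Put $$(\mathbf A_m^l\mathbf d_m)(j)=\sum_{p\ge0}d_m(p)^\top\vec a_m^l(p+j),\quad A_m^l(\lambda)=\sum_{j\ge0}\vec a_m^l(j)e^{ij\lambda},\quad S_m^l(\lambda)=\sum_{j\ge0}(\mathbf A_m^l\mathbf d_m)(j)e^{ij\lambda},$$ the last series converging in mean square. Let $\hat A\zeta$ be the optimal linear estimate of $A\zeta$ from noise-free observations of $\zeta(t,x)$, $t<0$, $x\in S_n$, that is the orthogonal projection of $A\zeta$ onto the closed linear span of these values in $L_2(\Omega,\mathcal F,\mathbb P)$. Then $A\zeta$ is a well-defined $L_2(\Omega)$-valued integral and the mean square error is $$\mathbb E|A\zeta-\hat A\zeta|^2=\sum_{m\ge0}\sum_{l=1}^{h(m,n)}\sum_{j\ge0}\|(\mathbf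 A_m^l\mathbf d_m)(j)\|^2<\infty .$$ Moreover, let $Q_m(\lambda)$ be measurable matrix functions with rows in $\ell_2$ and $Q_m(\lambda)P_m(\lambda)=I_{M_m}$ for almost all $\lambda$; if some $M_m=\infty$, suppose also that for every $l$ and almost every $\lambda$ the product $Q_m(\lambda)^\top S_m^l(\lambda)$ converges unconditionally in $\ell_2$ as a linear combination of the rows of $Q_m(\lambda)$ (this is automatic if $M_m<\infty$). Then the optimal estimate has the spectral characteristic $$h_m^l(\lambda)=A_m^l(\lambda)-Q_m(\lambda)^\top S_m^l(\lambda).$$ That is, $h=\{h_m^l\}$ belongs to $L_2^-(F)$, the closed subspace generated by the functions $e^{ij\lambda}\delta_k$, $j<0$, $k\ge1$ (placed at any $(m,l)$), of the space $L_2(F)$ with the norm $\|g\|_F^2=\sum_{m,l}\frac1{2\pi}\int_{-\pi}^{\pi}g_m^l(\lambda)^\top F_m(\lambda)\overline{g_m^l(\lambda)}\,d\lambda$; one has $\hat A\zeta=\sum_{m,l}\int h_m^l(\lambda)^\top Z_m^l(d\lambda)$ with the orthogonal stochastic measures $Z_m^l$ of $\vec\zeta_m^l$; and $h$ minimizes $\|A-g\|_F^2$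 over $g\in L_2^-(F)$, where $A=\{A_m^l\}$, with minimum equal to the mean square error above. -/

import Mathlib

open MeasureTheory Filter Topology
open scoped ENNReal ComplexConjugate

noncomputable section

namespace SphereField

/-! ### The sphere and spherical harmonics -/

/-- The unit sphere of the `n`-dimensional Euclidean space. -/
abbrev Sph (n : ℕ) : Type := Metric.sphere (0 : EuclideanSpace ℝ (Fin n)) 1

/-- The Lebesgue (surface) measure on the unit sphere. -/
def surf (n : ℕ) : Measure (Sph n) :=
  (volume : Measure (EuclideanSpace ℝ (Fin n))).toSphere

instance (n : ℕ) : IsFiniteMeasure (surf n) := by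
  unfold surf; infer_instance

/-- The Laplace operator on real polynomials in `n` variables. -/
def laplacian (n : ℕ) : MvPolynomial (Fin n) ℝ →ₗ[ℝ] MvPolynomial (Fin n) ℝ :=
  ∑ i : Fin n, (MvPolynomial.pderiv i).toLinearMap ∘ₗ (MvPolynomial.pderiv i).toLinearMap

/-- Restriction of a polynomial to the unit sphere. -/
def restrictSphere (n : ℕ) : MvPolynomial (Fin n) ℝ →ₗ[ℝ] (Sph n → ℝ) :=
  LinearMap.pi fun x => (MvPolynomial.aeval (fun i : Fin n => x.1 i)).toLinearMap

/-- Spherical harmonics of degree `m`: restrictions to the unit sphere of the homogeneous harmonic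
polynomials of degree `m`. -/
def harmonics (n m : ℕ) : Submodule ℝ (Sph n → ℝ) :=
  (MvPolynomial.homogeneousSubmodule (Fin n) ℝ m ⊓ LinearMap.ker (laplacian n)).map
    (restrictSphere n)

/-- `h(m, n)`: the number of linearly independent spherical harmonics of degree `m`. -/
def harmonicCount (n m : ℕ) : ℕ := Module.finrank ℝ (harmonics n m)

/-- The pairs `(m, l)` with `m = 0, 1, …` and `l` one of the `h(m, n)` possible values. -/
abbrev HIdx (n : ℕ) : Type := (m : ℕ) × Fin (harmonicCount n m)

/-- For every `m`, the functions `S m l` are an orthonormal basis of the (real) spherical harmonics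
of degree `m`. -/
structure IsHarmonicBasis {n : ℕ} (S : (m : ℕ) → Fin (harmonicCount n m) → Sph n → ℝ) : Prop where
  span_eq : ∀ m, Submodule.span ℝ (Set.range (S m)) = harmonics n m
  orthonormal : ∀ m l l', ∫ x, S m l x * S m l' x ∂(surf n) = if l = l' then 1 else 0

/-! ### Random fields -/

variable {Ω : Type*} [MeasurableSpace Ω]

/-- `E X \overline{Y}`. -/
def corr {P : Measure Ω} (X Y : Lp ℂ 2 P) : ℂ := ∫ ω, X ω * conj (Y ω) ∂P

/-- A mean-square continuous, zero-mean, second-order random field on `ℝ × S_n` which is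
periodically correlated in time with period `T` and isotropic on the sphere. -/
structure IsPCIsotropic {n : ℕ} {P : Measure Ω} (T : ℝ) (ζ : ℝ → Sph n → Lp ℂ 2 P) : Prop where
  continuous : Continuous fun p : ℝ × Sph n => ζ p.1 p.2
  mean_zero : ∀ t x, ∫ ω, ζ t x ω ∂P = 0
  isotropic : ∃ B : ℝ → ℝ → ℝ → ℂ, ∀ t s x y,
    corr (ζ t x) (ζ s y) = B t s (inner ℝ (x : EuclideanSpace ℝ (Fin n)) y) ∧
    corr (ζ (t + T) x) (ζ (s + T) y) = B t s (inner ℝ (x : EuclideanSpace ℝ (Fin n)) y)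

/-- The closed linear subspace of `L₂(Ω)` generated by the values of the field at times `t < 0`. -/
def pastSpace {n : ℕ} {P : Measure Ω} (ζ : ℝ → Sph n → Lp ℂ 2 P) : Submodule ℂ (Lp ℂ 2 P) :=
  (Submodule.span ℂ {η | ∃ t x, t < 0 ∧ η = ζ t x}).topologicalClosure

instance {n : ℕ} {P : Measure Ω} (ζ : ℝ → Sph n → Lp ℂ 2 P) : CompleteSpace (pastSpace ζ) := by
  unfold pastSpace; infer_instance

/-- `A ζ = ∫_0^∞ ∫_{S_n} a(t,x) ζ(t,x) m_n(dx) dt`, as an `L₂(Ω)`-valued integral. -/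
def functional {n : ℕ} {P : Measure Ω} (a : ℝ → Sph n → ℂ) (ζ : ℝ → Sph n → Lp ℂ 2 P) :
    Lp ℂ 2 P :=
  ∫ t in Set.Ici (0 : ℝ), ∫ x, a t x • ζ t x ∂(surf n)

/-- The optimal (least mean square) linear estimate of `A ζ` from the field at times `t < 0`: the
orthogonal projection of `A ζ` onto the past. -/
def optimalEstimate {n : ℕ} {P : Measure Ω} (a : ℝ → Sph n → ℂ) (ζ : ℝ → Sph n → Lp ℂ 2 P) :
    Lp ℂ 2 P :=
  (pastSpace ζ).starProjection (functional a ζ)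

/-! ### Coefficients with respect to spherical harmonics and to the trigonometric basis -/

/-- The frequencies `0, 1, -1, 2, -2, …`; the index `k = 0, 1, …` here is `k + 1` in the
enumeration `(-1)^k [k/2]`, `k = 1, 2, …`. -/
def freq (k : ℕ) : ℤ := (-1) ^ (k + 1) * (((k + 1) / 2 : ℕ) : ℤ)

/-- The trigonometric orthonormal basis of `L₂([0, T))`. -/
def basisFun (T : ℝ) (k : ℕ) (u : ℝ) : ℂ :=
  ((1 / Real.sqrt T : ℝ) : ℂ) *
    Complex.exp (2 * (Real.pi : ℂ) * Complex.I * (freq k : ℂ) * (u : ℂ) / (T : ℂ))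

/-- Coefficients of `u ↦ f (u + j T)`, `u ∈ [0, T)`, in the trigonometric basis. -/
def blockCoef {E : Type*} [NormedAddCommGroup E] [NormedSpace ℂ E] (T : ℝ) (f : ℝ → E)
    (j : ℤ) (k : ℕ) : E :=
  ∫ u in Set.Ico (0 : ℝ) T, conj (basisFun T k u) • f (u + j * T)

/-- `ζ_m^l(t)`, `p = (m, l)`. -/
def harmCoef {n : ℕ} {E : Type*} [NormedAddCommGroup E] [NormedSpace ℂ E]
    (S : (m : ℕ) → Fin (harmonicCount n m) → Sph n → ℝ) (f : ℝ → Sph n → E)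
    (p : HIdx n) (t : ℝ) : E :=
  ∫ x, ((S p.1 p.2 x : ℝ) : ℂ) • f t x ∂(surf n)

/-- The vector stationary sequence `ζ_{mk}^l(j)`, `p = (m, l)`. -/
def fieldSeq {n : ℕ} {P : Measure Ω} (T : ℝ)
    (S : (m : ℕ) → Fin (harmonicCount n m) → Sph n → ℝ) (ζ : ℝ → Sph n → Lp ℂ 2 P)
    (p : HIdx n) (j : ℤ) (k : ℕ) : Lp ℂ 2 P :=
  blockCoef T (harmCoef S ζ p) j k

/-- The permutation of the indices that exchanges the frequencies `q` and `-q`. -/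
def swapIdx (k : ℕ) : ℕ := if k = 0 then 0 else if k % 2 = 1 then k + 1 else k - 1

/-- The vectors `a_m^l(j)`, `j ≥ 0`, `p = (m, l)`: the trigonometric coefficients in the order that
exchanges opposite frequencies, so that `A ζ = ∑_{m,l} ∑_j a_m^l(j)^⊤ ζ_m^l(j)`. -/
def aVec {n : ℕ} (T : ℝ) (S : (m : ℕ) → Fin (harmonicCount n m) → Sph n → ℝ)
    (a : ℝ → Sph n → ℂ) (p : HIdx n) (j k : ℕ) : ℂ :=
  blockCoef T (harmCoef S a p) (j : ℤ) (swapIdx k)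

/-- `‖v‖²` for a sequence (or a countable family) of complex numbers. -/
def normSq {κ : Type*} (v : κ → ℂ) : ℝ≥0∞ := ∑' k, ‖v k‖ₑ ^ 2

/-- The weight `a` is square integrable over every period, and the vectors `a_m^l(j)` satisfy
`∑ ‖a_m^l(j)‖ < ∞`, `∑ (j+1) ‖a_m^l(j)‖² < ∞`. -/
structure IsWeight {n : ℕ} (T : ℝ) (S : (m : ℕ) → Fin (harmonicCount n m) → Sph n → ℝ)
    (a : ℝ → Sph n → ℂ) : Prop where
  memLp : ∀ j : ℕ, MemLp (Function.uncurry a) 2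
    ((volume.restrict (Set.Ico (j * T) ((j + 1) * T))).prod (surf n))
  sum_norm : ∑' (p : HIdx n) (j : ℕ), normSq (aVec T S a p j) ^ (1 / 2 : ℝ) < ∞
  sum_sq : ∑' (p : HIdx n) (j : ℕ), ((j : ℝ≥0∞) + 1) * normSq (aVec T S a p j) < ∞

/-! ### Spectral densities, spectral characteristics and the canonical factorization -/

/-- Lebesgue measure on `[-π, π)`. -/
def circ : Measure ℝ := volume.restrict (Set.Ico (-Real.pi) Real.pi)

/-- `e^{i q w}`. -/
def expI (q : ℤ) (w : ℝ) : ℂ := Complex.exp (Complex.I * (q : ℂ) * (w : ℂ))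

/-- The matrix functions `F m` are the spectral densities of the sequences `ζ_m^l`:
`E ζ_{mk}^l(i) \overline{ζ_{mn}^l(j)} = (1/2π) ∫ e^{i(i-j)w} f_m^{kn}(w) dw`. -/
structure IsSpectralDensity {n : ℕ} {P : Measure Ω}
    (z : HIdx n → ℤ → ℕ → Lp ℂ 2 P) (F : ℕ → ℝ → ℕ → ℕ → ℂ) : Prop where
  integrable : ∀ m k k', Integrable (fun w => F m w k k') circ
  corr_eq : ∀ (p : HIdx n) (i j : ℤ) (k k' : ℕ), corr (z p i k) (z p j k') =
    ((1 / (2 * Real.pi) : ℝ) : ℂ) * ∫ w, expI (i - j) w * F p.1 w k k' ∂circ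

/-- `v^⊤ F \overline{v}`. -/
def quadForm (F : ℕ → ℕ → ℂ) (v : ℕ → ℂ) : ℂ := ∑' k, ∑' k', v k * F k k' * conj (v k')

/-- `∑_{m,l} (1/2π) ∫ h_m^l(w)^⊤ F_m(w) \overline{h_m^l(w)} dw`. -/
def specNormSq {n : ℕ} (F : ℕ → ℝ → ℕ → ℕ → ℂ) (h : HIdx n → ℝ → ℕ → ℂ) : ℝ≥0∞ :=
  ∑' p : HIdx n, ENNReal.ofReal (1 / (2 * Real.pi)) *
    ∫⁻ w, ENNReal.ofReal (quadForm (F p.1 w) (h p w)).re ∂circ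

/-- Membership in `L₂(F)`. -/
structure MemL2 {n : ℕ} (F : ℕ → ℝ → ℕ → ℕ → ℂ) (h : HIdx n → ℝ → ℕ → ℂ) : Prop where
  aemeasurable : ∀ p k, AEMeasurable (fun w => h p w k) circ
  memℓp : ∀ p, ∀ᵐ w ∂circ, Memℓp (h p w) 2
  finite : specNormSq F h < ∞

/-- The vector function with components `∑_j c(m,l,j,k) e^{i j w}`, a finite linear combination of
the functions `e^{i j w} δ_k` placed at `(m, l)`. -/
def trigPoly {n : ℕ} (c : (HIdx n × ℤ × ℕ) →₀ ℂ) (p : HIdx n) (w : ℝ) (k : ℕ) : ℂ :=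
  c.sum fun i b => if i.1 = p ∧ i.2.2 = k then b * expI i.2.1 w else 0

/-- Membership in `L₂⁻(F)`, the closed subspace of `L₂(F)` generated by `e^{i j w} δ_k`, `j < 0`. -/
structure MemL2Minus {n : ℕ} (F : ℕ → ℝ → ℕ → ℕ → ℂ) (h : HIdx n → ℝ → ℕ → ℂ) : Prop where
  memL2 : MemL2 F h
  approx : ∀ ε : ℝ≥0∞, 0 < ε → ∃ c : (HIdx n × ℤ × ℕ) →₀ ℂ, (∀ i ∈ c.support, i.2.1 < 0) ∧
    specNormSq F (fun p w k => h p w k - trigPoly c p w k) < ε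

/-- `η = ∑_{m,l} ∫ h_m^l(w)^⊤ Z_m^l(dw)` for the orthogonal stochastic measures `Z_m^l` of the
sequences `z`. The stochastic integral is the isometric extension of the map which takes
`e^{i j w} δ_k` at `p = (m, l)` to `z p j k`. -/
def IsSpectralIntegral {n : ℕ} {P : Measure Ω} (z : HIdx n → ℤ → ℕ → Lp ℂ 2 P)
    (F : ℕ → ℝ → ℕ → ℕ → ℂ) (h : HIdx n → ℝ → ℕ → ℂ) (η : Lp ℂ 2 P) : Prop :=
  ∀ ε : ℝ≥0∞, 0 < ε → ∃ c : (HIdx n × ℤ × ℕ) →₀ ℂ,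
    specNormSq F (fun p w k => h p w k - trigPoly c p w k) < ε ∧
    ‖η - c.sum fun i b => b • z i.1 i.2.1 i.2.2‖ₑ < ε

/-- `f(w) = ∑_{u ≥ 0} c(u) e^{i e(u) w}` in mean square on `[-π, π)`, for a function `f` with
countably many components. -/
structure IsFourierSum {κ : Type*} (e : ℕ → ℤ) (c : ℕ → κ → ℂ) (f : ℝ → κ → ℂ) : Prop where
  aemeasurable : ∀ i, AEMeasurable (fun w => f w i) circ
  tendsto : Tendsto (fun N : ℕ => ∫⁻ w,
    normSq (fun i => f w i - ∑ u ∈ Finset.range N, c u i * expI (e u) w) ∂circ) atTop (𝓝 0)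

/-- The canonical factorization `F(w) = P(w) P(w)^*`, `P(w) = ∑_{u ≥ 0} d(u) e^{-i u w}`. The
columns are indexed by a countable set `ι` whose cardinality is the multiplicity. Canonical means
that in the representation `ζ(j) = ∑_{u ≥ 0} d(u) ξ(j - u)`, with white noise `ξ`, that corresponds
to the factorization, `ξ(j)` belongs to the past and present `{ζ(i), i ≤ j}`; in terms of `P`: the
constant unit vectors are mean square limits of linear combinations of the functions
`e^{-i j w} P(w)^⊤ δ_k`, `j ≥ 0`. -/
structure IsCanonicalFactorization {ι : Type*} (F : ℝ → ℕ → ℕ → ℂ) (d : ℕ → ℕ → ι → ℂ)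
    (P : ℝ → ℕ → ι → ℂ) : Prop where
  series : IsFourierSum (fun u => -(u : ℤ)) (fun u (i : ℕ × ι) => d u i.1 i.2)
    (fun w (i : ℕ × ι) => P w i.1 i.2)
  factor : ∀ᵐ w ∂circ, ∀ k k', HasSum (fun r => P w k r * conj (P w k' r)) (F w k k')
  canonical : ∀ r : ι, ∀ ε : ℝ≥0∞, 0 < ε → ∃ c : (ℕ × ℕ) →₀ ℂ,
    ∫⁻ w, normSq (fun s => Set.indicator {r} (fun _ => (1 : ℂ)) s -
      c.sum fun i b => b * expI (-(i.1 : ℤ)) w * P w i.2 s) ∂circ < ε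

/-- `A_m^l(w) = ∑_{j ≥ 0} a_m^l(j) e^{i j w}`. -/
def aSymbol {n : ℕ} (a : HIdx n → ℕ → ℕ → ℂ) (p : HIdx n) (w : ℝ) (k : ℕ) : ℂ :=
  ∑' j : ℕ, a p j k * expI j w

/-- `(A_m^l d_m)(j) = ∑_{u ≥ 0} d_m(u)^⊤ a_m^l(u + j)`. -/
def aConv {n : ℕ} {ι : ℕ → Type*} (a : HIdx n → ℕ → ℕ → ℂ) (d : (m : ℕ) → ℕ → ℕ → ι m → ℂ)
    (p : HIdx n) (j : ℕ) (r : ι p.1) : ℂ :=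
  ∑' u : ℕ, ∑' k : ℕ, d p.1 u k r * a p (u + j) k

/-- `Q(w)` is a left inverse of `P(w)`: `Q(w) P(w) = I` for almost all `w`. The rows of `Q(w)` are
in `ℓ₂`. -/
structure IsLeftInverse {ι : Type*} (P : ℝ → ℕ → ι → ℂ)
    (Q : ℝ → ι → lp (fun _ : ℕ => ℂ) 2) : Prop where
  aemeasurable : ∀ r k, AEMeasurable (fun w => Q w r k) circ
  mul_eq_one : ∀ᵐ w ∂circ, ∀ r s,
    HasSum (fun k => Q w r k * P w k s) (Set.indicator {r} (fun _ => (1 : ℂ)) s)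

/-- `h_m^l(w) = A_m^l(w) - Q_m(w)^⊤ S_m^l(w)`. -/
def specChar {n : ℕ} {ι : ℕ → Type*} (A : HIdx n → ℝ → ℕ → ℂ)
    (Q : (m : ℕ) → ℝ → ι m → lp (fun _ : ℕ => ℂ) 2) (s : (p : HIdx n) → ℝ → ι p.1 → ℂ)
    (p : HIdx n) (w : ℝ) (k : ℕ) : ℂ :=
  A p w k - (∑' r, s p w r • Q p.1 w r) k

end SphereField

end

open MeasureTheory SphereField
open scoped ENNReal

open MeasureTheory Filter Topology
open scoped ENNReal ComplexConjugate

noncomputable section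

namespace SphereField

/-! ### Gaussian integrals of polynomials -/

/-! The prediction problem becomes trivial in coordinates with respect to the white noises of the
canonical factorizations; the proof constructs these coordinates on both the spectral and the
probabilistic side and shows that they agree.

Reduction to sequences. Isotropy and the Funk–Hecke formula make harmonic coefficients with
different `(m, l)` uncorrelated (`inner_harmCoef_eq_zero`). Products of harmonics and exponentials
form a complete orthonormal family over each period (`isCompleteFamily_blockFam`). Hence the field
reduces to mutually uncorrelated vector stationary sequences, which generate the same past
(`pastSpace_eq`), and `A ζ` is an absolutely convergent series in them (`hasSum_functional`).

Noise coordinates. Since `F = P P^*`, the form `h^⊤ F \overline{h}` equals `‖P^⊤ h‖²`, so taking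
Fourier coefficients of `P^⊤ h` maps `L₂(F)` isometrically into an `ℓ₂` space indexed by the
harmonic, the noise and the time (`specNormSq_eq_normSq`). The images `vec p j k` of `e^{i j w} δ_k`
have the same Gram matrix as the variables `z p j k` (`inner_vec`), and they span a dense subspace,
so an isometry `V` into `L₂(Ω)` takes one family to the other (`exists_linearIsometry`).

Past and truncation. `P` has no positive frequencies, so `vec p j k` has no coordinates at times
after `j` (`vec_apply_eq_zero`). Canonicality is the converse: the unit coordinate at time `q` is a
limit of combinations of vectors with times at most `q` (`single_mem_closure`). So the past is
exactly the set of vectors with coordinates at negative times only, and projecting onto it is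
truncation (`starProjection_map`). The coordinates of `A ζ` at times `j ≥ 0` are those of `(A d)(j)`
(`functionalVec_apply_natCast`); their squared norm is the error.

Spectral characteristic. From `Q P = I` follows `P^⊤ Q^⊤ S = S` (`noiseSymbol_tsum_smul`), and `S`
carries precisely the coordinates of the functional at nonnegative times. Thus `A - Q^⊤ S` has the
truncated coordinates. It is optimal because elements of `L₂⁻(F)` have no coordinates at nonnegative
times (`coefVec_apply_eq_zero`).

The facts about spherical harmonics come from two sources: Gaussian integration by parts (`stein`)
gives Funk–Hecke and the orthogonality of different degrees, while the harmonic decomposition of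
polynomials and Stone–Weierstrass give completeness. -/

/-- The value of a real polynomial at a point of the Euclidean space. -/
abbrev peval {n : ℕ} (p : MvPolynomial (Fin n) ℝ) (y : EuclideanSpace ℝ (Fin n)) : ℝ :=
  MvPolynomial.eval (fun i => y i) p

/-- The Gaussian weight `exp (-‖y‖² / 2)`. -/
def gauss {n : ℕ} (y : EuclideanSpace ℝ (Fin n)) : ℝ := Real.exp (-(1 / 2) * ‖y‖ ^ 2)

/-- The radial Gaussian moments. -/
def radialMoment (n q : ℕ) : ℝ :=
  ∫ r : Set.Ioi (0 : ℝ), r.1 ^ q * Real.exp (-(1 / 2) * r.1 ^ 2) ∂Measure.volumeIoiPow (n - 1)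

lemma continuous_peval {n : ℕ} (p : MvPolynomial (Fin n) ℝ) : Continuous (peval p) := by
  unfold peval
  induction p using MvPolynomial.induction_on with
  | C a => simp only [MvPolynomial.eval_C]; fun_prop
  | add p q hp hq => simp only [map_add]; exact hp.add hq
  | mul_X p i hp => simp only [map_mul, MvPolynomial.eval_X]; exact hp.mul (by fun_prop)

lemma continuous_peval_sphere {n : ℕ} (p : MvPolynomial (Fin n) ℝ) :
    Continuous fun x : Sph n => peval p x.1 :=
  (continuous_peval p).comp continuous_subtype_val

lemma peval_smul {n q : ℕ} {p : MvPolynomial (Fin n) ℝ} (hp : p.IsHomogeneous q) (r : ℝ)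
    (y : EuclideanSpace ℝ (Fin n)) : peval p (r • y) = r ^ q * peval p y := by
  unfold peval
  rw [MvPolynomial.eval_eq, MvPolynomial.eval_eq, Finset.mul_sum]
  refine Finset.sum_congr rfl fun d hd => ?_
  have : d.degree = q := by
    by_contra h
    exact (MvPolynomial.mem_support_iff.1 hd) (hp.coeff_eq_zero h)
  have h2 : d.degree = ∑ i ∈ d.support, d i := rfl
  simp only [PiLp.smul_apply, smul_eq_mul, mul_pow, Finset.prod_mul_distrib,
    Finset.prod_pow_eq_pow_sum]
  rw [← h2, this]; ring

lemma integrable_radial (n q : ℕ) : Integrable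
    (fun r : Set.Ioi (0 : ℝ) => r.1 ^ q * Real.exp (-(1 / 2) * r.1 ^ 2))
    (Measure.volumeIoiPow (n - 1)) := by
  unfold Measure.volumeIoiPow
  rw [integrable_withDensity_iff_integrable_smul' (by fun_prop) (by simp)]
  have h := integrableOn_rpow_mul_exp_neg_mul_sq (b := 1 / 2) (by norm_num)
    (s := ((n - 1 + q : ℕ) : ℝ)) (by
      have : (0 : ℝ) ≤ ((n - 1 + q : ℕ) : ℝ) := Nat.cast_nonneg _
      linarith)
  rw [integrableOn_iff_comap_subtypeVal measurableSet_Ioi] at h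
  refine (integrable_congr ?_).1 h
  refine .of_forall ?_
  rintro ⟨x, hx : 0 < x⟩
  simp only [Function.comp, smul_eq_mul, Real.rpow_natCast]
  rw [ENNReal.toReal_ofReal (by positivity)]
  ring

lemma radialMoment_pos (n q : ℕ) : 0 < radialMoment n q := by
  unfold radialMoment
  rw [integral_pos_iff_support_of_nonneg _ (integrable_radial n q)]
  · have : Function.support (fun r : Set.Ioi (0 : ℝ) =>
        r.1 ^ q * Real.exp (-(1 / 2) * r.1 ^ 2)) = Set.univ := by
      ext ⟨x, hx : 0 < x⟩
      simp only [Function.mem_support, Set.mem_univ, iff_true]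
      positivity
    rw [this]
    refine lt_of_lt_of_le ?_ (measure_mono (Set.subset_univ (Set.Iio ⟨1, Set.mem_Ioi.2 one_pos⟩)))
    rw [Measure.volumeIoiPow_apply_Iio]
    simp only [one_pow, ENNReal.ofReal_pos]
    positivity
  · rintro ⟨x, hx : 0 < x⟩
    simp only [Pi.zero_apply]
    positivity

lemma polar_aux {n q : ℕ} {p : MvPolynomial (Fin n) ℝ} (hp : p.IsHomogeneous q)
    (y : ({0}ᶜ : Set (EuclideanSpace ℝ (Fin n)))) :
    peval p y.1 * gauss y.1 =
      (fun z : Sph n × Set.Ioi (0 : ℝ) =>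
        peval p z.1.1 * (z.2.1 ^ q * Real.exp (-(1 / 2) * z.2.1 ^ 2)))
        (homeomorphUnitSphereProd _ y) := by
  have hy : ‖y.1‖ ≠ 0 := norm_ne_zero_iff.2 y.2
  have h : y.1 = ‖y.1‖ • (‖y.1‖⁻¹ • y.1) := by
    rw [smul_smul, mul_inv_cancel₀ hy, one_smul]
  simp only [homeomorphUnitSphereProd_apply_fst_coe, homeomorphUnitSphereProd_apply_snd_coe]
  conv_lhs => rw [h, peval_smul hp, ← h]
  unfold gauss
  ring

lemma nontrivial_euclidean {n : ℕ} (hn : 0 < n) : Nontrivial (EuclideanSpace ℝ (Fin n)) := by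
  have : Nonempty (Fin n) := ⟨⟨0, hn⟩⟩
  infer_instance

lemma integrable_peval_gauss {n q : ℕ} (hn : 0 < n) {p : MvPolynomial (Fin n) ℝ}
    (hp : p.IsHomogeneous q) : Integrable (fun y => peval p y * gauss y) := by
  have : Nontrivial (EuclideanSpace ℝ (Fin n)) := nontrivial_euclidean hn
  rw [← restrict_compl_singleton (μ := volume) (0 : EuclideanSpace ℝ (Fin n)), ← IntegrableOn,
    integrableOn_iff_comap_subtypeVal (by measurability)]
  have := ((volume : Measure (EuclideanSpace ℝ (Fin n))).measurePreserving_homeomorphUnitSphereProd.integrable_comp_emb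
    (g := fun z : Sph n × Set.Ioi (0 : ℝ) =>
        peval p z.1.1 * (z.2.1 ^ q * Real.exp (-(1 / 2) * z.2.1 ^ 2)))
    (Homeomorph.measurableEmbedding _)).2 ?_
  · refine (integrable_congr (.of_forall fun y => ?_)).2 this
    exact polar_aux hp y
  · rw [finrank_euclideanSpace_fin]
    refine Integrable.mul_prod (f := fun x : Sph n => peval p x.1) ?_ (integrable_radial n q)
    exact (continuous_peval_sphere p).integrable_of_hasCompactSupport
      (HasCompactSupport.of_compactSpace _)

/-- In polar coordinates homogeneity splits off the radial factor. This transfers integrals over the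
sphere to flat space, where integration by parts is available. -/
lemma integral_peval_gauss {n q : ℕ} (hn : 0 < n) {p : MvPolynomial (Fin n) ℝ}
    (hp : p.IsHomogeneous q) :
    ∫ y, peval p y * gauss y = radialMoment n q * ∫ x : Sph n, peval p x.1 ∂(surf n) := by
  have : Nontrivial (EuclideanSpace ℝ (Fin n)) := nontrivial_euclidean hn
  calc
    ∫ y, peval p y * gauss y = ∫ y : ({(0)}ᶜ : Set (EuclideanSpace ℝ (Fin n))),
        peval p y.1 * gauss y.1 ∂(volume.comap Subtype.val) := by
      rw [integral_subtype_comap (measurableSet_singleton (0 : EuclideanSpace ℝ (Fin n))).compl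
        (fun y => peval p y * gauss y), restrict_compl_singleton]
    _ = ∫ z : Sph n × Set.Ioi (0 : ℝ),
        peval p z.1.1 * (z.2.1 ^ q * Real.exp (-(1 / 2) * z.2.1 ^ 2))
          ∂(surf n).prod (Measure.volumeIoiPow (n - 1)) := by
      have := (volume : Measure (EuclideanSpace ℝ (Fin n))).measurePreserving_homeomorphUnitSphereProd.integral_comp
        (Homeomorph.measurableEmbedding _) (fun z : Sph n × Set.Ioi (0 : ℝ) =>
        peval p z.1.1 * (z.2.1 ^ q * Real.exp (-(1 / 2) * z.2.1 ^ 2)))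
      rw [finrank_euclideanSpace_fin] at this
      rw [surf, ← this]
      exact integral_congr_ae (.of_forall fun y => polar_aux hp y)
    _ = _ := by
      rw [integral_prod_mul (fun x : Sph n => peval p x.1)
        (fun r : Set.Ioi (0 : ℝ) => r.1 ^ q * Real.exp (-(1 / 2) * r.1 ^ 2)), radialMoment,
        mul_comm]

lemma hasLineDerivAt_peval {n : ℕ} (p : MvPolynomial (Fin n) ℝ) (i : Fin n)
    (y : EuclideanSpace ℝ (Fin n)) :
    HasLineDerivAt ℝ (peval p) (peval (MvPolynomial.pderiv i p) y) y
      (EuclideanSpace.single i 1) := by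
  unfold peval HasLineDerivAt
  induction p using MvPolynomial.induction_on with
  | C a => simpa using hasDerivAt_const (0 : ℝ) a
  | add p q hp hq =>
    simp only [map_add]
    exact hp.add hq
  | mul_X p j hp =>
    have h1 : HasDerivAt (fun t : ℝ => (y + t • EuclideanSpace.single i (1 : ℝ)) j)
        (if j = i then 1 else 0) 0 := by
      have : (fun t : ℝ => (y + t • EuclideanSpace.single i (1 : ℝ)) j) =
          fun t => y j + t * (if j = i then 1 else 0) := by
        ext t
        simp
      rw [this]
      simpa using ((hasDerivAt_id (0 : ℝ)).mul_const (if j = i then (1 : ℝ) else 0)).const_add (y j)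
    have := hp.mul h1
    simp only [map_mul, MvPolynomial.eval_X, MvPolynomial.pderiv_mul, map_add,
      MvPolynomial.pderiv_X]
    refine this.congr_deriv ?_
    by_cases hij : j = i
    · subst hij
      simp
    · simp [hij, mul_comm]

lemma hasLineDerivAt_gauss {n : ℕ} (i : Fin n) (y : EuclideanSpace ℝ (Fin n)) :
    HasLineDerivAt ℝ gauss (-(y i * gauss y)) y (EuclideanSpace.single i 1) := by
  have h1 : HasFDerivAt (fun y : EuclideanSpace ℝ (Fin n) => ‖y‖ ^ 2) (2 • (innerSL ℝ y)) y :=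
    (hasStrictFDerivAt_norm_sq y).hasFDerivAt
  have h := ((h1.const_mul (-(1 / 2) : ℝ)).exp).hasLineDerivAt (EuclideanSpace.single i 1)
  unfold gauss
  have e : -(y i * Real.exp (-(1 / 2) * ‖y‖ ^ 2)) =
      (Real.exp (-(1 / 2) * ‖y‖ ^ 2) • -(1 / 2 : ℝ) • 2 • (innerSL ℝ) y)
        (EuclideanSpace.single i 1) := by
    simp [EuclideanSpace.inner_single_right]
    ring
  rw [e]
  exact h

/-- Gaussian integration by parts. -/
lemma stein {n q : ℕ} (hn : 0 < n) {p : MvPolynomial (Fin n) ℝ} (hp : p.IsHomogeneous q)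
    (i : Fin n) :
    ∫ y, peval (MvPolynomial.X i * p) y * gauss y =
      ∫ y, peval (MvPolynomial.pderiv i p) y * gauss y := by
  have hx := integrable_peval_gauss hn ((MvPolynomial.isHomogeneous_X ℝ i).mul hp)
  have h := integral_bilinear_hasLineDerivAt_right_eq_neg_left_of_integrable
    (μ := (volume : Measure (EuclideanSpace ℝ (Fin n))))
    (f := peval p) (f' := peval (MvPolynomial.pderiv i p)) (g := gauss)
    (g' := fun y => -(y i * gauss y)) (v := EuclideanSpace.single i 1)
    (B := ContinuousLinearMap.mul ℝ ℝ)
    (by simpa using integrable_peval_gauss hn hp.pderiv)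
    (by
      refine hx.neg.congr (.of_forall fun y => ?_)
      simp [peval]; ring)
    (by simpa using integrable_peval_gauss hn hp)
    (fun x _ => hasLineDerivAt_peval p i x) (fun x _ => hasLineDerivAt_gauss i x)
  simp only [ContinuousLinearMap.mul_apply'] at h
  rw [← neg_inj, ← h, ← integral_neg]
  congr 1; ext y
  simp [peval]; ring

/-! ### Harmonic polynomials -/

open MvPolynomial in
-- A commutator of derivations is again a derivation, so it vanishes as soon as it kills the
-- variables, whose derivatives are constants.
lemma pderiv_pderiv_comm {n : ℕ} (i j : Fin n) (p : MvPolynomial (Fin n) ℝ) :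
    pderiv i (pderiv j p) = pderiv j (pderiv i p) := by
  have : ⁅(pderiv i : Derivation ℝ (MvPolynomial (Fin n) ℝ) (MvPolynomial (Fin n) ℝ)),
      (pderiv j : Derivation ℝ (MvPolynomial (Fin n) ℝ) (MvPolynomial (Fin n) ℝ))⁆ = 0 := by
    refine derivation_ext fun k => ?_
    rw [Derivation.commutator_apply, pderiv_X, pderiv_X]
    by_cases h1 : k = j <;> by_cases h2 : k = i <;> simp [Pi.single_apply, h1, h2] <;>
      split_ifs <;> simp
  have h := congrArg (fun D => D p) this
  simpa [Derivation.commutator_apply, sub_eq_zero] using h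

lemma laplacian_apply {n : ℕ} (p : MvPolynomial (Fin n) ℝ) :
    laplacian n p = ∑ i, MvPolynomial.pderiv i (MvPolynomial.pderiv i p) := by
  simp [laplacian]

lemma laplacian_pderiv {n : ℕ} (i : Fin n) {p : MvPolynomial (Fin n) ℝ} (hp : laplacian n p = 0) :
    laplacian n (MvPolynomial.pderiv i p) = 0 := by
  rw [laplacian_apply] at *
  have h := congrArg (MvPolynomial.pderiv i) hp
  rw [map_sum, map_zero] at h
  rw [← h]
  refine Finset.sum_congr rfl fun j _ => ?_
  rw [pderiv_pderiv_comm j i p, pderiv_pderiv_comm j i]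

lemma isHomogeneous_laplacian {n k : ℕ} {p : MvPolynomial (Fin n) ℝ} (hp : p.IsHomogeneous k) :
    (laplacian n p).IsHomogeneous (k - 2) := by
  rw [laplacian_apply]
  exact MvPolynomial.IsHomogeneous.sum _ _ _ fun _ _ => hp.pderiv.pderiv

lemma eq_C_of_isHomogeneous_zero {n : ℕ} {p : MvPolynomial (Fin n) ℝ} (hp : p.IsHomogeneous 0) :
    ∃ a, p = MvPolynomial.C a :=
  ⟨_, MvPolynomial.totalDegree_eq_zero_iff_eq_C.1
    ((MvPolynomial.totalDegree_zero_iff_isHomogeneous _).2 hp)⟩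

lemma laplacian_eq_zero_of_lt {n k : ℕ} {p : MvPolynomial (Fin n) ℝ} (hp : p.IsHomogeneous k)
    (hk : k < 2) : laplacian n p = 0 := by
  rw [laplacian_apply]
  refine Finset.sum_eq_zero fun i _ => ?_
  have h : (MvPolynomial.pderiv i p).IsHomogeneous 0 := by
    have := hp.pderiv (i := i)
    rwa [show k - 1 = 0 by omega] at this
  obtain ⟨a, ha⟩ := eq_C_of_isHomogeneous_zero h
  rw [ha, MvPolynomial.pderiv_C]

/-- The polynomial `‖x‖²`. -/
def sqNorm (n : ℕ) : MvPolynomial (Fin n) ℝ := ∑ i, MvPolynomial.X i ^ 2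

lemma isHomogeneous_sqNorm (n : ℕ) : (sqNorm n).IsHomogeneous 2 :=
  MvPolynomial.IsHomogeneous.sum _ _ _ fun i _ => MvPolynomial.isHomogeneous_X_pow i 2

lemma peval_sqNorm {n : ℕ} (y : EuclideanSpace ℝ (Fin n)) : peval (sqNorm n) y = ‖y‖ ^ 2 := by
  simp [peval, sqNorm, EuclideanSpace.norm_sq_eq]

lemma pderiv_sqNorm {n : ℕ} (i : Fin n) :
    MvPolynomial.pderiv i (sqNorm n) = 2 * MvPolynomial.X i := by
  rw [sqNorm, map_sum, Finset.sum_eq_single i]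
  · simp
  · intro j _ hj
    simp [MvPolynomial.pderiv_X_of_ne hj]
  · simp

/-- The cross term `2 ∇‖x‖² · ∇p` is `4 ∑ x_i ∂_i p`, which Euler's identity evaluates as `4 k p`;
the remaining `2 n` is the Laplacian of `‖x‖²`. -/
lemma laplacian_sqNorm_mul {n k : ℕ} {p : MvPolynomial (Fin n) ℝ} (hp : p.IsHomogeneous k) :
    laplacian n (sqNorm n * p) =
      sqNorm n * laplacian n p + MvPolynomial.C (4 * (k : ℝ) + 2 * n) * p := by
  have he := hp.sum_X_mul_pderiv
  have h : ∀ i : Fin n, MvPolynomial.pderiv i (MvPolynomial.pderiv i (sqNorm n * p)) =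
      sqNorm n * MvPolynomial.pderiv i (MvPolynomial.pderiv i p) +
        4 * (MvPolynomial.X i * MvPolynomial.pderiv i p) + 2 * p := by
    intro i
    have h2 : MvPolynomial.pderiv i (2 : MvPolynomial (Fin n) ℝ) = 0 := by
      rw [← map_ofNat MvPolynomial.C 2, MvPolynomial.pderiv_C]
    rw [MvPolynomial.pderiv_mul, pderiv_sqNorm, map_add, MvPolynomial.pderiv_mul,
      MvPolynomial.pderiv_mul, MvPolynomial.pderiv_mul, pderiv_sqNorm, h2,
      MvPolynomial.pderiv_X_self]
    ring
  rw [laplacian_apply, laplacian_apply, Finset.sum_congr rfl fun i _ => h i,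
    Finset.sum_add_distrib, Finset.sum_add_distrib, ← Finset.mul_sum, ← Finset.mul_sum, he]
  simp only [Finset.sum_const, Finset.card_univ, Fintype.card_fin, nsmul_eq_mul, map_add, map_mul,
    map_natCast, map_ofNat]
  ring

/-- Applying the Laplacian to the equation gives an equation of the same kind for `h = Δ g`, of
degree `k - 2` and with a larger constant. Solving that one first, `g = (f - ‖x‖² h) / c` indeed has
Laplacian `h`. Allowing every positive `c` is what lets the induction close. -/
lemma exists_sqNorm_mul_laplacian_add {n : ℕ} (k : ℕ) : ∀ (c : ℝ), 0 < c →
    ∀ f : MvPolynomial (Fin n) ℝ, f.IsHomogeneous k → ∃ g : MvPolynomial (Fin n) ℝ,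
      g.IsHomogeneous k ∧ sqNorm n * laplacian n g + MvPolynomial.C c * g = f := by
  induction k using Nat.strong_induction_on with
  | _ k ih =>
    intro c hc f hf
    have hcc : (MvPolynomial.C c : MvPolynomial (Fin n) ℝ) * MvPolynomial.C c⁻¹ = 1 := by
      rw [← map_mul, mul_inv_cancel₀ hc.ne', map_one]
    by_cases hk : k < 2
    · refine ⟨MvPolynomial.C c⁻¹ * f, hf.C_mul _, ?_⟩
      rw [laplacian_eq_zero_of_lt (hf.C_mul _) hk, mul_zero, zero_add, ← mul_assoc, hcc, one_mul]
    · obtain ⟨h, hh, he⟩ := ih (k - 2) (by omega) (4 * ((k - 2 : ℕ) : ℝ) + 2 * n + c)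
        (by positivity) (laplacian n f) (isHomogeneous_laplacian hf)
      have hNh : (sqNorm n * h).IsHomogeneous k := by
        have := (isHomogeneous_sqNorm n).mul hh
        rwa [show 2 + (k - 2) = k by omega] at this
      refine ⟨MvPolynomial.C c⁻¹ * (f - sqNorm n * h), (hf.sub hNh).C_mul _, ?_⟩
      have hl : laplacian n (MvPolynomial.C c⁻¹ * (f - sqNorm n * h)) = h := by
        rw [← MvPolynomial.smul_eq_C_mul, map_smul, map_sub, laplacian_sqNorm_mul hh, ← he,
          MvPolynomial.smul_eq_C_mul, map_add]
        linear_combination h * hcc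
      rw [hl]
      linear_combination (f - sqNorm n * h) * hcc

lemma restrictSphere_apply {n : ℕ} (p : MvPolynomial (Fin n) ℝ) (x : Sph n) :
    restrictSphere n p x = peval p x.1 := by
  simp [restrictSphere, peval]

/-- Choose `g` with `Δ(‖x‖² g) = Δ f`. Then `f - ‖x‖² g` is harmonic, and on the sphere `‖x‖² g`
equals `g`, whose degree is smaller by two. -/
lemma restrictSphere_mem_of_isHomogeneous {n : ℕ} (hn : 0 < n) (k : ℕ) :
    ∀ f : MvPolynomial (Fin n) ℝ, f.IsHomogeneous k → restrictSphere n f ∈ ⨆ m, harmonics n m := by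
  induction k using Nat.strong_induction_on with
  | _ k ih =>
    intro f hf
    by_cases hk : k < 2
    · exact Submodule.mem_iSup_of_mem k (Submodule.mem_map_of_mem
        ⟨hf, laplacian_eq_zero_of_lt hf hk⟩)
    · obtain ⟨g, hg, he⟩ := exists_sqNorm_mul_laplacian_add (k - 2)
        (4 * ((k - 2 : ℕ) : ℝ) + 2 * n) (by positivity) _ (isHomogeneous_laplacian hf)
      have hNg : (sqNorm n * g).IsHomogeneous k := by
        have := (isHomogeneous_sqNorm n).mul hg
        rwa [show 2 + (k - 2) = k by omega] at this
      have h1 : restrictSphere n (f - sqNorm n * g) ∈ ⨆ m, harmonics n m :=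
        Submodule.mem_iSup_of_mem k (Submodule.mem_map_of_mem ⟨hf.sub hNg, by
          change laplacian n _ = 0
          rw [map_sub, laplacian_sqNorm_mul hg, he, sub_self]⟩)
      have h2 := ih (k - 2) (by omega) g hg
      have : restrictSphere n f = restrictSphere n (f - sqNorm n * g) + restrictSphere n g := by
        ext x
        have hx : ‖x.1‖ = 1 := by simp
        rw [Pi.add_apply, restrictSphere_apply, restrictSphere_apply, restrictSphere_apply]
        have := peval_sqNorm x.1
        simp only [peval, map_sub, map_mul] at this ⊢
        rw [this, hx]
        ring
      rw [this]
      exact add_mem h1 h2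

lemma restrictSphere_mem {n : ℕ} (hn : 0 < n) (p : MvPolynomial (Fin n) ℝ) :
    restrictSphere n p ∈ ⨆ m, harmonics n m := by
  rw [← MvPolynomial.sum_homogeneousComponent p, map_sum]
  exact Submodule.sum_mem _ fun i _ =>
    restrictSphere_mem_of_isHomogeneous hn i _ (MvPolynomial.homogeneousComponent_isHomogeneous i p)

/-! ### The Funk–Hecke formula for powers -/

/-- The Gaussian integral of a polynomial. -/
def gint {n : ℕ} (p : MvPolynomial (Fin n) ℝ) : ℝ :=
  ∫ y : EuclideanSpace ℝ (Fin n), peval p y * gauss y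

lemma gint_C_mul {n : ℕ} (a : ℝ) (p : MvPolynomial (Fin n) ℝ) :
    gint (MvPolynomial.C a * p) = a * gint p := by
  simp [gint, peval, mul_assoc, integral_const_mul]

lemma gint_sum {n : ℕ} (hn : 0 < n) {I : Type*} (s : Finset I) (p : I → MvPolynomial (Fin n) ℝ)
    (q : ℕ) (hp : ∀ i ∈ s, (p i).IsHomogeneous q) : gint (∑ i ∈ s, p i) = ∑ i ∈ s, gint (p i) := by
  unfold gint
  rw [← integral_finsetSum _ fun i hi => integrable_peval_gauss hn (hp i hi)]
  simp [peval, Finset.sum_mul]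

lemma gint_add {n : ℕ} (hn : 0 < n) {p q : MvPolynomial (Fin n) ℝ} {k l : ℕ}
    (hp : p.IsHomogeneous k) (hq : q.IsHomogeneous l) : gint (p + q) = gint p + gint q := by
  unfold gint
  rw [← integral_add (integrable_peval_gauss hn hp) (integrable_peval_gauss hn hq)]
  simp [peval, add_mul]

/-- The linear form `y ↦ ⟨x, y⟩`. -/
def linForm {n : ℕ} (x : EuclideanSpace ℝ (Fin n)) : MvPolynomial (Fin n) ℝ :=
  ∑ i, MvPolynomial.C (x i) * MvPolynomial.X i

lemma isHomogeneous_linForm {n : ℕ} (x : EuclideanSpace ℝ (Fin n)) :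
    (linForm x).IsHomogeneous 1 :=
  MvPolynomial.IsHomogeneous.sum _ _ _ fun _ _ => MvPolynomial.isHomogeneous_C_mul_X _ _

lemma peval_linForm {n : ℕ} (x y : EuclideanSpace ℝ (Fin n)) :
    peval (linForm x) y = inner ℝ x y := by
  simp [peval, linForm, PiLp.inner_apply, mul_comm]

lemma pderiv_linForm {n : ℕ} (x : EuclideanSpace ℝ (Fin n)) (i : Fin n) :
    MvPolynomial.pderiv i (linForm x) = MvPolynomial.C (x i) := by
  rw [linForm, map_sum, Finset.sum_eq_single i]
  · simp
  · intro j _ hj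
    simp [MvPolynomial.pderiv_X_of_ne hj]
  · simp

/-- The eigenvalues of the kernels `⟨x, y⟩ ^ k` on harmonic polynomials of degree `m`, with respect
to the Gaussian measure. -/
def heckeCoef : ℕ → ℕ → ℝ
  | 0, 0 => 1
  | 0, _ + 1 => 0
  -- The truncated `m - 1` is harmless here and below: at `m = 0` the factor `m` vanishes.
  | 1, m => m * heckeCoef 0 (m - 1)
  | k + 2, m => (k + 1) * heckeCoef k m + m * heckeCoef (k + 1) (m - 1)

/-- One factor `⟨x, y⟩ = ∑ x_i y_i` is removed by integration by parts. The derivative falls on the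
other powers, where `∑ x_i² = 1` appears, or on `f`. For `k = 0` the truncated exponent `k - 1` has
coefficient zero. -/
lemma gint_pow_succ_mul {n m : ℕ} (hn : 0 < n) {f : MvPolynomial (Fin n) ℝ}
    (hf : f.IsHomogeneous m) (x : EuclideanSpace ℝ (Fin n)) (hx : ‖x‖ = 1) (k : ℕ) :
    gint (linForm x ^ (k + 1) * f) = k * gint (linForm x ^ (k - 1) * f) +
      ∑ i, x i * gint (linForm x ^ k * MvPolynomial.pderiv i f) := by
  have hk : ∀ j, (linForm x ^ j).IsHomogeneous j := fun j => by
    simpa using (isHomogeneous_linForm x).pow j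
  have e1 : linForm x ^ (k + 1) * f =
      ∑ i, MvPolynomial.C (x i) * (MvPolynomial.X i * (linForm x ^ k * f)) := by
    rw [pow_succ, mul_right_comm, mul_comm, linForm, Finset.sum_mul]
    exact Finset.sum_congr rfl fun i _ => by rw [mul_assoc]
  have e2 : ∀ i, gint (MvPolynomial.X i * (linForm x ^ k * f)) =
      x i * (k * gint (linForm x ^ (k - 1) * f)) +
        gint (linForm x ^ k * MvPolynomial.pderiv i f) := by
    intro i
    rw [gint, stein hn ((hk k).mul hf), ← gint]
    have : MvPolynomial.pderiv i (linForm x ^ k * f) =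
        MvPolynomial.C (x i * k) * (linForm x ^ (k - 1) * f) +
          linForm x ^ k * MvPolynomial.pderiv i f := by
      rw [MvPolynomial.pderiv_mul, MvPolynomial.pderiv_pow, pderiv_linForm]
      simp only [map_mul, map_natCast]
      ring
    rw [this, gint_add hn (((hk (k - 1)).mul hf).C_mul _) ((hk k).mul hf.pderiv), gint_C_mul]
    ring
  have hx2 : ∑ i, x i * x i = 1 := by
    have := EuclideanSpace.norm_sq_eq x
    rw [hx] at this
    simpa [pow_two] using this.symm
  rw [e1, gint_sum hn _ _ (1 + (k + m)) fun i _ =>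
    ((MvPolynomial.isHomogeneous_X ℝ i).mul ((hk k).mul hf)).C_mul _]
  simp only [gint_C_mul, e2, mul_add, Finset.sum_add_distrib]
  congr 1
  simp only [← mul_assoc]
  rw [← Finset.sum_mul, ← Finset.sum_mul, hx2, one_mul]

lemma sum_mul_peval_pderiv {n m : ℕ} {f : MvPolynomial (Fin n) ℝ} (hf : f.IsHomogeneous m)
    (x : EuclideanSpace ℝ (Fin n)) :
    ∑ i, x i * peval (MvPolynomial.pderiv i f) x = m * peval f x := by
  have h := congrArg (fun p => peval p x) hf.sum_X_mul_pderiv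
  simpa [peval] using h

/-- Derivatives of harmonic polynomials are harmonic of degree `m - 1`, so the induction hypothesis
applies to each `∂_i f`, and Euler's identity at `x` recombines the values `x_i ∂_i f(x)` into `m
f(x)`. The constants then obey the recursion of `heckeCoef`. -/
lemma gint_linForm_pow_mul {n : ℕ} (hn : 0 < n) (x : EuclideanSpace ℝ (Fin n)) (hx : ‖x‖ = 1)
    (k : ℕ) : ∀ (m : ℕ) (f : MvPolynomial (Fin n) ℝ), f.IsHomogeneous m → laplacian n f = 0 →
      gint (linForm x ^ k * f) = gint (1 : MvPolynomial (Fin n) ℝ) * heckeCoef k m * peval f x := by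
  induction k using Nat.strong_induction_on with
  | _ k ih =>
    intro m f hf hl
    match k, ih with
    | 0, _ =>
      rw [pow_zero, one_mul]
      match m with
      | 0 =>
        obtain ⟨a, rfl⟩ := eq_C_of_isHomogeneous_zero hf
        have := gint_C_mul a (1 : MvPolynomial (Fin n) ℝ)
        rw [mul_one] at this
        rw [this, heckeCoef]
        simp [peval, mul_comm]
      | m + 1 =>
        -- A harmonic polynomial of positive degree has Gaussian mean zero: by Euler and integration
        -- by parts, its mean times the degree is the mean of its Laplacian.
        have h1 : gint (∑ i, MvPolynomial.X i * MvPolynomial.pderiv i f) = 0 := by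
          rw [gint_sum hn _ _ (1 + (m + 1 - 1)) fun i _ =>
            (MvPolynomial.isHomogeneous_X ℝ i).mul hf.pderiv]
          simp only [gint]
          rw [Finset.sum_congr rfl fun i _ => stein hn hf.pderiv i]
          have := gint_sum hn Finset.univ
            (fun i => MvPolynomial.pderiv i (MvPolynomial.pderiv i f)) _
            fun i _ => hf.pderiv.pderiv
          rw [← laplacian_apply, hl] at this
          simp only [gint] at this
          rw [← this]
          simp [peval]
        rw [hf.sum_X_mul_pderiv] at h1
        have h2 : (m + 1) • f = MvPolynomial.C ((m + 1 : ℕ) : ℝ) * f := by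
          rw [nsmul_eq_mul, map_natCast]
        rw [h2, gint_C_mul] at h1
        have : gint f = 0 := by
          rcases mul_eq_zero.1 h1 with h | h
          · exact absurd h (by positivity)
          · exact h
        rw [this, heckeCoef]; ring
    | 1, ih =>
      rw [gint_pow_succ_mul hn hf x hx 0, Finset.sum_congr rfl fun i _ => by
        rw [ih 0 (by omega) (m - 1) _ hf.pderiv (laplacian_pderiv i hl)]]
      have := sum_mul_peval_pderiv hf x
      simp only [mul_left_comm (x.ofLp _), ← Finset.mul_sum, this]
      rw [heckeCoef]
      push_cast
      ring
    | k + 2, ih =>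
      rw [gint_pow_succ_mul hn hf x hx (k + 1), Finset.sum_congr rfl fun i _ => by
        rw [ih (k + 1) (by omega) (m - 1) _ hf.pderiv (laplacian_pderiv i hl)],
        show k + 1 - 1 = k by omega, ih k (by omega) m f hf hl]
      have := sum_mul_peval_pderiv hf x
      simp only [mul_left_comm (x.ofLp _), ← Finset.mul_sum, this]
      rw [heckeCoef]
      push_cast
      ring

lemma heckeCoef_eq_zero (k : ℕ) : ∀ m, k < m → heckeCoef k m = 0 := by
  induction k using Nat.strong_induction_on with
  | _ k ih =>
    intro m hm
    match k, ih with
    | 0, _ =>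
      obtain ⟨m, rfl⟩ := Nat.exists_eq_succ_of_ne_zero hm.ne'
      rw [heckeCoef]
    | 1, ih => rw [heckeCoef, ih 0 (by omega) _ (by omega), mul_zero]
    | k + 2, ih =>
      rw [heckeCoef, ih k (by omega) _ (by omega), ih (k + 1) (by omega) _ (by omega)]
      ring

/-- On the diagonal only the second term of the recursion survives, so the value is `m!`. -/
lemma heckeCoef_self_pos (m : ℕ) : 0 < heckeCoef m m := by
  induction m with
  | zero => simp [heckeCoef]
  | succ m ih =>
    match m, ih with
    | 0, _ => simp [heckeCoef]
    | m + 1, ih =>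
      rw [heckeCoef, heckeCoef_eq_zero m _ (by omega), mul_zero, zero_add]
      simp only [Nat.add_sub_cancel]
      positivity

lemma gint_one_pos {n : ℕ} (hn : 0 < n) : 0 < gint (1 : MvPolynomial (Fin n) ℝ) := by
  have : Nontrivial (EuclideanSpace ℝ (Fin n)) := nontrivial_euclidean hn
  rw [gint, integral_peval_gauss hn (MvPolynomial.isHomogeneous_one _ _)]
  refine mul_pos (radialMoment_pos _ _) ?_
  simp only [peval, map_one, integral_const, smul_eq_mul, mul_one]
  rw [measureReal_def, ENNReal.toReal_pos_iff]
  refine ⟨?_, measure_lt_top _ _⟩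
  rw [Measure.measure_univ_pos]
  exact Measure.toSphere_ne_zero _

/-- The Funk–Hecke formula for the kernels `⟨x, y⟩ ^ k`. -/
lemma funkHecke_pow {n : ℕ} (hn : 0 < n) (k m : ℕ) : ∃ c : ℝ, (k < m → c = 0) ∧ (k = m → 0 < c) ∧
    ∀ f ∈ harmonics n m, ∀ x : Sph n,
      ∫ y : Sph n, (inner ℝ x.1 y.1) ^ k * f y ∂(surf n) = c * f x := by
  refine ⟨(radialMoment n (k + m))⁻¹ * (gint (1 : MvPolynomial (Fin n) ℝ) * heckeCoef k m),
    fun h => by rw [heckeCoef_eq_zero k m h, mul_zero, mul_zero], ?_, ?_⟩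
  · rintro rfl
    exact mul_pos (inv_pos.2 (radialMoment_pos _ _))
      (mul_pos (gint_one_pos hn) (heckeCoef_self_pos _))
  · rintro _ ⟨p, ⟨hp, hl⟩, rfl⟩ x
    have hx : ‖x.1‖ = 1 := by simp
    have h1 := gint_linForm_pow_mul hn x.1 hx k m p hp hl
    have hk : (linForm x.1 ^ k).IsHomogeneous k := by
      simpa using (isHomogeneous_linForm x.1).pow k
    rw [gint, integral_peval_gauss hn (hk.mul hp)] at h1
    rw [restrictSphere_apply, mul_assoc, ← h1, ← mul_assoc,
      inv_mul_cancel₀ (radialMoment_pos _ _).ne', one_mul]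
    refine integral_congr_ae (.of_forall fun y => ?_)
    have := peval_linForm x.1 y.1
    simp only [peval, map_mul, map_pow, restrictSphere_apply] at this ⊢
    rw [this]

/-! ### Orthogonality and completeness of the spherical harmonics -/

lemma Continuous.integrable_sphere {n : ℕ} {E : Type*} [NormedAddCommGroup E] {f : Sph n → E}
    (hf : Continuous f) : Integrable f (surf n) :=
  hf.integrable_of_hasCompactSupport (HasCompactSupport.of_compactSpace _)

lemma Continuous.integrable_sphere_prod {n : ℕ} {E : Type*} [NormedAddCommGroup E]
    {f : Sph n × Sph n → E} (hf : Continuous f) : Integrable f ((surf n).prod (surf n)) :=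
  hf.integrable_of_hasCompactSupport (HasCompactSupport.of_compactSpace _)

lemma continuous_of_mem_harmonics {n m : ℕ} {f : Sph n → ℝ} (hf : f ∈ harmonics n m) :
    Continuous f := by
  obtain ⟨p, -, rfl⟩ := hf
  have : restrictSphere n p = fun x : Sph n => peval p x.1 := funext (restrictSphere_apply p)
  rw [this]
  exact continuous_peval_sphere p

lemma inner_mem_Icc {n : ℕ} (x y : Sph n) :
    (inner ℝ x.1 y.1 : ℝ) ∈ Set.Icc (-1 : ℝ) 1 := by
  have h := abs_real_inner_le_norm x.1 y.1
  have hx : ‖x.1‖ = 1 := by simp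
  have hy : ‖y.1‖ = 1 := by simp
  rw [hx, hy, one_mul] at h
  exact abs_le.1 h

lemma integral_prod_kernel {n : ℕ} {φ : ℝ → ℝ} (hφ : Continuous φ) {f g : Sph n → ℝ}
    (hf : Continuous f) (hg : Continuous g) (c : ℝ)
    (h : ∀ x : Sph n, ∫ y : Sph n, φ (inner ℝ x.1 y.1) * f y ∂(surf n) = c * f x) :
    ∫ z : Sph n × Sph n, φ (inner ℝ z.1.1 z.2.1) * (f z.2 * g z.1) ∂((surf n).prod (surf n)) =
      c * ∫ x, f x * g x ∂(surf n) := by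
  rw [integral_prod _ (Continuous.integrable_sphere_prod (by fun_prop)), ← integral_const_mul]
  refine integral_congr_ae (.of_forall fun x => ?_)
  simp only [← mul_assoc, ← h x]
  rw [integral_mul_const]

/-- The symmetric kernel `⟨x, y⟩ ^ m` multiplies degree `m` by a positive constant and annihilates
the larger degree `m'`. Evaluating the double integral of the kernel against `f` and `g` in both
orders forces `∫ f g = 0`. -/
lemma harmonics_orthogonal {n m m' : ℕ} (hn : 0 < n) (hm : m < m') {f g : Sph n → ℝ}
    (hf : f ∈ harmonics n m) (hg : g ∈ harmonics n m') : ∫ x, f x * g x ∂(surf n) = 0 := by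
  have hfc := continuous_of_mem_harmonics hf
  have hgc := continuous_of_mem_harmonics hg
  obtain ⟨c, -, hc, h⟩ := funkHecke_pow hn m m
  obtain ⟨c', hc', -, h'⟩ := funkHecke_pow hn m m'
  have h1 := integral_prod_kernel (φ := fun u => u ^ m) (by fun_prop) hfc hgc c (h f hf)
  have h2 := integral_prod_kernel (φ := fun u => u ^ m) (by fun_prop) hgc hfc c' (h' g hg)
  rw [← integral_prod_swap] at h2
  have h3 : ∫ z : Sph n × Sph n, (inner ℝ z.1.1 z.2.1 : ℝ) ^ m * (f z.2 * g z.1)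
      ∂((surf n).prod (surf n)) = c' * ∫ x, g x * f x ∂(surf n) := by
    rw [← h2]
    refine integral_congr_ae (.of_forall fun z => ?_)
    simp only [Prod.fst_swap, Prod.snd_swap, real_inner_comm, mul_comm]
  rw [h3, hc' hm, zero_mul] at h1
  exact (mul_eq_zero.1 h1.symm).resolve_left (hc rfl).ne'

lemma funkHecke_polynomial {n : ℕ} (hn : 0 < n) (m : ℕ) (q : Polynomial ℝ) : ∃ c : ℝ,
    ∀ f ∈ harmonics n m, ∀ x : Sph n,
      ∫ y : Sph n, q.eval (inner ℝ x.1 y.1) * f y ∂(surf n) = c * f x := by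
  induction q using Polynomial.induction_on' with
  | add p q hp hq =>
    obtain ⟨c, hc⟩ := hp
    obtain ⟨c', hc'⟩ := hq
    refine ⟨c + c', fun f hf x => ?_⟩
    have hfc := continuous_of_mem_harmonics hf
    rw [add_mul, ← hc f hf x, ← hc' f hf x, ← integral_add]
    · simp [add_mul]
    · exact Continuous.integrable_sphere (by fun_prop)
    · exact Continuous.integrable_sphere (by fun_prop)
  | monomial k a =>
    obtain ⟨c, -, -, hc⟩ := funkHecke_pow hn k m
    refine ⟨a * c, fun f hf x => ?_⟩
    rw [mul_assoc, ← hc f hf x, ← integral_const_mul]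
    simp [mul_assoc]

/-- For polynomial kernels Funk–Hecke gives a multiple of `∫ f g = 0`; Weierstrass approximation on
`[-1, 1]` extends this to continuous kernels. The bound uses `K + 1` so that `K = 0` needs no
separate case. -/
lemma integral_isotropic_real {n m : ℕ} (hn : 0 < n) {f g : Sph n → ℝ} (hf : f ∈ harmonics n m)
    (hg : Continuous g) (hfg : ∫ x, f x * g x ∂(surf n) = 0) {φ : ℝ → ℝ}
    (hφ : ContinuousOn φ (Set.Icc (-1) 1))
    (hφc : Continuous fun z : Sph n × Sph n => φ (inner ℝ z.1.1 z.2.1)) :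
    ∫ z : Sph n × Sph n, φ (inner ℝ z.1.1 z.2.1) * (f z.2 * g z.1) ∂((surf n).prod (surf n)) =
      0 := by
  have hfc := continuous_of_mem_harmonics hf
  set K : ℝ := ∫ z : Sph n × Sph n, |f z.2 * g z.1| ∂((surf n).prod (surf n))
  have hK : 0 ≤ K := integral_nonneg fun _ => abs_nonneg _
  rw [← abs_eq_zero]
  refine le_antisymm (le_of_forall_pos_le_add fun ε hε => ?_) (abs_nonneg _)
  obtain ⟨q, hq⟩ := exists_polynomial_near_of_continuousOn (-1) 1 φ hφ (ε / (K + 1)) (by positivity)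
  obtain ⟨c, hc⟩ := funkHecke_polynomial hn m q
  have h0 := integral_prod_kernel q.continuous hfc hg c (hc f hf)
  rw [hfg, mul_zero] at h0
  have i1 : Integrable (fun z : Sph n × Sph n => φ (inner ℝ z.1.1 z.2.1) * (f z.2 * g z.1))
      ((surf n).prod (surf n)) := Continuous.integrable_sphere_prod (hφc.mul (by fun_prop))
  have i2 : Integrable (fun z : Sph n × Sph n => q.eval (inner ℝ z.1.1 z.2.1) * (f z.2 * g z.1))
      ((surf n).prod (surf n)) := Continuous.integrable_sphere_prod (by fun_prop)
  have i3 : Integrable (fun z : Sph n × Sph n => |f z.2 * g z.1|)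
      ((surf n).prod (surf n)) := Continuous.integrable_sphere_prod (by fun_prop)
  rw [zero_add, ← sub_zero (∫ z : Sph n × Sph n, φ (inner ℝ z.1.1 z.2.1) * (f z.2 * g z.1)
    ∂((surf n).prod (surf n))), ← h0, ← integral_sub i1 i2, ← Real.norm_eq_abs]
  calc _ ≤ ∫ z : Sph n × Sph n, ε / (K + 1) * |f z.2 * g z.1| ∂((surf n).prod (surf n)) := by
        refine norm_integral_le_of_norm_le (i3.const_mul _) (.of_forall fun z => ?_)
        rw [← sub_mul, Real.norm_eq_abs, abs_mul]
        refine mul_le_mul_of_nonneg_right ?_ (abs_nonneg _)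
        rw [abs_sub_comm]
        exact (hq _ (inner_mem_Icc z.1 z.2)).le
    _ = ε * (K / (K + 1)) := by rw [integral_const_mul]; ring
    _ ≤ ε := by
        have : K / (K + 1) ≤ 1 := (div_le_one (by positivity)).2 (by linarith)
        nlinarith

lemma integral_isotropic {n m : ℕ} (hn : 0 < n) {f g : Sph n → ℝ} (hf : f ∈ harmonics n m)
    (hg : Continuous g) (hfg : ∫ x, f x * g x ∂(surf n) = 0) {φ : ℝ → ℂ}
    (hφ : ContinuousOn φ (Set.Icc (-1) 1)) :
    ∫ z : Sph n × Sph n, φ (inner ℝ z.1.1 z.2.1) * ((f z.2 * g z.1 : ℝ) : ℂ)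
      ∂((surf n).prod (surf n)) = 0 := by
  have hfc := continuous_of_mem_harmonics hf
  have hφc : Continuous fun z : Sph n × Sph n => φ (inner ℝ z.1.1 z.2.1) :=
    hφ.comp_continuous (by fun_prop) fun z => inner_mem_Icc z.1 z.2
  have hi : Integrable (fun z : Sph n × Sph n => φ (inner ℝ z.1.1 z.2.1) *
      ((f z.2 * g z.1 : ℝ) : ℂ)) ((surf n).prod (surf n)) :=
    Continuous.integrable_sphere_prod (hφc.mul (by fun_prop))
  apply Complex.ext
  · have h := Complex.reCLM.integral_comp_comm hi
    simp only [Complex.reCLM_apply, Complex.re_mul_ofReal] at h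
    rw [← h]
    exact integral_isotropic_real hn hf hg hfg (φ := fun u => (φ u).re)
      (Complex.continuous_re.comp_continuousOn hφ) (Complex.continuous_re.comp hφc)
  · have h := Complex.imCLM.integral_comp_comm hi
    simp only [Complex.imCLM_apply, Complex.im_mul_ofReal] at h
    rw [← h]
    exact integral_isotropic_real hn hf hg hfg (φ := fun u => (φ u).im)
      (Complex.continuous_im.comp_continuousOn hφ) (Complex.continuous_im.comp hφc)

/-! ### Orthonormality across degrees and completeness of a harmonic basis -/

namespace IsHarmonicBasis

variable {n : ℕ} {Y : (m : ℕ) → Fin (harmonicCount n m) → Sph n → ℝ}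

lemma mem (hY : IsHarmonicBasis Y) (p : HIdx n) : Y p.1 p.2 ∈ harmonics n p.1 := by
  rw [← hY.span_eq]
  exact Submodule.subset_span ⟨_, rfl⟩

lemma continuous (hY : IsHarmonicBasis Y) (p : HIdx n) : Continuous (Y p.1 p.2) :=
  continuous_of_mem_harmonics (hY.mem p)

lemma integral_self (hY : IsHarmonicBasis Y) (p : HIdx n) :
    ∫ x, Y p.1 p.2 x * Y p.1 p.2 x ∂(surf n) = 1 := by
  rw [hY.orthonormal]; simp

lemma integral_of_ne (hY : IsHarmonicBasis Y) (hn : 0 < n) {p p' : HIdx n} (h : p ≠ p') :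
    ∫ x, Y p.1 p.2 x * Y p'.1 p'.2 x ∂(surf n) = 0 := by
  rcases lt_trichotomy p.1 p'.1 with hlt | heq | hlt
  · exact harmonics_orthogonal hn hlt (hY.mem p) (hY.mem p')
  · obtain ⟨m, l⟩ := p
    obtain ⟨m', l'⟩ := p'
    obtain rfl : m = m' := heq
    simp only at *
    rw [hY.orthonormal, if_neg]
    rintro rfl
    exact h rfl
  · simp only [mul_comm (Y p.1 p.2 _)]
    exact harmonics_orthogonal hn hlt (hY.mem p') (hY.mem p)

/-- The polynomial functions on the sphere. -/
def _root_.SphereField.polySubalgebra (n : ℕ) : Subalgebra ℝ C(Sph n, ℝ) where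
  carrier := {g | ∃ p, ∀ x, g x = restrictSphere n p x}
  mul_mem' := by
    rintro a b ⟨p, hp⟩ ⟨q, hq⟩
    exact ⟨p * q, fun x => by
      rw [ContinuousMap.mul_apply, hp, hq]; simp [restrictSphere_apply, peval]⟩
  add_mem' := by
    rintro a b ⟨p, hp⟩ ⟨q, hq⟩
    exact ⟨p + q, fun x => by
      rw [ContinuousMap.add_apply, hp, hq]; simp [restrictSphere_apply, peval]⟩
  algebraMap_mem' r := ⟨MvPolynomial.C r, fun x => by simp [restrictSphere_apply, peval]⟩

lemma _root_.SphereField.polySubalgebra_separatesPoints (n : ℕ) :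
    (polySubalgebra n).SeparatesPoints := by
  intro x y hxy
  have : ∃ i, x.1 i ≠ y.1 i := by
    by_contra! h
    exact hxy (Subtype.ext (PiLp.ext h))
  obtain ⟨i, hi⟩ := this
  refine ⟨fun x => x.1 i, ⟨⟨fun x : Sph n => x.1 i, by fun_prop⟩,
    ⟨MvPolynomial.X i, fun x => ?_⟩, rfl⟩, hi⟩
  simp [restrictSphere_apply, peval]

/-- The continuous functions orthogonal to `f` form a subspace. It contains every space of
harmonics, hence all restrictions of polynomials. -/
lemma integral_restrictSphere_mul (hY : IsHarmonicBasis Y) (hn : 0 < n) {f : Sph n → ℂ}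
    (hf : Integrable f (surf n)) (h : ∀ p : HIdx n, ∫ x, (Y p.1 p.2 x : ℂ) * f x ∂(surf n) = 0)
    (q : MvPolynomial (Fin n) ℝ) : ∫ x, (restrictSphere n q x : ℂ) * f x ∂(surf n) = 0 := by
  have hint : ∀ {g : Sph n → ℝ}, Continuous g → Integrable (fun x => (g x : ℂ) * f x) (surf n) := by
    intro g hg
    obtain ⟨C, hC⟩ :=
      (isCompact_univ : IsCompact (Set.univ : Set (Sph n))).exists_bound_of_continuousOn
      hg.continuousOn
    exact hf.bdd_mul (c := C) (Continuous.aestronglyMeasurable (by fun_prop))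
      (.of_forall fun x => by simpa using hC x trivial)
  let W : Submodule ℝ (Sph n → ℝ) :=
    { carrier := {g | Continuous g ∧ ∫ x, (g x : ℂ) * f x ∂(surf n) = 0}
      add_mem' := by
        rintro a b ⟨ha, ha'⟩ ⟨hb, hb'⟩
        refine ⟨ha.add hb, ?_⟩
        simp only [Pi.add_apply, Complex.ofReal_add, add_mul]
        rw [integral_add (hint ha) (hint hb), ha', hb', add_zero]
      zero_mem' := ⟨continuous_const, by simp⟩
      smul_mem' := by
        rintro c a ⟨ha, ha'⟩
        refine ⟨ha.const_smul c, ?_⟩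
        simp only [Pi.smul_apply, smul_eq_mul, Complex.ofReal_mul, mul_assoc]
        rw [integral_const_mul, ha', mul_zero] }
  have hW : ⨆ m, harmonics n m ≤ W := by
    refine iSup_le fun m => ?_
    rw [← hY.span_eq, Submodule.span_le]
    rintro _ ⟨l, rfl⟩
    exact ⟨hY.continuous ⟨m, l⟩, h ⟨m, l⟩⟩
  exact (hW (restrictSphere_mem hn q)).2

/-- Stone–Weierstrass: polynomials are uniformly dense in the continuous functions on the sphere,
and `f` is integrable. -/
lemma integral_continuous_mul (hY : IsHarmonicBasis Y) (hn : 0 < n) {f : Sph n → ℂ}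
    (hf : Integrable f (surf n)) (h : ∀ p : HIdx n, ∫ x, (Y p.1 p.2 x : ℂ) * f x ∂(surf n) = 0)
    {g : Sph n → ℝ} (hg : Continuous g) : ∫ x, (g x : ℂ) * f x ∂(surf n) = 0 := by
  have hint : ∀ {g : Sph n → ℝ}, Continuous g → Integrable (fun x => (g x : ℂ) * f x) (surf n) := by
    intro g hg
    obtain ⟨C, hC⟩ :=
      (isCompact_univ : IsCompact (Set.univ : Set (Sph n))).exists_bound_of_continuousOn
      hg.continuousOn
    exact hf.bdd_mul (c := C) (Continuous.aestronglyMeasurable (by fun_prop))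
      (.of_forall fun x => by simpa using hC x trivial)
  set K : ℝ := ∫ x, ‖f x‖ ∂(surf n)
  have hK : 0 ≤ K := integral_nonneg fun _ => norm_nonneg _
  rw [← norm_eq_zero]
  refine le_antisymm (le_of_forall_pos_le_add fun ε hε => ?_) (norm_nonneg _)
  obtain ⟨⟨q, p, hp⟩, hq⟩ :=
    ContinuousMap.exists_mem_subalgebra_near_continuous_of_separatesPoints (polySubalgebra n)
      (polySubalgebra_separatesPoints n) g hg (ε / (K + 1)) (by positivity)
  have h0 : ∫ x, (q x : ℂ) * f x ∂(surf n) = 0 := by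
    simp only [hp]
    exact hY.integral_restrictSphere_mul hn hf h p
  rw [zero_add, ← sub_zero (∫ x, (g x : ℂ) * f x ∂(surf n)), ← h0,
    ← integral_sub (hint hg) (hint q.continuous)]
  calc _ ≤ ∫ x, ε / (K + 1) * ‖f x‖ ∂(surf n) := by
        refine norm_integral_le_of_norm_le (hf.norm.const_mul _) (.of_forall fun x => ?_)
        rw [← sub_mul, norm_mul]
        refine mul_le_mul_of_nonneg_right ?_ (norm_nonneg _)
        rw [← Complex.ofReal_sub, Complex.norm_real, norm_sub_rev]
        exact (hq x).le
    _ = ε * (K / (K + 1)) := by rw [integral_const_mul]; ring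
    _ ≤ ε := by
        have : K / (K + 1) ≤ 1 := (div_le_one (by positivity)).2 (by linarith)
        nlinarith

/-- Completeness of the spherical harmonics in `L₂` of the sphere. -/
lemma ae_eq_zero (hY : IsHarmonicBasis Y) (hn : 0 < n) {f : Sph n → ℂ} (hf : MemLp f 2 (surf n))
    (h : ∀ p : HIdx n, ∫ x, (Y p.1 p.2 x : ℂ) * f x ∂(surf n) = 0) : f =ᵐ[surf n] 0 := by
  have hfi : Integrable f (surf n) := hf.integrable (by norm_num)
  have h0 : hf.toLp f = 0 := by
    refine Dense.eq_zero_of_inner_right ℂ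
      (ContinuousMap.toLp_denseRange ℂ (surf n) (p := 2) ℂ (by norm_num)) ?_
    rintro _ ⟨g, rfl⟩
    rw [L2.inner_def]
    have e : ∀ᵐ x ∂(surf n), inner ℂ ((ContinuousMap.toLp 2 (surf n) ℂ g : Lp ℂ 2 (surf n)) x)
        (hf.toLp f x) = ((g x).re : ℂ) * f x - Complex.I * (((g x).im : ℂ) * f x) := by
      filter_upwards [ContinuousMap.coeFn_toLp (surf n) (p := 2) (𝕜 := ℂ) g, hf.coeFn_toLp]
        with x h1 h2
      rw [h1, h2, RCLike.inner_apply]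
      have : conj (g x) = ((g x).re : ℂ) - (g x).im * Complex.I := by
        apply Complex.ext <;> simp
      rw [this]
      ring
    rw [integral_congr_ae e, integral_sub, integral_const_mul,
      hY.integral_continuous_mul hn hfi h (g := fun x => (g x).re) (by fun_prop),
      hY.integral_continuous_mul hn hfi h (g := fun x => (g x).im) (by fun_prop)]
    · simp
    all_goals
      obtain ⟨C, hC⟩ :=
        (isCompact_univ : IsCompact (Set.univ : Set (Sph n))).exists_bound_of_continuousOn
        g.continuous.continuousOn
      try apply Integrable.const_mul
      refine hfi.bdd_mul (c := C) (Continuous.aestronglyMeasurable (by fun_prop))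
        (.of_forall fun x => ?_)
      rw [Complex.norm_real, Real.norm_eq_abs]
    · exact (Complex.abs_re_le_norm _).trans (hC x trivial)
    · exact (Complex.abs_im_le_norm _).trans (hC x trivial)
  have := hf.coeFn_toLp
  rw [h0] at this
  filter_upwards [this, Lp.coeFn_zero ℂ 2 (surf n)] with x h1 h2
  rw [← h1, h2]

end IsHarmonicBasis

/-! ### Square integrable functions and complete orthonormal families -/

lemma lintegral_mul_sq_le {X : Type*} [MeasurableSpace X] {μ : Measure X} {f g : X → ℝ≥0∞}
    (hf : AEMeasurable f μ) (hg : AEMeasurable g μ) :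
    (∫⁻ x, f x * g x ∂μ) ^ 2 ≤ (∫⁻ x, f x ^ 2 ∂μ) * ∫⁻ x, g x ^ 2 ∂μ := by
  have h := ENNReal.lintegral_mul_le_Lp_mul_Lq μ (p := 2) (q := 2) Real.HolderConjugate.two_two hf hg
  simp only [ENNReal.rpow_two, Pi.mul_apply] at h
  calc _ ≤ ((∫⁻ x, f x ^ 2 ∂μ) ^ (1 / 2 : ℝ) * (∫⁻ x, g x ^ 2 ∂μ) ^ (1 / 2 : ℝ)) ^ 2 := by gcongr
    _ = _ := by
      rw [mul_pow, ← ENNReal.rpow_two, ← ENNReal.rpow_two, ← ENNReal.rpow_mul, ← ENNReal.rpow_mul]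
      norm_num

/-- This is Cauchy–Schwarz for the counting measure on the discrete σ-algebra. -/
lemma tsum_mul_sq_le {I : Type*} (f g : I → ℝ≥0∞) :
    (∑' i, f i * g i) ^ 2 ≤ (∑' i, f i ^ 2) * ∑' i, g i ^ 2 := by
  let _ : MeasurableSpace I := ⊤
  have h := lintegral_mul_sq_le (μ := Measure.count) (f := f) (g := g)
    (measurable_from_top).aemeasurable (measurable_from_top).aemeasurable
  simpa only [lintegral_count] using h

lemma memLp_two_iff {X E : Type*} [MeasurableSpace X] [NormedAddCommGroup E] {μ : Measure X}
    {f : X → E} :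
    MemLp f 2 μ ↔ AEStronglyMeasurable f μ ∧ ∫⁻ x, ‖f x‖ₑ ^ 2 ∂μ < ∞ := by
  unfold MemLp
  rw [eLpNorm_lt_top_iff_lintegral_rpow_enorm_lt_top (by norm_num) (by norm_num)]
  simp

lemma eLpNorm_two_sq {X E : Type*} [MeasurableSpace X] [NormedAddCommGroup E] {μ : Measure X}
    (f : X → E) : eLpNorm f 2 μ ^ 2 = ∫⁻ x, ‖f x‖ₑ ^ 2 ∂μ := by
  rw [eLpNorm_eq_lintegral_rpow_enorm_toReal (by norm_num) (by norm_num), ← ENNReal.rpow_two,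
    ← ENNReal.rpow_mul]
  simp

lemma enorm_sq_eq_ofReal (z : ℂ) : ‖z‖ₑ ^ 2 = ENNReal.ofReal (‖z‖ ^ 2) := by
  rw [← ofReal_norm, ENNReal.ofReal_pow (norm_nonneg _)]

lemma tsum_enorm_sq_lt_top_iff {I : Type*} {c : I → ℂ} :
    ∑' i, ‖c i‖ₑ ^ 2 < ∞ ↔ Summable fun i => ‖c i‖ ^ 2 := by
  constructor
  · intro h
    have := ENNReal.summable_toReal h.ne
    refine this.congr fun i => ?_
    rw [enorm_sq_eq_ofReal, ENNReal.toReal_ofReal (by positivity)]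
  · intro h
    simp only [enorm_sq_eq_ofReal]
    exact h.tsum_ofReal_lt_top

lemma tsum_enorm_sq {I : Type*} {c : I → ℂ} {a : ℝ} (h : HasSum (fun i => ‖c i‖ ^ 2) a) :
    ∑' i, ‖c i‖ₑ ^ 2 = ENNReal.ofReal a := by
  simp only [enorm_sq_eq_ofReal]
  rw [← ENNReal.ofReal_tsum_of_nonneg (fun _ => by positivity) h.summable, h.tsum_eq]

/-- A complete orthonormal family of square integrable functions. -/
structure IsCompleteFamily {X I : Type*} [MeasurableSpace X] (μ : Measure X) (b : I → X → ℂ) :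
    Prop where
  memLp : ∀ i, MemLp (b i) 2 μ
  self : ∀ i, ∫ x, conj (b i x) * b i x ∂μ = 1
  ne : ∀ i j, i ≠ j → ∫ x, conj (b i x) * b j x ∂μ = 0
  complete : ∀ f, MemLp f 2 μ → (∀ i, ∫ x, conj (b i x) * f x ∂μ = 0) → f =ᵐ[μ] 0

/-- The coefficients of a function with respect to an orthonormal family. -/
def famCoef {X I : Type*} [MeasurableSpace X] (μ : Measure X) (b : I → X → ℂ) (f : X → ℂ) (i : I) :
    ℂ := ∫ x, conj (b i x) * f x ∂μ

lemma inner_toLp {X : Type*} [MeasurableSpace X] {μ : Measure X} {f g : X → ℂ}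
    (hf : MemLp f 2 μ) (hg : MemLp g 2 μ) :
    inner ℂ (hf.toLp f) (hg.toLp g) = ∫ x, conj (f x) * g x ∂μ := by
  rw [L2.inner_def]
  refine integral_congr_ae ?_
  filter_upwards [hf.coeFn_toLp, hg.coeFn_toLp] with x h1 h2
  rw [h1, h2, RCLike.inner_apply, mul_comm]

lemma integrable_conj_mul {X : Type*} [MeasurableSpace X] {μ : Measure X} {f g : X → ℂ}
    (hf : MemLp f 2 μ) (hg : MemLp g 2 μ) : Integrable (fun x => conj (f x) * g x) μ := by
  have : MemLp (fun x => conj (f x)) 2 μ := hf.star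
  exact this.integrable_mul hg

lemma integral_conj_mul_self {X : Type*} [MeasurableSpace X] {μ : Measure X} {f : X → ℂ} :
    ∫ x, conj (f x) * f x ∂μ = ((∫ x, ‖f x‖ ^ 2 ∂μ : ℝ) : ℂ) := by
  rw [← integral_complex_ofReal]
  refine integral_congr_ae (.of_forall fun x => ?_)
  simp only [Complex.conj_mul']
  push_cast
  rfl

namespace IsCompleteFamily

variable {X I : Type*} [MeasurableSpace X] {μ : Measure X} {b : I → X → ℂ}

/-- The Hilbert basis of `L₂` formed by a complete orthonormal family. -/
def basis (hb : IsCompleteFamily μ b) : HilbertBasis I ℂ (Lp ℂ 2 μ) :=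
  HilbertBasis.mkOfOrthogonalEqBot (v := fun i => (hb.memLp i).toLp (b i))
    (by
      classical
      rw [orthonormal_iff_ite]
      intro i j
      rw [inner_toLp]
      split_ifs with h
      · subst h; exact hb.self i
      · exact hb.ne i j h)
    (by
      rw [Submodule.eq_bot_iff]
      intro f hf
      rw [Submodule.mem_orthogonal] at hf
      have : f =ᵐ[μ] 0 := by
        refine hb.complete f (Lp.memLp f) fun i => ?_
        have := hf _ (Submodule.subset_span ⟨i, rfl⟩)
        rw [← Lp.toLp_coeFn f (Lp.memLp f), inner_toLp] at this
        exact this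
      exact (Lp.eq_zero_iff_ae_eq_zero).2 this)

lemma basis_apply (hb : IsCompleteFamily μ b) (i : I) :
    hb.basis i = (hb.memLp i).toLp (b i) := by
  rw [basis, HilbertBasis.coe_mkOfOrthogonalEqBot]

lemma inner_basis (hb : IsCompleteFamily μ b) {f : X → ℂ} (hf : MemLp f 2 μ) (i : I) :
    inner ℂ (hb.basis i) (hf.toLp f) = famCoef μ b f i := by
  rw [basis_apply, inner_toLp, famCoef]

/-- Parseval's identity. -/
lemma hasSum_conj_mul (hb : IsCompleteFamily μ b) {f g : X → ℂ} (hf : MemLp f 2 μ)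
    (hg : MemLp g 2 μ) : HasSum (fun i => conj (famCoef μ b f i) * famCoef μ b g i)
      (∫ x, conj (f x) * g x ∂μ) := by
  have h := hb.basis.hasSum_inner_mul_inner (hf.toLp f) (hg.toLp g)
  rw [inner_toLp] at h
  simpa only [← inner_conj_symm (hf.toLp f), inner_basis] using h

lemma hasSum_norm_sq (hb : IsCompleteFamily μ b) {f : X → ℂ} (hf : MemLp f 2 μ) :
    HasSum (fun i => ‖famCoef μ b f i‖ ^ 2) (∫ x, ‖f x‖ ^ 2 ∂μ) := by
  have h := hb.hasSum_conj_mul hf hf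
  rw [integral_conj_mul_self] at h
  have h2 : ∀ i, conj (famCoef μ b f i) * famCoef μ b f i =
      ((‖famCoef μ b f i‖ ^ 2 : ℝ) : ℂ) := fun i => by
    rw [Complex.conj_mul']; push_cast; rfl
  simp only [h2] at h
  exact_mod_cast h

lemma tsum_enorm_sq_famCoef (hb : IsCompleteFamily μ b) {f : X → ℂ} (hf : MemLp f 2 μ) :
    ∑' i, ‖famCoef μ b f i‖ₑ ^ 2 = ∫⁻ x, ‖f x‖ₑ ^ 2 ∂μ := by
  rw [tsum_enorm_sq (hb.hasSum_norm_sq hf), ofReal_integral_eq_lintegral_ofReal]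
  · simp only [enorm_sq_eq_ofReal]
  · have := hf.integrable_norm_rpow (by norm_num) (by norm_num)
    simpa using this
  · exact .of_forall fun _ => by positivity

/-- The Riesz–Fischer theorem. -/
lemma exists_famCoef_eq (hb : IsCompleteFamily μ b) {c : I → ℂ} (hc : ∑' i, ‖c i‖ₑ ^ 2 < ∞) :
    ∃ f, MemLp f 2 μ ∧ ∀ i, famCoef μ b f i = c i := by
  have hm : Memℓp c 2 := by
    rw [memℓp_gen_iff (by norm_num)]
    simpa using tsum_enorm_sq_lt_top_iff.1 hc
  let f := hb.basis.repr.symm ⟨c, hm⟩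
  refine ⟨f, Lp.memLp f, fun i => ?_⟩
  rw [← hb.inner_basis (Lp.memLp f), Lp.toLp_coeFn, ← hb.basis.repr_apply_apply]
  simp [f]

end IsCompleteFamily

/-! ### Exponentials on an interval -/

lemma integral_exp_interval {a b : ℝ} (hab : a < b) (q : ℤ) :
    ∫ x in Set.Ico a b, Complex.exp (2 * Real.pi * Complex.I * q * x / ((b - a : ℝ) : ℂ)) =
      if q = 0 then ((b - a : ℝ) : ℂ) else 0 := by
  have hba : ((b - a : ℝ) : ℂ) ≠ 0 := by
    rw [Complex.ofReal_ne_zero]; exact (sub_pos.2 hab).ne'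
  rw [restrict_Ico_eq_restrict_Ioc, ← intervalIntegral.integral_of_le hab.le]
  split_ifs with h
  · subst h; simp
  · have hc : 2 * Real.pi * Complex.I * q / ((b - a : ℝ) : ℂ) ≠ 0 := by
      refine div_ne_zero ?_ hba
      simp [Real.pi_ne_zero, h]
    have e : ∀ x : ℝ, 2 * Real.pi * Complex.I * q * x / ((b - a : ℝ) : ℂ) =
        2 * Real.pi * Complex.I * q / ((b - a : ℝ) : ℂ) * x := fun x => by ring
    simp only [e]
    rw [integral_exp_mul_complex hc]
    have : 2 * Real.pi * Complex.I * q / ((b - a : ℝ) : ℂ) * b =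
        2 * Real.pi * Complex.I * q / ((b - a : ℝ) : ℂ) * a + q * (2 * Real.pi * Complex.I) := by
      have : (b : ℂ) = a + ((b - a : ℝ) : ℂ) := by push_cast; ring
      rw [this]
      field_simp
    rw [this, Complex.exp_add, Complex.exp_int_mul_two_pi_mul_I]
    simp

/-- By Parseval the `L₂` norm is the sum of the squared Fourier coefficients. The sign of the
exponent is immaterial, since all `q : ℤ` occur. -/
lemma ae_eq_zero_of_fourier {a b : ℝ} (hab : a < b) {f : ℝ → ℂ}
    (hf : MemLp f 2 (volume.restrict (Set.Ico a b)))
    (h : ∀ q : ℤ, ∫ x in Set.Ico a b,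
      Complex.exp (2 * Real.pi * Complex.I * q * x / ((b - a : ℝ) : ℂ)) * f x = 0) :
    f =ᵐ[volume.restrict (Set.Ico a b)] 0 := by
  rw [restrict_Ico_eq_restrict_Ioc] at *
  have hs := hasSum_sq_fourierCoeffOn hab hf
  have h0 : ∀ q, fourierCoeffOn hab f q = 0 := by
    intro q
    rw [fourierCoeffOn_eq_integral, intervalIntegral.integral_of_le hab.le]
    simp only [fourier_coe_apply, smul_eq_mul]
    rw [h (-q), smul_zero]
  simp only [h0, norm_zero, ne_eq, OfNat.ofNat_ne_zero, not_false_eq_true, zero_pow] at hs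
  have h1 := hs.unique hasSum_zero
  have hba : (b - a)⁻¹ ≠ 0 := inv_ne_zero (sub_pos.2 hab).ne'
  rw [smul_eq_zero, or_iff_right hba, intervalIntegral.integral_of_le hab.le,
    integral_eq_zero_iff_of_nonneg (fun _ => by positivity)] at h1
  · filter_upwards [h1] with x hx
    simpa using hx
  · have := hf.integrable_norm_rpow (by norm_num) (by norm_num)
    simpa using this

/-! ### Fourier coefficients on the circle -/

lemma expI_zero (w : ℝ) : expI 0 w = 1 := by simp [expI]

lemma expI_add (p q : ℤ) (w : ℝ) : expI (p + q) w = expI p w * expI q w := by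
  rw [expI, expI, expI, ← Complex.exp_add]
  congr 1
  push_cast
  ring

lemma conj_expI (q : ℤ) (w : ℝ) : conj (expI q w) = expI (-q) w := by
  rw [expI, expI, ← Complex.exp_conj]
  congr 1
  simp

lemma norm_expI (q : ℤ) (w : ℝ) : ‖expI q w‖ = 1 := by
  rw [expI, show Complex.I * (q : ℂ) * (w : ℂ) = ((q * w : ℝ) : ℂ) * Complex.I by push_cast; ring,
    Complex.norm_exp_ofReal_mul_I]

lemma enorm_expI (q : ℤ) (w : ℝ) : ‖expI q w‖ₑ = 1 := by
  rw [← ofReal_norm, norm_expI, ENNReal.ofReal_one]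

@[fun_prop]
lemma continuous_expI (q : ℤ) : Continuous (expI q) := by
  unfold expI
  fun_prop

instance : IsFiniteMeasure circ := by
  unfold circ; infer_instance

lemma memLp_expI (q : ℤ) : MemLp (expI q) 2 circ :=
  MemLp.of_bound (continuous_expI q).aestronglyMeasurable 1 (.of_forall fun w => (norm_expI q w).le)

lemma two_pi_pos : (0 : ℝ) < 2 * Real.pi := by positivity

lemma integral_expI (q : ℤ) :
    ∫ w, expI q w ∂circ = if q = 0 then ((2 * Real.pi : ℝ) : ℂ) else 0 := by
  have h := integral_exp_interval (a := -Real.pi) (b := Real.pi) (by linarith [Real.pi_pos]) q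
  rw [show Real.pi - -Real.pi = 2 * Real.pi by ring] at h
  rw [← h, circ]
  refine integral_congr_ae (.of_forall fun w => ?_)
  simp only [expI]
  congr 1
  have : (Real.pi : ℂ) ≠ 0 := by simp [Real.pi_ne_zero]
  push_cast
  field_simp

/-- The normalized exponentials. -/
def circFam (q : ℤ) (w : ℝ) : ℂ := ((1 / Real.sqrt (2 * Real.pi) : ℝ) : ℂ) * expI q w

lemma sqrt_two_pi_sq : ((1 / Real.sqrt (2 * Real.pi) : ℝ) : ℂ) *
    ((1 / Real.sqrt (2 * Real.pi) : ℝ) : ℂ) = ((1 / (2 * Real.pi) : ℝ) : ℂ) := by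
  rw [← Complex.ofReal_mul, div_mul_div_comm, Real.mul_self_sqrt two_pi_pos.le, one_mul]

lemma conj_circFam_mul (p q : ℤ) (w : ℝ) :
    conj (circFam p w) * circFam q w = ((1 / (2 * Real.pi) : ℝ) : ℂ) * expI (q - p) w := by
  rw [circFam, circFam, map_mul, Complex.conj_ofReal, conj_expI, sub_eq_neg_add, expI_add,
    ← sqrt_two_pi_sq]
  ring

lemma isCompleteFamily_circFam : IsCompleteFamily circ circFam where
  memLp q := (memLp_expI q).const_mul _
  self q := by
    simp only [conj_circFam_mul]
    rw [integral_const_mul, integral_expI, if_pos (sub_self q), ← Complex.ofReal_mul,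
      one_div_mul_cancel two_pi_pos.ne', Complex.ofReal_one]
  ne p q h := by
    simp only [conj_circFam_mul]
    rw [integral_const_mul, integral_expI, if_neg (sub_ne_zero.2 h.symm), mul_zero]
  complete f hf h := by
    refine ae_eq_zero_of_fourier (a := -Real.pi) (b := Real.pi) (by linarith [Real.pi_pos]) hf
      fun q => ?_
    have h1 := h (-q)
    simp only [circFam, map_mul, Complex.conj_ofReal, conj_expI, neg_neg, mul_assoc] at h1
    rw [integral_const_mul, mul_eq_zero, or_iff_right] at h1
    · rw [← h1, circ]
      refine integral_congr_ae (.of_forall fun w => ?_)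
      simp only [expI]
      congr 2
      have : (Real.pi : ℂ) ≠ 0 := by simp [Real.pi_ne_zero]
      push_cast
      field_simp
      ring
    · have := Real.sqrt_pos.2 two_pi_pos
      exact Complex.ofReal_ne_zero.2 (by positivity)

/-- The Fourier coefficients of a function on `[-π, π)`. -/
def fcoef (g : ℝ → ℂ) (q : ℤ) : ℂ := ((1 / (2 * Real.pi) : ℝ) : ℂ) * ∫ w, expI (-q) w * g w ∂circ

lemma fcoef_eq (g : ℝ → ℂ) (q : ℤ) :
    fcoef g q = ((1 / Real.sqrt (2 * Real.pi) : ℝ) : ℂ) * famCoef circ circFam g q := by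
  simp only [fcoef, famCoef, circFam, map_mul, Complex.conj_ofReal, conj_expI, mul_assoc]
  rw [integral_const_mul, ← sqrt_two_pi_sq, mul_assoc]

lemma hasSum_fcoef {f g : ℝ → ℂ} (hf : MemLp f 2 circ) (hg : MemLp g 2 circ) :
    HasSum (fun q => conj (fcoef f q) * fcoef g q)
      (((1 / (2 * Real.pi) : ℝ) : ℂ) * ∫ w, conj (f w) * g w ∂circ) := by
  refine ((isCompleteFamily_circFam.hasSum_conj_mul hf hg).mul_left
    ((1 / (2 * Real.pi) : ℝ) : ℂ)).congr_fun fun q => ?_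
  rw [fcoef_eq, fcoef_eq, map_mul, Complex.conj_ofReal, ← sqrt_two_pi_sq]
  ring

lemma tsum_enorm_sq_fcoef {f : ℝ → ℂ} (hf : MemLp f 2 circ) :
    ∑' q, ‖fcoef f q‖ₑ ^ 2 = ENNReal.ofReal (1 / (2 * Real.pi)) * ∫⁻ w, ‖f w‖ₑ ^ 2 ∂circ := by
  rw [← isCompleteFamily_circFam.tsum_enorm_sq_famCoef hf, ← ENNReal.tsum_mul_left]
  refine tsum_congr fun q => ?_
  rw [fcoef_eq, enorm_mul, mul_pow]
  congr 1
  rw [enorm_sq_eq_ofReal]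
  congr 1
  rw [← norm_pow, pow_two, sqrt_two_pi_sq, Complex.norm_real, Real.norm_of_nonneg]
  positivity

lemma exists_fcoef_eq {c : ℤ → ℂ} (hc : ∑' q, ‖c q‖ₑ ^ 2 < ∞) :
    ∃ f, MemLp f 2 circ ∧ ∀ q, fcoef f q = c q := by
  have hs : ((Real.sqrt (2 * Real.pi) : ℝ) : ℂ) ≠ 0 := by
    rw [Complex.ofReal_ne_zero]
    exact (Real.sqrt_pos.2 two_pi_pos).ne'
  obtain ⟨f, hf, h⟩ := isCompleteFamily_circFam.exists_famCoef_eq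
    (c := fun q => ((Real.sqrt (2 * Real.pi) : ℝ) : ℂ) * c q) (by
      simp only [enorm_mul, mul_pow]
      rw [ENNReal.tsum_mul_left]
      exact ENNReal.mul_lt_top (ENNReal.pow_lt_top enorm_lt_top) hc)
  refine ⟨f, hf, fun q => ?_⟩
  rw [fcoef_eq, h, ← mul_assoc]
  push_cast
  rw [one_div_mul_cancel hs, one_mul]

lemma fcoef_sub {f g : ℝ → ℂ} (hf : Integrable f circ) (hg : Integrable g circ) (q : ℤ) :
    fcoef (fun w => f w - g w) q = fcoef f q - fcoef g q := by
  have h : ∀ {f : ℝ → ℂ}, Integrable f circ → Integrable (fun w => expI (-q) w * f w) circ :=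
    fun hf => hf.bdd_mul (c := 1) (continuous_expI _).aestronglyMeasurable
      (.of_forall fun w => (norm_expI _ w).le)
  unfold fcoef
  simp only [mul_sub]
  rw [integral_sub (h hf) (h hg), mul_sub]

lemma fcoef_congr {f g : ℝ → ℂ} (h : f =ᵐ[circ] g) (q : ℤ) : fcoef f q = fcoef g q := by
  unfold fcoef
  congr 1
  refine integral_congr_ae ?_
  filter_upwards [h] with w hw
  rw [hw]

lemma fcoef_const_mul (c : ℂ) (f : ℝ → ℂ) (q : ℤ) :
    fcoef (fun w => c * f w) q = c * fcoef f q := by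
  unfold fcoef
  simp only [mul_left_comm _ c]
  rw [integral_const_mul, mul_left_comm]

lemma fcoef_expI_mul (j : ℤ) (f : ℝ → ℂ) (q : ℤ) :
    fcoef (fun w => expI j w * f w) q = fcoef f (q - j) := by
  unfold fcoef
  simp only [← mul_assoc, ← expI_add]
  rw [show -q + j = -(q - j) by ring]

lemma fcoef_sum {I : Type*} (s : Finset I) {f : I → ℝ → ℂ} (hf : ∀ i ∈ s, Integrable (f i) circ)
    (q : ℤ) : fcoef (fun w => ∑ i ∈ s, f i w) q = ∑ i ∈ s, fcoef (f i) q := by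
  unfold fcoef
  simp only [Finset.mul_sum]
  rw [integral_finsetSum _ fun i hi => (hf i hi).bdd_mul (c := 1)
    (continuous_expI _).aestronglyMeasurable (.of_forall fun w => (norm_expI _ w).le),
    Finset.mul_sum]

lemma fcoef_expI (j q : ℤ) : fcoef (expI j) q = if j = q then 1 else 0 := by
  unfold fcoef
  simp only [← expI_add]
  rw [integral_expI]
  by_cases h : j = q
  · rw [if_pos h, if_pos (by omega), ← Complex.ofReal_mul, one_div_mul_cancel two_pi_pos.ne',
      Complex.ofReal_one]
  · rw [if_neg h, if_neg (by omega), mul_zero]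

/-! ### The trigonometric basis of one period -/

lemma freq_two_mul (i : ℕ) : freq (2 * i) = -(i : ℤ) := by
  unfold freq
  rw [show (2 * i + 1) / 2 = i by omega, pow_succ, pow_mul]
  simp

lemma freq_two_mul_add_one (i : ℕ) : freq (2 * i + 1) = i + 1 := by
  unfold freq
  rw [show (2 * i + 1 + 1) / 2 = i + 1 by omega, show 2 * i + 1 + 1 = 2 * (i + 1) by ring, pow_mul]
  simp

lemma freq_injective : Function.Injective freq := by
  intro a b h
  rcases Nat.even_or_odd' a with ⟨i, rfl | rfl⟩ <;> rcases Nat.even_or_odd' b with ⟨j, rfl | rfl⟩ <;>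
  simp only [freq_two_mul, freq_two_mul_add_one] at h <;> omega

lemma freq_surjective : Function.Surjective freq := by
  intro q
  rcases le_or_gt q 0 with h | h
  · refine ⟨2 * q.natAbs, ?_⟩
    rw [freq_two_mul]; omega
  · refine ⟨2 * (q.natAbs - 1) + 1, ?_⟩
    rw [freq_two_mul_add_one]; omega

lemma freq_swapIdx (k : ℕ) : freq (swapIdx k) = -freq k := by
  rcases Nat.even_or_odd' k with ⟨i, rfl | rfl⟩
  · rcases Nat.eq_zero_or_pos i with rfl | hi
    · simp [swapIdx, freq]
    · have : swapIdx (2 * i) = 2 * (i - 1) + 1 := by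
        rw [swapIdx, if_neg (by omega), if_neg (by omega)]; omega
      rw [this, freq_two_mul_add_one, freq_two_mul]; omega
  · have : swapIdx (2 * i + 1) = 2 * (i + 1) := by
      rw [swapIdx, if_neg (by omega), if_pos (by omega)]; omega
    rw [this, freq_two_mul_add_one, freq_two_mul]; push_cast; ring

lemma conj_basisFun_eq (T : ℝ) (k : ℕ) (u : ℝ) : conj (basisFun T k u) =
    ((1 / Real.sqrt T : ℝ) : ℂ) *
      Complex.exp (2 * (Real.pi : ℂ) * Complex.I * ((-freq k : ℤ) : ℂ) * (u : ℂ) / (T : ℂ)) := by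
  rw [basisFun, map_mul, Complex.conj_ofReal, ← Complex.exp_conj]
  congr 2
  have : conj (2 : ℂ) = 2 := Complex.conj_ofReal 2
  simp [this]

lemma conj_basisFun (T : ℝ) (k : ℕ) (u : ℝ) : conj (basisFun T k u) = basisFun T (swapIdx k) u := by
  rw [conj_basisFun_eq, basisFun, freq_swapIdx]

lemma swapIdx_swapIdx (k : ℕ) : swapIdx (swapIdx k) = k :=
  freq_injective (by rw [freq_swapIdx, freq_swapIdx, neg_neg])

@[fun_prop]
lemma continuous_basisFun (T : ℝ) (k : ℕ) : Continuous (basisFun T k) := by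
  unfold basisFun
  fun_prop

lemma basisFun_sub_int_mul {T : ℝ} (hT : 0 < T) (k : ℕ) (u : ℝ) (j : ℤ) :
    basisFun T k (u - j * T) = basisFun T k u := by
  have hT' : (T : ℂ) ≠ 0 := by exact_mod_cast hT.ne'
  unfold basisFun
  congr 1
  have : 2 * (Real.pi : ℂ) * Complex.I * (freq k : ℂ) * ((u - j * T : ℝ) : ℂ) / (T : ℂ) =
      2 * (Real.pi : ℂ) * Complex.I * (freq k : ℂ) * (u : ℂ) / (T : ℂ) +
        ((-(freq k * j) : ℤ) : ℂ) * (2 * Real.pi * Complex.I) := by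
    push_cast
    field_simp
    ring
  rw [this, Complex.exp_add, Complex.exp_int_mul_two_pi_mul_I, mul_one]

/-- Lebesgue measure on the `j`-th period. -/
def blockMeasure (T : ℝ) (j : ℤ) : Measure ℝ :=
  volume.restrict (Set.Ico (j * T) ((j + 1) * T))

instance (T : ℝ) (j : ℤ) : IsFiniteMeasure (blockMeasure T j) := by
  unfold blockMeasure; infer_instance

/-- The exponentials have period `T`, so the shift moves the integral to the true `j`-th period
without changing the basis functions. One family thus serves all periods. -/
lemma blockCoef_eq {E : Type*} [NormedAddCommGroup E] [NormedSpace ℂ E] {T : ℝ} (hT : 0 < T)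
    (f : ℝ → E) (j : ℤ) (k : ℕ) :
    blockCoef T f j k = ∫ t, conj (basisFun T k t) • f t ∂(blockMeasure T j) := by
  have h := (measurePreserving_add_right volume ((j : ℝ) * T)).setIntegral_preimage_emb
    (measurableEmbedding_addRight ((j : ℝ) * T)) (fun t => conj (basisFun T k t) • f t)
    (Set.Ico (j * T) ((j + 1) * T))
  rw [blockMeasure, ← h, blockCoef]
  have hs : (fun x : ℝ => x + j * T) ⁻¹' Set.Ico (j * T) ((j + 1) * T) = Set.Ico 0 T := by
    ext x
    simp only [Set.mem_preimage, Set.mem_Ico]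
    constructor <;> rintro ⟨h1, h2⟩ <;> constructor <;> linarith
  rw [hs]
  refine integral_congr_ae (.of_forall fun u => ?_)
  have := basisFun_sub_int_mul hT k (u + j * T) j
  rw [add_sub_cancel_right] at this
  simp only [this]

lemma norm_basisFun (T : ℝ) (k : ℕ) (u : ℝ) : ‖basisFun T k u‖ = 1 / Real.sqrt T := by
  rw [basisFun, norm_mul, Complex.norm_real, Real.norm_of_nonneg (by positivity)]
  have : 2 * (Real.pi : ℂ) * Complex.I * (freq k : ℂ) * (u : ℂ) / (T : ℂ) =
      ((2 * Real.pi * freq k * u / T : ℝ) : ℂ) * Complex.I := by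
    push_cast
    ring
  rw [this, Complex.norm_exp_ofReal_mul_I, mul_one]

lemma conj_basisFun_mul {T : ℝ} (hT : 0 < T) (k k' : ℕ) (u : ℝ) :
    conj (basisFun T k u) * basisFun T k' u = ((1 / T : ℝ) : ℂ) *
      Complex.exp (2 * Real.pi * Complex.I * ((freq k' - freq k : ℤ) : ℂ) * u / (T : ℂ)) := by
  have h1 : ((1 / Real.sqrt T : ℝ) : ℂ) * ((1 / Real.sqrt T : ℝ) : ℂ) = ((1 / T : ℝ) : ℂ) := by
    rw [← Complex.ofReal_mul, div_mul_div_comm, Real.mul_self_sqrt hT.le, one_mul]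
  rw [conj_basisFun_eq, basisFun, mul_mul_mul_comm, h1, ← Complex.exp_add]
  congr 2
  push_cast
  ring

lemma integral_conj_basisFun_mul {T : ℝ} (hT : 0 < T) (j : ℤ) (k k' : ℕ) :
    ∫ t, conj (basisFun T k t) * basisFun T k' t ∂(blockMeasure T j) = if k = k' then 1 else 0 := by
  have h := integral_exp_interval (a := j * T) (b := (j + 1) * T) (by linarith) (freq k' - freq k)
  rw [show ((j : ℝ) + 1) * T - j * T = T by ring] at h
  simp only [conj_basisFun_mul hT]
  rw [integral_const_mul, blockMeasure, h]
  by_cases hk : k = k'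
  · subst hk
    rw [if_pos (sub_self _), if_pos rfl, ← Complex.ofReal_mul, one_div_mul_cancel hT.ne',
      Complex.ofReal_one]
  · rw [if_neg, if_neg hk, mul_zero]
    rw [sub_eq_zero]
    exact fun h => hk (freq_injective h).symm

lemma ae_eq_zero_of_basisFun {T : ℝ} (hT : 0 < T) (j : ℤ) {f : ℝ → ℂ}
    (hf : MemLp f 2 (blockMeasure T j))
    (h : ∀ k, ∫ t, conj (basisFun T k t) * f t ∂(blockMeasure T j) = 0) :
    f =ᵐ[blockMeasure T j] 0 := by
  refine ae_eq_zero_of_fourier (a := j * T) (b := (j + 1) * T) (by linarith) hf fun q => ?_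
  rw [show ((j : ℝ) + 1) * T - j * T = T by ring]
  obtain ⟨k, hk⟩ := freq_surjective (-q)
  have h1 := h k
  simp only [conj_basisFun_eq, hk, neg_neg, mul_assoc] at h1
  rw [integral_const_mul, mul_eq_zero, or_iff_right] at h1
  · simpa only [mul_assoc, blockMeasure] using h1
  · have := Real.sqrt_pos.2 hT
    exact Complex.ofReal_ne_zero.2 (by positivity)

/-- The products of spherical harmonics and trigonometric functions. -/
def blockFam {n : ℕ} (T : ℝ) (Y : (m : ℕ) → Fin (harmonicCount n m) → Sph n → ℝ)
    (i : HIdx n × ℕ) (z : ℝ × Sph n) : ℂ := basisFun T i.2 z.1 * ((Y i.1.1 i.1.2 z.2 : ℝ) : ℂ)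

lemma conj_blockFam {n : ℕ} (T : ℝ) (Y : (m : ℕ) → Fin (harmonicCount n m) → Sph n → ℝ)
    (i : HIdx n × ℕ) (z : ℝ × Sph n) : conj (blockFam T Y i z) =
      conj (basisFun T i.2 z.1) * ((Y i.1.1 i.1.2 z.2 : ℝ) : ℂ) := by
  rw [blockFam, map_mul, Complex.conj_ofReal]

/-! ### Products of harmonics and exponentials over one period -/

section Block

variable {n : ℕ} {Y : (m : ℕ) → Fin (harmonicCount n m) → Sph n → ℝ}

lemma IsHarmonicBasis.exists_bound (hY : IsHarmonicBasis Y) (p : HIdx n) :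
    ∃ C, ∀ x, ‖((Y p.1 p.2 x : ℝ) : ℂ)‖ ≤ C := by
  obtain ⟨C, hC⟩ := (isCompact_univ : IsCompact (Set.univ : Set (Sph n))).exists_bound_of_continuousOn
    (hY.continuous p).continuousOn
  exact ⟨C, fun x => by simpa using hC x trivial⟩

lemma IsHarmonicBasis.continuous_ofReal (hY : IsHarmonicBasis Y) (p : HIdx n) :
    Continuous fun x => ((Y p.1 p.2 x : ℝ) : ℂ) :=
  Complex.continuous_ofReal.comp (hY.continuous p)

lemma continuous_blockFam (hY : IsHarmonicBasis Y) (T : ℝ) (i : HIdx n × ℕ) :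
    Continuous (blockFam T Y i) := by
  unfold blockFam
  exact ((continuous_basisFun T i.2).comp continuous_fst).mul
    ((hY.continuous_ofReal i.1).comp continuous_snd)

lemma exists_bound_blockFam (hY : IsHarmonicBasis Y) (T : ℝ) (i : HIdx n × ℕ) :
    ∃ C, ∀ z, ‖blockFam T Y i z‖ ≤ C := by
  obtain ⟨C, hC⟩ := hY.exists_bound i.1
  refine ⟨1 / Real.sqrt T * C, fun z => ?_⟩
  rw [blockFam, norm_mul, norm_basisFun]
  gcongr
  exact hC z.2

lemma enorm_sq_integral_harmonic_mul_le (hY : IsHarmonicBasis Y) (p : HIdx n) {f : Sph n → ℂ}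
    (hf : AEStronglyMeasurable f (surf n)) :
    ‖∫ x, ((Y p.1 p.2 x : ℝ) : ℂ) * f x ∂(surf n)‖ₑ ^ 2 ≤ ∫⁻ x, ‖f x‖ₑ ^ 2 ∂(surf n) := by
  have h1 : ‖∫ x, ((Y p.1 p.2 x : ℝ) : ℂ) * f x ∂(surf n)‖ₑ ≤
      ∫⁻ x, ‖((Y p.1 p.2 x : ℝ) : ℂ)‖ₑ * ‖f x‖ₑ ∂(surf n) := by
    refine (enorm_integral_le_lintegral_enorm _).trans_eq ?_
    simp only [enorm_mul]
  have h2 : ∫⁻ x, ‖((Y p.1 p.2 x : ℝ) : ℂ)‖ₑ ^ 2 ∂(surf n) = 1 := by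
    have h := hY.integral_self p
    have hi : Integrable (fun x => Y p.1 p.2 x * Y p.1 p.2 x) (surf n) :=
      Continuous.integrable_sphere ((hY.continuous p).mul (hY.continuous p))
    have h3 := ofReal_integral_eq_lintegral_ofReal hi (.of_forall fun x => mul_self_nonneg _)
    rw [h, ENNReal.ofReal_one] at h3
    rw [h3]
    refine lintegral_congr fun x => ?_
    rw [enorm_sq_eq_ofReal, Complex.norm_real, Real.norm_eq_abs, sq_abs, pow_two]
  calc _ ≤ (∫⁻ x, ‖((Y p.1 p.2 x : ℝ) : ℂ)‖ₑ * ‖f x‖ₑ ∂(surf n)) ^ 2 := by gcongr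
    _ ≤ _ := lintegral_mul_sq_le
      (hY.continuous_ofReal p).aestronglyMeasurable.enorm hf.enorm
    _ = _ := by rw [h2, one_mul]

lemma isCompleteFamily_blockFam (hY : IsHarmonicBasis Y) (hn : 0 < n) {T : ℝ} (hT : 0 < T) (j : ℤ) :
    IsCompleteFamily ((blockMeasure T j).prod (surf n)) (blockFam T Y) := by
  have key : ∀ i i' : HIdx n × ℕ, ∫ z, conj (blockFam T Y i z) * blockFam T Y i' z
      ∂((blockMeasure T j).prod (surf n)) = (if i.2 = i'.2 then 1 else 0) *
        ((∫ x, Y i.1.1 i.1.2 x * Y i'.1.1 i'.1.2 x ∂(surf n) : ℝ) : ℂ) := by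
    intro i i'
    rw [← integral_conj_basisFun_mul hT j, ← integral_complex_ofReal, ← integral_prod_mul
      (fun t => conj (basisFun T i.2 t) * basisFun T i'.2 t)]
    refine integral_congr_ae (.of_forall fun z => ?_)
    simp only [conj_blockFam]
    rw [blockFam]
    push_cast
    ring
  refine ⟨fun i => ?_, fun i => ?_, fun i i' h => ?_, fun f hf h => ?_⟩
  · obtain ⟨C, hC⟩ := exists_bound_blockFam hY T i
    exact MemLp.of_bound (continuous_blockFam hY T i).aestronglyMeasurable C (.of_forall hC)
  · rw [key, if_pos rfl, hY.integral_self]; simp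
  · rw [key]
    by_cases h2 : i.2 = i'.2
    · rw [hY.integral_of_ne hn, Complex.ofReal_zero, mul_zero]
      exact fun h1 => h (Prod.ext h1 h2)
    · rw [if_neg h2, zero_mul]
  · have hfm := (memLp_two_iff.1 hf).1
    have hfi : Integrable f ((blockMeasure T j).prod (surf n)) := hf.integrable (by norm_num)
    have hfl : ∫⁻ t, ∫⁻ x, ‖f (t, x)‖ₑ ^ 2 ∂(surf n) ∂(blockMeasure T j) < ∞ := by
      rw [← lintegral_prod _ (hfm.enorm.pow_const 2)]
      exact (memLp_two_iff.1 hf).2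
    -- Completeness in time first: each harmonic coefficient of `f (t, ·)` is orthogonal to all
    -- exponentials, so it vanishes for almost every `t`; countability of the indices gives one null
    -- set for all of them.
    have h1 : ∀ᵐ t ∂(blockMeasure T j), ∀ p : HIdx n,
        ∫ x, ((Y p.1 p.2 x : ℝ) : ℂ) * f (t, x) ∂(surf n) = 0 := by
      rw [ae_all_iff]
      intro p
      have hYf : AEStronglyMeasurable (fun z : ℝ × Sph n => ((Y p.1 p.2 z.2 : ℝ) : ℂ) * f z)
          ((blockMeasure T j).prod (surf n)) :=
        (((hY.continuous_ofReal p).comp continuous_snd).aestronglyMeasurable).mul hfm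
      refine ae_eq_zero_of_basisFun hT j (memLp_two_iff.2 ⟨hYf.integral_prod_right', ?_⟩) ?_
      · refine lt_of_le_of_lt (lintegral_mono_ae ?_) hfl
        filter_upwards [hfi.prod_right_ae] with t ht
        exact enorm_sq_integral_harmonic_mul_le hY p ht.aestronglyMeasurable
      · intro k
        rw [← h (p, k), integral_prod]
        · refine integral_congr_ae (.of_forall fun t => ?_)
          simp only [conj_blockFam, mul_assoc]
          rw [integral_const_mul]
        · obtain ⟨C, hC⟩ := exists_bound_blockFam hY T (p, k)
          refine hfi.bdd_mul (c := C)
            (Complex.continuous_conj.comp (continuous_blockFam hY T (p, k))).aestronglyMeasurable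
            (.of_forall fun z => ?_)
          rw [RCLike.norm_conj]
          exact hC z
    -- Completeness on the sphere, applied for almost every fixed `t`.
    have h2 : ∀ᵐ t ∂(blockMeasure T j), ∫⁻ x, ‖f (t, x)‖ₑ ^ 2 ∂(surf n) = 0 := by
      have hm := (hfm.enorm.pow_const 2).lintegral_prod_right'
      filter_upwards [h1, hfi.prod_right_ae, ae_lt_top' hm hfl.ne] with t ht hti htl
      have := hY.ae_eq_zero hn (memLp_two_iff.2 ⟨hti.aestronglyMeasurable, htl⟩) ht
      rw [lintegral_congr_ae (g := fun _ => 0), lintegral_zero]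
      filter_upwards [this] with x hx
      rw [hx]; simp
    have h3 : ∫⁻ z, ‖f z‖ₑ ^ 2 ∂((blockMeasure T j).prod (surf n)) = 0 := by
      rw [lintegral_prod _ (hfm.enorm.pow_const 2), lintegral_congr_ae h2, lintegral_zero]
    rw [lintegral_eq_zero_iff' (hfm.enorm.pow_const 2)] at h3
    filter_upwards [h3] with z hz
    simpa using hz

end Block

/-! ### Second-order properties of the random field -/

lemma integrable_conj_smul {X H : Type*} [MeasurableSpace X] {μ : Measure X}
    [NormedAddCommGroup H] [InnerProductSpace ℂ H] {b : X → ℂ} {G : X → H} (hb : MemLp b 2 μ) (hG : MemLp G 2 μ) :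
    Integrable (fun x => conj (b x) • G x) μ := by
  have : MemLp (fun x => conj (b x)) 2 μ := hb.star
  exact memLp_one_iff_integrable.1 (hG.smul this)

lemma mem_orthogonal_span_iff {H : Type*} [NormedAddCommGroup H] [InnerProductSpace ℂ H]
    {A : Set H} {η : H} : η ∈ (Submodule.span ℂ A)ᗮ ↔ ∀ s ∈ A, inner ℂ η s = 0 := by
  rw [Submodule.mem_orthogonal']
  refine ⟨fun h s hs => h s (Submodule.subset_span hs), fun h u hu => ?_⟩
  induction hu using Submodule.span_induction with
  | mem x hx => exact h x hx
  | zero => rw [inner_zero_right]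
  | add x y _ _ hx hy => rw [inner_add_right, hx, hy, add_zero]
  | smul c x _ hx => rw [inner_smul_right, hx, mul_zero]

/-- The coefficient of a vector valued function with respect to a scalar function. -/
def vecCoef {X H : Type*} [MeasurableSpace X] (μ : Measure X) [NormedAddCommGroup H]
    [InnerProductSpace ℂ H] (b : X → ℂ) (G : X → H) : H :=
  ∫ x, conj (b x) • G x ∂μ

/-! ### Coefficients of functions with values in a Hilbert space -/

section Hilbert

variable {X I H : Type*} [MeasurableSpace X] {μ : Measure X} [NormedAddCommGroup H]
  [InnerProductSpace ℂ H] [CompleteSpace H]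

/-- Integrability is not required, because the integral of a non-integrable function is zero by
convention. -/
lemma inner_integral_eq_zero {f : X → H} {c : H} (h : ∀ᵐ x ∂μ, inner ℂ c (f x) = 0) :
    inner ℂ c (∫ x, f x ∂μ) = 0 := by
  by_cases hf : Integrable f μ
  · rw [← integral_inner hf c, integral_congr_ae (g := fun _ => 0) h, integral_zero]
  · rw [integral_undef hf, inner_zero_right]

lemma integral_inner_eq_zero_left {f : X → H} {c : H} (h : ∀ᵐ x ∂μ, inner ℂ (f x) c = 0) :
    inner ℂ (∫ x, f x ∂μ) c = 0 := by
  rw [inner_eq_zero_symm]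
  refine inner_integral_eq_zero ?_
  filter_upwards [h] with x hx
  rwa [inner_eq_zero_symm]

lemma integral_inner_complex {f : X → H} (hf : Integrable f μ) (c : H) :
    ∫ x, inner ℂ c (f x) ∂μ = inner ℂ c (∫ x, f x ∂μ) :=
  integral_inner hf c

lemma inner_vecCoef {b : X → ℂ} {G : X → H} (hb : MemLp b 2 μ) (hG : MemLp G 2 μ) (c : H) :
    inner ℂ c (vecCoef μ b G) = ∫ x, conj (b x) * inner ℂ c (G x) ∂μ := by
  rw [vecCoef, ← integral_inner_complex (integrable_conj_smul hb hG)]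
  simp only [inner_smul_right]

/-- Bessel's inequality for functions with values in a Hilbert space. -/
lemma IsCompleteFamily.sum_norm_sq_le {b : I → X → ℂ} (hb : IsCompleteFamily μ b) {G : X → H}
    (hG : MemLp G 2 μ) (s : Finset I) :
    ∑ i ∈ s, ‖vecCoef μ (b i) G‖ ^ 2 ≤ ∫ x, ‖G x‖ ^ 2 ∂μ := by
  classical
  set z : I → H := fun i => vecCoef μ (b i) G with hz
  have hi : ∀ i, Integrable (fun x => conj (b i x) * inner ℂ (z i) (G x)) μ := fun i => by
    simp only [← inner_smul_right]
    exact (integrable_conj_smul (hb.memLp i) hG).const_inner _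
  have e1 : ∀ i, ∫ x, conj (b i x) * inner ℂ (z i) (G x) ∂μ = ((‖z i‖ ^ 2 : ℝ) : ℂ) := fun i => by
    rw [← inner_vecCoef (hb.memLp i) hG]
    rw [inner_self_eq_norm_sq_to_K]
    push_cast
    rfl
  have e2 : ∀ i j, ∫ x, conj (b i x) * b j x ∂μ = if i = j then 1 else 0 := fun i j => by
    split_ifs with h
    · subst h; exact hb.self i
    · exact hb.ne i j h
  set S : X → H := fun x => ∑ i ∈ s, b i x • z i with hS
  have hSG : ∀ x, inner ℂ (S x) (G x) = ∑ i ∈ s, conj (b i x) * inner ℂ (z i) (G x) := fun x => by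
    simp only [hS, sum_inner, inner_smul_left]
  have hSS : ∀ x, inner ℂ (S x) (S x) =
      ∑ i ∈ s, ∑ j ∈ s, (conj (b i x) * b j x) * inner ℂ (z i) (z j) := fun x => by
    simp only [hS, sum_inner, inner_smul_left]
    refine Finset.sum_congr rfl fun i _ => ?_
    rw [inner_sum, Finset.mul_sum]
    exact Finset.sum_congr rfl fun j _ => by rw [inner_smul_right, mul_assoc]
  have iSG : Integrable (fun x => inner ℂ (S x) (G x)) μ := by
    simp only [hSG]
    exact integrable_finsetSum _ fun i _ => hi i
  have iSS : Integrable (fun x => inner ℂ (S x) (S x)) μ := by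
    simp only [hSS]
    exact integrable_finsetSum _ fun i _ => integrable_finsetSum _ fun j _ =>
      (integrable_conj_mul (hb.memLp i) (hb.memLp j)).mul_const _
  have vSG : ∫ x, inner ℂ (S x) (G x) ∂μ = ((∑ i ∈ s, ‖z i‖ ^ 2 : ℝ) : ℂ) := by
    simp only [hSG]
    rw [integral_finsetSum _ fun i _ => hi i, Complex.ofReal_sum]
    exact Finset.sum_congr rfl fun i _ => e1 i
  have vSS : ∫ x, inner ℂ (S x) (S x) ∂μ = ((∑ i ∈ s, ‖z i‖ ^ 2 : ℝ) : ℂ) := by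
    simp only [hSS]
    rw [integral_finsetSum _ fun i _ => integrable_finsetSum _ fun j _ =>
      (integrable_conj_mul (hb.memLp i) (hb.memLp j)).mul_const _, Complex.ofReal_sum]
    refine Finset.sum_congr rfl fun i his => ?_
    rw [integral_finsetSum _ fun j _ =>
      (integrable_conj_mul (hb.memLp i) (hb.memLp j)).mul_const _]
    simp only [integral_mul_const, e2]
    rw [Finset.sum_eq_single i (fun j _ hj => by rw [if_neg hj.symm, zero_mul])
      (fun h => absurd his h), if_pos rfl, one_mul, inner_self_eq_norm_sq_to_K]
    push_cast
    rfl
  have iG : Integrable (fun x => ‖G x‖ ^ 2) μ := by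
    simpa using hG.integrable_norm_rpow (by norm_num) (by norm_num)
  -- The expression is `‖S x - G x‖²` for the partial expansion `S`. By `vSG` and `vSS`, its
  -- integral is `∫ ‖G‖²` minus the sum of the squared coefficient norms.
  have hre : ∀ x, 0 ≤ ‖G x‖ ^ 2 - 2 * (inner ℂ (S x) (G x)).re + (inner ℂ (S x) (S x)).re := by
    intro x
    have h := norm_sub_sq (𝕜 := ℂ) (S x) (G x)
    have h2 : (inner ℂ (S x) (S x)).re = ‖S x‖ ^ 2 := inner_self_eq_norm_sq (𝕜 := ℂ) (S x)
    rw [h2]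
    have h3 : RCLike.re (inner ℂ (S x) (G x)) = (inner ℂ (S x) (G x)).re := rfl
    rw [h3] at h
    nlinarith [sq_nonneg ‖S x - G x‖]
  have h := integral_nonneg (μ := μ) (f := fun x => ‖G x‖ ^ 2 - 2 * (inner ℂ (S x) (G x)).re +
    (inner ℂ (S x) (S x)).re) hre
  have iR : Integrable (fun x => 2 * (inner ℂ (S x) (G x)).re) μ := iSG.re.const_mul 2
  have iR' : Integrable (fun x => (inner ℂ (S x) (S x)).re) μ := iSS.re
  rw [integral_add (f := fun x => ‖G x‖ ^ 2 - 2 * (inner ℂ (S x) (G x)).re) (iG.sub iR) iR',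
    integral_sub iG iR, integral_const_mul] at h
  have r1 := integral_re iSG
  have r2 := integral_re iSS
  rw [vSG] at r1
  rw [vSS] at r2
  simp only [RCLike.re_to_complex, Complex.ofReal_re] at r1 r2
  rw [r1, r2] at h
  linarith

end Hilbert

lemma blockCoef_harmCoef_eq {E : Type*} [NormedAddCommGroup E] [NormedSpace ℂ E] {n : ℕ} {T : ℝ}
    (hT : 0 < T) {Y : (m : ℕ) → Fin (harmonicCount n m) → Sph n → ℝ} {f : ℝ → Sph n → E}
    (p : HIdx n) (j : ℤ) (k : ℕ) (hf : Integrable (fun z => conj (blockFam T Y (p, k) z) • f z.1 z.2)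
      ((blockMeasure T j).prod (surf n))) :
    blockCoef T (harmCoef Y f p) j k =
      ∫ z, conj (blockFam T Y (p, k) z) • f z.1 z.2 ∂((blockMeasure T j).prod (surf n)) := by
  rw [blockCoef_eq hT, integral_prod _ hf]
  refine integral_congr_ae (.of_forall fun t => ?_)
  simp only [conj_blockFam, mul_smul, harmCoef]
  exact (integral_smul _ _).symm

section Field

variable {Ω : Type*} [MeasurableSpace Ω] {P : Measure Ω}

lemma corr_eq_inner (U V : Lp ℂ 2 P) : corr U V = inner ℂ V U := by
  rw [corr, L2.inner_def]
  simp [RCLike.inner_apply]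

variable {n : ℕ} {T : ℝ} {ζ : ℝ → Sph n → Lp ℂ 2 P}
  {Y : (m : ℕ) → Fin (harmonicCount n m) → Sph n → ℝ}

/-- Continuity bounds the field on the compact set `[0, T] × S_n`, and periodic correlation makes
`‖ζ t x‖` periodic in time. -/
lemma IsPCIsotropic.exists_bound (hζ : IsPCIsotropic T ζ) (hT : 0 < T) :
    ∃ C, ∀ t x, ‖ζ t x‖ ≤ C := by
  obtain ⟨C, hC⟩ := ((isCompact_Icc (a := (0 : ℝ)) (b := T)).prod
    (isCompact_univ : IsCompact (Set.univ : Set (Sph n)))).exists_bound_of_continuousOn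
    hζ.continuous.continuousOn
  refine ⟨C, fun t x => ?_⟩
  have hp : Function.Periodic (fun t => ‖ζ t x‖) T := by
    intro t
    obtain ⟨B, hB⟩ := hζ.isotropic
    have h1 := (hB t t x x).1
    have h2 := (hB t t x x).2
    rw [← h1, corr_eq_inner, corr_eq_inner, inner_self_eq_norm_sq_to_K,
      inner_self_eq_norm_sq_to_K] at h2
    have h3 : ‖ζ (t + T) x‖ ^ 2 = ‖ζ t x‖ ^ 2 := by exact_mod_cast h2
    exact (pow_left_inj₀ (norm_nonneg _) (norm_nonneg _) two_ne_zero).1 h3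
  obtain ⟨u, hu, he⟩ := hp.exists_mem_Ico₀ hT t
  rw [he]
  exact hC (u, x) ⟨⟨hu.1, hu.2.le⟩, trivial⟩

lemma IsPCIsotropic.memLp_block (hζ : IsPCIsotropic T ζ) (hT : 0 < T) (j : ℤ) :
    MemLp (fun z : ℝ × Sph n => ζ z.1 z.2) 2 ((blockMeasure T j).prod (surf n)) := by
  obtain ⟨C, hC⟩ := hζ.exists_bound hT
  exact MemLp.of_bound hζ.continuous.aestronglyMeasurable C (.of_forall fun z => hC _ _)

lemma fieldSeq_eq (hY : IsHarmonicBasis Y) (hζ : IsPCIsotropic T ζ) (hT : 0 < T) (hn : 0 < n)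
    (p : HIdx n) (j : ℤ) (k : ℕ) : fieldSeq T Y ζ p j k =
      vecCoef ((blockMeasure T j).prod (surf n)) (blockFam T Y (p, k)) (fun z => ζ z.1 z.2) := by
  exact blockCoef_harmCoef_eq hT p j k (integrable_conj_smul
    ((isCompleteFamily_blockFam hY hn hT j).memLp (p, k)) (hζ.memLp_block hT j))

/-- Bessel's inequality over one period combined with the uniform bound on the field; the constant
does not depend on `j`. This yields both the summability of variances and the convergence of the
series for the functional. -/
lemma exists_tsum_fieldSeq_le (hY : IsHarmonicBasis Y) (hζ : IsPCIsotropic T ζ) (hT : 0 < T)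
    (hn : 0 < n) : ∃ K : ℝ≥0∞, K < ∞ ∧ ∀ j : ℤ,
      ∑' i : HIdx n × ℕ, ‖fieldSeq T Y ζ i.1 j i.2‖ₑ ^ 2 ≤ K := by
  obtain ⟨C, hC⟩ := hζ.exists_bound hT
  refine ⟨ENNReal.ofReal (C ^ 2 * (T * (surf n).real Set.univ)), ENNReal.ofReal_lt_top,
    fun j => ?_⟩
  rw [ENNReal.tsum_eq_iSup_sum]
  refine iSup_le fun s => ?_
  have h := (isCompleteFamily_blockFam hY hn hT j).sum_norm_sq_le (hζ.memLp_block hT j) s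
  have h1 : ∫ z : ℝ × Sph n, ‖ζ z.1 z.2‖ ^ 2 ∂((blockMeasure T j).prod (surf n)) ≤
      C ^ 2 * (T * (surf n).real Set.univ) := by
    have hm : ((blockMeasure T j).prod (surf n)).real Set.univ = T * (surf n).real Set.univ := by
      rw [← Set.univ_prod_univ, measureReal_prod_prod, blockMeasure, measureReal_restrict_apply_univ,
        Real.volume_real_Ico_of_le (by linarith)]
      ring
    calc _ ≤ ∫ _z : ℝ × Sph n, C ^ 2 ∂((blockMeasure T j).prod (surf n)) := by
          refine integral_mono_of_nonneg (.of_forall fun _ => by positivity) (integrable_const _)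
            (.of_forall fun z => ?_)
          have := hC z.1 z.2
          simp only
          gcongr
      _ = _ := by rw [integral_const, hm, smul_eq_mul, mul_comm]
  calc ∑ i ∈ s, ‖fieldSeq T Y ζ i.1 j i.2‖ₑ ^ 2
      = ∑ i ∈ s, ENNReal.ofReal (‖vecCoef
          ((blockMeasure T j).prod (surf n)) (blockFam T Y i) (fun z => ζ z.1 z.2)‖ ^ 2) := by
        refine Finset.sum_congr rfl fun i _ => ?_
        rw [fieldSeq_eq hY hζ hT hn, ← ofReal_norm, ENNReal.ofReal_pow (norm_nonneg _)]
    _ = ENNReal.ofReal (∑ i ∈ s, ‖vecCoef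
          ((blockMeasure T j).prod (surf n)) (blockFam T Y i) (fun z => ζ z.1 z.2)‖ ^ 2) :=
        (ENNReal.ofReal_sum_of_nonneg fun _ _ => by positivity).symm
    _ ≤ _ := ENNReal.ofReal_le_ofReal (h.trans h1)

/-- The point of the sphere with coordinates `(u, √(1 - u²), 0, …)`. -/
def circlePoint (hn : 2 ≤ n) (u : ℝ) : EuclideanSpace ℝ (Fin n) :=
  EuclideanSpace.single ⟨0, by omega⟩ u + EuclideanSpace.single ⟨1, by omega⟩ (Real.sqrt (1 - u ^ 2))

lemma norm_circlePoint (hn : 2 ≤ n) {u : ℝ} (hu : u ∈ Set.Icc (-1 : ℝ) 1) :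
    ‖circlePoint hn u‖ = 1 := by
  have h : (inner ℝ (EuclideanSpace.single (⟨0, by omega⟩ : Fin n) u)
      (EuclideanSpace.single (⟨1, by omega⟩ : Fin n) (Real.sqrt (1 - u ^ 2))) : ℝ) = 0 := by
    simp [EuclideanSpace.inner_single_left]
  have h2 := norm_add_sq_eq_norm_sq_add_norm_sq_real h
  have h3 : (0 : ℝ) ≤ 1 - u ^ 2 := by nlinarith [hu.1, hu.2]
  rw [PiLp.norm_single, PiLp.norm_single, Real.norm_eq_abs, Real.norm_eq_abs,
    abs_mul_abs_self, abs_mul_abs_self, Real.mul_self_sqrt h3] at h2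
  have h4 : ‖circlePoint hn u‖ ^ 2 = 1 := by
    rw [circlePoint, pow_two, h2]; ring
  exact (pow_eq_one_iff_of_nonneg (norm_nonneg _) two_ne_zero).1 h4

/-- Continuity of the correlation function in the angle is not assumed. It follows from mean square
continuity along an arc of points whose inner product with a fixed point is exactly `u`; the arc
needs two coordinates, hence `2 ≤ n`. -/
lemma continuousOn_of_isotropic (hn : 2 ≤ n) (hζ : IsPCIsotropic T ζ) {φ : ℝ → ℂ} {t s : ℝ}
    (hφ : ∀ x y : Sph n, corr (ζ t x) (ζ s y) = φ (inner ℝ x.1 y.1)) :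
    ContinuousOn φ (Set.Icc (-1) 1) := by
  rw [continuousOn_iff_continuous_domRestrict]
  let y : Set.Icc (-1 : ℝ) 1 → Sph n := fun u =>
    ⟨circlePoint hn u.1, by simpa using norm_circlePoint hn u.2⟩
  have hy : Continuous y := by
    refine Continuous.subtype_mk ?_ _
    unfold circlePoint
    have : ∀ i : Fin n, Continuous fun a : ℝ => EuclideanSpace.single i a := fun i =>
      (PiLp.continuous_toLp 2 (fun _ : Fin n => ℝ)).comp
        (continuous_single (A := fun _ : Fin n => ℝ) i)
    exact ((this _).comp (by fun_prop)).add ((this _).comp (by fun_prop))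
  let x : Sph n := y ⟨1, by norm_num, le_refl _⟩
  have hx : ∀ u, (inner ℝ x.1 (y u).1 : ℝ) = u.1 := by
    intro u
    simp [x, y, circlePoint, inner_add_left, inner_add_right, EuclideanSpace.inner_single_left]
  have : Set.domRestrict (Set.Icc (-1 : ℝ) 1) φ = fun u => inner ℂ (ζ s (y u)) (ζ t x) := by
    ext u
    rw [← corr_eq_inner, hφ, hx]
    rfl
  rw [this]
  refine Continuous.inner ?_ continuous_const
  exact hζ.continuous.comp (continuous_const.prodMk hy)

lemma IsPCIsotropic.continuous_apply (hζ : IsPCIsotropic T ζ) (t : ℝ) : Continuous (ζ t) :=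
  hζ.continuous.comp (Continuous.prodMk_right t)

lemma integrable_harmonic_smul (hY : IsHarmonicBasis Y) (hζ : IsPCIsotropic T ζ) (p : HIdx n)
    (t : ℝ) : Integrable (fun x => ((Y p.1 p.2 x : ℝ) : ℂ) • ζ t x) (surf n) :=
  Continuous.integrable_sphere ((hY.continuous_ofReal p).smul (hζ.continuous_apply t))

/-- The inner product is the double integral of a continuous kernel in `⟨x, y⟩` against two
orthogonal harmonics, so `integral_isotropic` applies. -/
lemma inner_harmCoef_eq_zero (hn : 2 ≤ n) (hY : IsHarmonicBasis Y) (hζ : IsPCIsotropic T ζ)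
    {p p' : HIdx n} (h : p ≠ p') (s t : ℝ) :
    inner ℂ (harmCoef Y ζ p' s) (harmCoef Y ζ p t) = 0 := by
  obtain ⟨B, hB⟩ := hζ.isotropic
  have hφ : ∀ x y : Sph n, corr (ζ t x) (ζ s y) = B t s (inner ℝ x.1 y.1) := fun x y =>
    (hB t s x y).1
  have hc := continuousOn_of_isotropic hn hζ hφ
  have h0 := integral_isotropic (by omega) (hY.mem p') (hY.continuous p)
    (hY.integral_of_ne (by omega) h.symm) hc
  have hφc : Continuous fun z : Sph n × Sph n => B t s (inner ℝ z.1.1 z.2.1) :=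
    hc.comp_continuous (by fun_prop) fun z => inner_mem_Icc z.1 z.2
  have hY1 := hY.continuous_ofReal p
  have hY2 := hY.continuous_ofReal p'
  rw [integral_prod] at h0
  · rw [harmCoef, harmCoef, ← integral_inner_complex (integrable_harmonic_smul hY hζ p t), ← h0]
    refine integral_congr_ae (.of_forall fun x => ?_)
    simp only
    rw [← inner_conj_symm, ← integral_inner_complex (integrable_harmonic_smul hY hζ p' s), ← integral_conj]
    refine integral_congr_ae (.of_forall fun y => ?_)
    simp only
    rw [inner_conj_symm, inner_smul_left, inner_smul_right, ← corr_eq_inner, hφ, Complex.conj_ofReal]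
    push_cast
    ring
  · refine Continuous.integrable_sphere_prod (hφc.mul ?_)
    simp only [Complex.ofReal_mul]
    exact (hY2.comp continuous_snd).mul (hY1.comp continuous_fst)

lemma inner_fieldSeq_eq_zero (hn : 2 ≤ n) (hY : IsHarmonicBasis Y) (hζ : IsPCIsotropic T ζ)
    {p p' : HIdx n} (h : p ≠ p') (i j : ℤ) (k k' : ℕ) :
    inner ℂ (fieldSeq T Y ζ p' j k') (fieldSeq T Y ζ p i k) = 0 := by
  unfold fieldSeq blockCoef
  refine inner_integral_eq_zero (.of_forall fun t => ?_)
  refine integral_inner_eq_zero_left (.of_forall fun s => ?_)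
  rw [inner_smul_left, inner_smul_right, inner_harmCoef_eq_zero hn hY hζ h, mul_zero, mul_zero]

/-- All coefficients of `(t, x) ↦ ⟨η, ζ t x⟩` over the period vanish, so the function is zero almost
everywhere. Being continuous, it is zero at every point of the period, including the left endpoint,
which lies in the closure of the interior. -/
lemma eq_zero_of_inner_fieldSeq (hn : 0 < n) (hT : 0 < T) (hY : IsHarmonicBasis Y)
    (hζ : IsPCIsotropic T ζ) {η : Lp ℂ 2 P} {j : ℤ}
    (h : ∀ p k, inner ℂ η (fieldSeq T Y ζ p j k) = 0) {t : ℝ}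
    (ht : t ∈ Set.Ico (j * T) ((j + 1) * T)) (x : Sph n) : inner ℂ η (ζ t x) = 0 := by
  have hc : Continuous fun z : ℝ × Sph n => inner ℂ η (ζ z.1 z.2) :=
    Continuous.inner continuous_const hζ.continuous
  have h0 : (fun z : ℝ × Sph n => inner ℂ η (ζ z.1 z.2))
      =ᵐ[(blockMeasure T j).prod (surf n)] 0 := by
    refine (isCompleteFamily_blockFam hY hn hT j).complete _ ((hζ.memLp_block hT j).const_inner η)
      fun i => ?_
    rw [← h i.1 i.2, fieldSeq_eq hY hζ hT hn, inner_vecCoef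
      ((isCompleteFamily_blockFam hY hn hT j).memLp _) (hζ.memLp_block hT j)]
  have hr : (blockMeasure T j).prod (surf n) =
      ((volume : Measure ℝ).prod (surf n)).restrict
        (Set.Ico (j * T) ((j + 1) * T) ×ˢ Set.univ) := by
    rw [blockMeasure, ← Measure.prod_restrict, Measure.restrict_univ]
  rw [hr] at h0
  have : (surf n).IsOpenPosMeasure := by unfold surf; infer_instance
  have hE := Measure.eqOn_of_ae_eq h0 hc.continuousOn continuous_zero.continuousOn (by
    rw [interior_prod_eq, interior_Ico, interior_univ, closure_prod_eq, closure_univ,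
      closure_Ioo (by linarith)]
    exact Set.prod_mono Set.Ico_subset_Icc_self subset_rfl)
  exact hE (x := (t, x)) ⟨ht, trivial⟩

lemma inner_fieldSeq_of_forall (η : Lp ℂ 2 P) (hT : 0 < T) {j : ℤ}
    (h : ∀ t ∈ Set.Ico (j * T) ((j + 1) * T), ∀ x : Sph n, inner ℂ η (ζ t x) = 0) (p : HIdx n)
    (k : ℕ) : inner ℂ η (fieldSeq T Y ζ p j k) = 0 := by
  rw [fieldSeq, blockCoef_eq hT]
  refine inner_integral_eq_zero ?_
  unfold blockMeasure
  filter_upwards [ae_restrict_mem measurableSet_Ico] with t ht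
  rw [inner_smul_right, harmCoef, inner_integral_eq_zero, mul_zero]
  refine .of_forall fun x => ?_
  rw [inner_smul_right, h t ht, mul_zero]

/-- The past of the field is generated by the coefficients with negative indices. -/
lemma pastSpace_eq (hn : 0 < n) (hT : 0 < T) (hY : IsHarmonicBasis Y) (hζ : IsPCIsotropic T ζ) :
    pastSpace ζ = (Submodule.span ℂ {η | ∃ (p : HIdx n) (j : ℤ) (k : ℕ), j < 0 ∧
      η = fieldSeq T Y ζ p j k}).topologicalClosure := by
  -- Closed spans are compared through their orthogonal complements, which avoids approximating
  -- field values by coefficients explicitly.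
  have key : ∀ η : Lp ℂ 2 P, η ∈ (Submodule.span ℂ {η | ∃ t x, t < 0 ∧ η = ζ t x})ᗮ ↔
      η ∈ (Submodule.span ℂ {η | ∃ (p : HIdx n) (j : ℤ) (k : ℕ), j < 0 ∧
      η = fieldSeq T Y ζ p j k})ᗮ := by
    intro η
    rw [mem_orthogonal_span_iff, mem_orthogonal_span_iff]
    constructor
    · rintro h _ ⟨p, j, k, hj, rfl⟩
      refine inner_fieldSeq_of_forall η hT (fun t ht x => h _ ⟨t, x, ?_, rfl⟩) p k
      have : ((j : ℝ) + 1) * T ≤ 0 :=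
        mul_nonpos_of_nonpos_of_nonneg (by exact_mod_cast hj) hT.le
      exact ht.2.trans_le this
    · rintro h _ ⟨t, x, ht, rfl⟩
      -- The time `t` lies in the period numbered `⌊t / T⌋`, which is negative because `t < 0`.
      have hj : ⌊t / T⌋ < 0 := Int.floor_lt.2 (by simpa using div_neg_of_neg_of_pos ht hT)
      refine eq_zero_of_inner_fieldSeq hn hT hY hζ (j := ⌊t / T⌋)
        (fun p k => h _ ⟨p, _, k, hj, rfl⟩) ⟨?_, ?_⟩ x
      · exact (le_div_iff₀ hT).1 (Int.floor_le _)
      · exact (div_lt_iff₀ hT).1 (Int.lt_floor_add_one _)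
  rw [pastSpace, ← Submodule.orthogonal_orthogonal_eq_closure,
    ← Submodule.orthogonal_orthogonal_eq_closure, Submodule.ext key]

end Field

/-! ### The functional as a series -/

lemma inner_iterated_integral {H X X' : Type*} [NormedAddCommGroup H] [InnerProductSpace ℂ H]
    [CompleteSpace H] [NormedSpace ℝ H] [MeasurableSpace X] [MeasurableSpace X'] {μ : Measure X}
    {ν : Measure X'} [SFinite μ] [SFinite ν] {f : X → X' → H}
    (hf : Integrable (fun z : X × X' => f z.1 z.2) (μ.prod ν)) (c : H) :
    inner ℂ c (∫ x, ∫ y, f x y ∂ν ∂μ) = ∫ z, inner ℂ c (f z.1 z.2) ∂(μ.prod ν) := by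
  rw [integral_inner hf c, integral_prod _ hf]

lemma sum_blockMeasure {T : ℝ} (hT : 0 < T) :
    Measure.sum (fun j : ℕ => blockMeasure T j) = volume.restrict (Set.Ici (0 : ℝ)) := by
  have hU : (⋃ j : ℕ, Set.Ico ((((j : ℕ) : ℤ) : ℝ) * T) (((((j : ℕ) : ℤ) : ℝ) + 1) * T)) =
      Set.Ici (0 : ℝ) := by
    ext t
    simp only [Set.mem_iUnion, Set.mem_Ico, Set.mem_Ici, Int.cast_natCast]
    constructor
    · rintro ⟨j, h, -⟩
      exact le_trans (by positivity) h
    · intro ht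
      refine ⟨⌊t / T⌋₊, (le_div_iff₀ hT).1 (Nat.floor_le (by positivity)),
        (div_lt_iff₀ hT).1 (Nat.lt_floor_add_one _)⟩
  rw [← hU, Measure.restrict_iUnion]
  · rfl
  · intro i j hij
    rw [Function.onFun, Set.disjoint_left]
    simp only [Set.mem_Ico, Int.cast_natCast]
    rintro t ⟨h1, h2⟩ ⟨h3, h4⟩
    have h5 : (i : ℝ) < j + 1 := lt_of_mul_lt_mul_right (h1.trans_lt h4) hT.le
    have h6 : (j : ℝ) < i + 1 := lt_of_mul_lt_mul_right (h3.trans_lt h2) hT.le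
    have h7 : i < j + 1 := by exact_mod_cast h5
    have h8 : j < i + 1 := by exact_mod_cast h6
    omega
  · exact fun _ => measurableSet_Ico

lemma enorm_mul_tsum_le {I : Type*} (x : I → ℝ≥0∞) : ∑' i, x i ^ 2 ≤ (∑' i, x i) ^ 2 := by
  calc ∑' i, x i ^ 2 ≤ ∑' i, x i * ∑' j, x j :=
        ENNReal.tsum_le_tsum fun i => by rw [pow_two]; gcongr; exact ENNReal.le_tsum i
    _ = _ := by rw [ENNReal.tsum_mul_right, pow_two]

lemma rpow_half_sq (x : ℝ≥0∞) : (x ^ (1 / 2 : ℝ)) ^ 2 = x := by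
  rw [← ENNReal.rpow_two, ← ENNReal.rpow_mul]; norm_num

section Field

variable {Ω : Type*} [MeasurableSpace Ω] {P : Measure Ω} {n : ℕ} {T : ℝ}
  {ζ : ℝ → Sph n → Lp ℂ 2 P} {Y : (m : ℕ) → Fin (harmonicCount n m) → Sph n → ℝ}
  {a : ℝ → Sph n → ℂ}

lemma IsWeight.memLp_block (ha : IsWeight T Y a) (j : ℕ) :
    MemLp (fun z : ℝ × Sph n => a z.1 z.2) 2 ((blockMeasure T j).prod (surf n)) := by
  have := ha.memLp j
  simp only [blockMeasure, Int.cast_natCast]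
  exact this

/-- The product `a ζ` is bilinear while Parseval is sesquilinear, so it is applied to `conj a`.
Conjugating an exponential negates its frequency, which is the reason for `swapIdx` in `aVec`. -/
lemma famCoef_conj_weight (hn : 0 < n) (hT : 0 < T) (hY : IsHarmonicBasis Y) (ha : IsWeight T Y a)
    (j : ℕ) (i : HIdx n × ℕ) :
    conj (famCoef ((blockMeasure T j).prod (surf n)) (blockFam T Y)
      (fun z => conj (a z.1 z.2)) i) = aVec T Y a i.1 j i.2 := by
  have hi := integrable_conj_mul
    ((isCompleteFamily_blockFam hY hn hT j).memLp (i.1, swapIdx i.2)) (ha.memLp_block j)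
  rw [aVec, blockCoef_harmCoef_eq hT _ _ _ hi, famCoef, ← integral_conj]
  refine integral_congr_ae (.of_forall fun z => ?_)
  simp only [map_mul, Complex.conj_conj, conj_basisFun, swapIdx_swapIdx, blockFam,
    smul_eq_mul, Complex.conj_ofReal]

/-- Parseval's identity for the weight over one period. -/
lemma lintegral_weight_sq (hn : 0 < n) (hT : 0 < T) (hY : IsHarmonicBasis Y) (ha : IsWeight T Y a)
    (j : ℕ) : ∫⁻ z : ℝ × Sph n, ‖a z.1 z.2‖ₑ ^ 2 ∂((blockMeasure T j).prod (surf n)) =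
      ∑' p, normSq (aVec T Y a p j) := by
  have hc : MemLp (fun z : ℝ × Sph n => conj (a z.1 z.2)) 2 ((blockMeasure T j).prod (surf n)) :=
    (ha.memLp_block j).star
  have h := (isCompleteFamily_blockFam hY hn hT j).tsum_enorm_sq_famCoef hc
  have e : ∀ z : ℂ, ‖conj z‖ₑ = ‖z‖ₑ := fun z => by
    rw [← ofReal_norm, RCLike.norm_conj, ofReal_norm]
  simp only [e] at h
  rw [← h, ENNReal.tsum_prod']
  simp only [normSq, ← famCoef_conj_weight hn hT hY ha j (_, _), e]

/-- Cauchy–Schwarz on a period of finite measure bounds the `L₁` norm by the `L₂` norm. By Parseval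
the latter is at most the sum of the norms of the vectors, which is the quantity assumed summable
over `j`. -/
lemma lintegral_weight_le (hn : 0 < n) (hT : 0 < T) (hY : IsHarmonicBasis Y) (ha : IsWeight T Y a)
    (j : ℕ) : ∫⁻ z : ℝ × Sph n, ‖a z.1 z.2‖ₑ ∂((blockMeasure T j).prod (surf n)) ≤
      (∑' p, normSq (aVec T Y a p j) ^ (1 / 2 : ℝ)) *
        (ENNReal.ofReal T * surf n Set.univ) ^ (1 / 2 : ℝ) := by
  rw [← ENNReal.pow_le_pow_left_iff two_ne_zero, mul_pow, rpow_half_sq]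
  have h := lintegral_mul_sq_le (μ := (blockMeasure T j).prod (surf n))
    (f := fun z => ‖a z.1 z.2‖ₑ) (g := fun _ => 1)
    (memLp_two_iff.1 (ha.memLp_block j)).1.enorm aemeasurable_const
  simp only [mul_one, one_pow, lintegral_const, one_mul] at h
  refine h.trans (mul_le_mul' ?_ (le_of_eq ?_))
  · rw [lintegral_weight_sq hn hT hY ha]
    refine le_trans (le_of_eq ?_) (enorm_mul_tsum_le _)
    simp only [rpow_half_sq]
  · rw [← Set.univ_prod_univ, Measure.prod_prod, blockMeasure, Measure.restrict_apply_univ,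
      Real.volume_Ico]
    congr 2
    ring

/-- The functional is a well-defined integral. -/
lemma integrable_functional (hn : 0 < n) (hT : 0 < T) (hY : IsHarmonicBasis Y)
    (hζ : IsPCIsotropic T ζ) (ha : IsWeight T Y a) :
    Integrable (fun q : ℝ × Sph n => a q.1 q.2 • ζ q.1 q.2)
      ((volume.restrict (Set.Ici (0 : ℝ))).prod (surf n)) := by
  obtain ⟨C, hC⟩ := hζ.exists_bound hT
  -- The half-line is cut into periods, over each of which the weight is square integrable.
  rw [← sum_blockMeasure hT, Measure.prod_sum_left]
  refine ⟨?_, ?_⟩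
  · rw [aestronglyMeasurable_sum_measure_iff]
    exact fun j => (memLp_two_iff.1 (ha.memLp_block j)).1.smul
      hζ.continuous.aestronglyMeasurable
  · rw [HasFiniteIntegral, lintegral_sum_measure]
    calc _ ≤ ∑' j : ℕ, ((∑' p, normSq (aVec T Y a p j) ^ (1 / 2 : ℝ)) *
          (ENNReal.ofReal T * surf n Set.univ) ^ (1 / 2 : ℝ)) * ENNReal.ofReal C := by
          refine ENNReal.tsum_le_tsum fun j => ?_
          refine le_trans ?_ (mul_le_mul_left (lintegral_weight_le hn hT hY ha j) _)
          rw [← lintegral_mul_const' _ _ ENNReal.ofReal_ne_top]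
          refine lintegral_mono fun z => ?_
          rw [enorm_smul]
          gcongr
          rw [← ofReal_norm]
          exact ENNReal.ofReal_le_ofReal (hC _ _)
      _ < ∞ := by
          rw [ENNReal.tsum_mul_right, ENNReal.tsum_mul_right, ENNReal.tsum_comm]
          refine ENNReal.mul_lt_top (ENNReal.mul_lt_top ha.sum_norm ?_) ENNReal.ofReal_lt_top
          exact ENNReal.rpow_lt_top_of_nonneg (by norm_num)
            (ENNReal.mul_lt_top ENNReal.ofReal_lt_top (measure_lt_top _ _)).ne

lemma inner_functional (hn : 0 < n) (hT : 0 < T) (hY : IsHarmonicBasis Y)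
    (hζ : IsPCIsotropic T ζ) (ha : IsWeight T Y a) (η : Lp ℂ 2 P) :
    inner ℂ η (functional a ζ) = ∫ z : ℝ × Sph n, inner ℂ η (a z.1 z.2 • ζ z.1 z.2)
      ∂((volume.restrict (Set.Ici (0 : ℝ))).prod (surf n)) :=
  inner_iterated_integral (f := fun t x => a t x • ζ t x)
    (integrable_functional hn hT hY hζ ha) η

/-- The absolute summability of products of coefficients of the weight with a family whose squares
are uniformly summable over each period. -/
lemma IsWeight.tsum_mul_lt_top (ha : IsWeight T Y a) {x : ℕ → HIdx n × ℕ → ℝ≥0∞} {K : ℝ≥0∞}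
    (hK : K < ∞) (hx : ∀ j p, ∑' k, x j (p, k) ^ 2 ≤ K) :
    ∑' i : ℕ × HIdx n × ℕ, ‖aVec T Y a i.2.1 i.1 i.2.2‖ₑ * x i.1 i.2 < ∞ := by
  rw [ENNReal.tsum_prod']
  calc _ ≤ ∑' j, ∑' p, normSq (aVec T Y a p j) ^ (1 / 2 : ℝ) * K ^ (1 / 2 : ℝ) := by
        refine ENNReal.tsum_le_tsum fun j => ?_
        rw [ENNReal.tsum_prod']
        refine ENNReal.tsum_le_tsum fun p => ?_
        rw [← ENNReal.pow_le_pow_left_iff two_ne_zero, mul_pow, rpow_half_sq, rpow_half_sq]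
        exact (tsum_mul_sq_le _ _).trans (mul_le_mul' le_rfl (hx j p))
    _ < ∞ := by
        simp only [ENNReal.tsum_mul_right]
        rw [ENNReal.tsum_comm]
        exact ENNReal.mul_lt_top ha.sum_norm
          (ENNReal.rpow_lt_top_of_nonneg (by norm_num) hK.ne)

lemma summable_norm_weight_smul_fieldSeq (hn : 0 < n) (hT : 0 < T) (hY : IsHarmonicBasis Y)
    (hζ : IsPCIsotropic T ζ) (ha : IsWeight T Y a) :
    Summable fun i : ℕ × HIdx n × ℕ =>
      ‖aVec T Y a i.2.1 i.1 i.2.2 • fieldSeq T Y ζ i.2.1 i.1 i.2.2‖ := by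
  obtain ⟨K, hK, h⟩ := exists_tsum_fieldSeq_le hY hζ hT hn
  have := ha.tsum_mul_lt_top (x := fun j i => ‖fieldSeq T Y ζ i.1 j i.2‖ₑ) hK fun j p => by
    refine le_trans ?_ (h j)
    rw [ENNReal.tsum_prod']
    exact ENNReal.le_tsum (f := fun p : HIdx n => ∑' k, ‖fieldSeq T Y ζ p j k‖ₑ ^ 2) p
  refine (ENNReal.summable_toReal this.ne).congr fun i => ?_
  rw [norm_smul, ENNReal.toReal_mul, toReal_enorm, toReal_enorm]

/-- The functional is the sum of the series `∑_{m,l} ∑_j a_m^l(j)^⊤ ζ_m^l(j)`. -/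
lemma hasSum_functional (hn : 0 < n) (hT : 0 < T) (hY : IsHarmonicBasis Y)
    (hζ : IsPCIsotropic T ζ) (ha : IsWeight T Y a) :
    HasSum (fun i : ℕ × HIdx n × ℕ =>
      aVec T Y a i.2.1 i.1 i.2.2 • fieldSeq T Y ζ i.2.1 i.1 i.2.2) (functional a ζ) := by
  have hs := (summable_norm_weight_smul_fieldSeq hn hT hY hζ ha).of_norm.hasSum
  suffices h : ∑' i : ℕ × HIdx n × ℕ,
      aVec T Y a i.2.1 i.1 i.2.2 • fieldSeq T Y ζ i.2.1 i.1 i.2.2 = functional a ζ by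
    rwa [h] at hs
  -- The identity is tested weakly: against a fixed `η`, Parseval evaluates the series over each
  -- period, and the integral over the half-line is the sum of the integrals over the periods.
  refine ext_inner_left ℂ fun η => ?_
  have h1 := hs.mapL (innerSL ℂ η)
  have hi := (integrable_functional hn hT hY hζ ha).const_inner (𝕜 := ℂ) η
  have hblock : ∀ j : ℕ, HasSum (fun i : HIdx n × ℕ =>
      innerSL ℂ η (aVec T Y a i.1 j i.2 • fieldSeq T Y ζ i.1 j i.2))
      (∫ z : ℝ × Sph n, inner ℂ η (a z.1 z.2 • ζ z.1 z.2)
        ∂((blockMeasure T j).prod (surf n))) := by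
    intro j
    have hc : MemLp (fun z : ℝ × Sph n => conj (a z.1 z.2)) 2
      ((blockMeasure T j).prod (surf n)) := (ha.memLp_block j).star
    have hb := isCompleteFamily_blockFam hY hn hT (j : ℤ)
    have h := hb.hasSum_conj_mul hc ((hζ.memLp_block hT j).const_inner (𝕜 := ℂ) η)
    simp only [Complex.conj_conj, famCoef_conj_weight hn hT hY ha, ← inner_smul_right] at h
    convert h using 2 with i
    rw [innerSL_apply_apply, fieldSeq_eq hY hζ hT hn, inner_smul_right,
      inner_vecCoef (hb.memLp i) (hζ.memLp_block hT j)]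
    rfl
  have h2 := h1.prod_fiberwise hblock
  rw [inner_functional hn hT hY hζ ha]
  rw [← sum_blockMeasure hT, Measure.prod_sum_left] at hi ⊢
  exact h2.unique (hasSum_integral_measure hi)

end Field

/-! ### Fourier series with countably many components -/

lemma memLp_of_lintegral_enorm_sq_lt_top {X : Type*} [MeasurableSpace X] {μ : Measure X}
    {f : X → ℂ} (hm : AEMeasurable f μ) (hf : ∫⁻ x, ‖f x‖ₑ ^ 2 ∂μ < ∞) : MemLp f 2 μ :=
  memLp_two_iff.2 ⟨hm.aestronglyMeasurable, hf⟩

lemma enorm_sq_le_normSq {κ : Type*} (v : κ → ℂ) (i : κ) : ‖v i‖ₑ ^ 2 ≤ normSq v :=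
  ENNReal.le_tsum (f := fun i => ‖v i‖ₑ ^ 2) i

lemma normSq_add_le {κ : Type*} (v w : κ → ℂ) :
    normSq (fun i => v i + w i) ≤ 2 * normSq v + 2 * normSq w := by
  unfold normSq
  rw [← ENNReal.tsum_mul_left, ← ENNReal.tsum_mul_left, ← ENNReal.tsum_add]
  refine ENNReal.tsum_le_tsum fun i => ?_
  calc ‖v i + w i‖ₑ ^ 2 ≤ (‖v i‖ₑ + ‖w i‖ₑ) ^ 2 := by gcongr; exact enorm_add_le _ _
    _ ≤ 2 * (‖v i‖ₑ ^ 2 + ‖w i‖ₑ ^ 2) := by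
        have := ENNReal.rpow_add_le_mul_rpow_add_rpow ‖v i‖ₑ ‖w i‖ₑ (p := 2) (by norm_num)
        norm_num at this
        exact this
    _ = _ := by rw [mul_add]

lemma normSq_const_mul {κ : Type*} (b : ℂ) (v : κ → ℂ) :
    normSq (fun i => b * v i) = ‖b‖ₑ ^ 2 * normSq v := by
  unfold normSq
  rw [← ENNReal.tsum_mul_left]
  exact tsum_congr fun i => by rw [enorm_mul, mul_pow]

lemma aemeasurable_normSq {κ X : Type*} [Countable κ] [MeasurableSpace X] {μ : Measure X}
    {f : X → κ → ℂ} (hf : ∀ i, AEMeasurable (fun x => f x i) μ) :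
    AEMeasurable (fun x => normSq (f x)) μ :=
  AEMeasurable.tsum fun i => (hf i).enorm.pow_const 2

lemma lintegral_normSq {κ X : Type*} [Countable κ] [MeasurableSpace X] {μ : Measure X}
    {f : X → κ → ℂ} (hf : ∀ i, AEMeasurable (fun x => f x i) μ) :
    ∫⁻ x, normSq (f x) ∂μ = ∑' i, ∫⁻ x, ‖f x i‖ₑ ^ 2 ∂μ :=
  lintegral_tsum fun i => (hf i).enorm.pow_const 2

/-- Parseval's identity for functions with countably many components. -/
lemma tsum_normSq_fcoef {κ : Type*} [Countable κ] {f : ℝ → κ → ℂ}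
    (hf : ∀ i, AEMeasurable (fun w => f w i) circ) (hfin : ∫⁻ w, normSq (f w) ∂circ < ∞) :
    ∑' (i) (q : ℤ), ‖fcoef (fun w => f w i) q‖ₑ ^ 2 =
      ENNReal.ofReal (1 / (2 * Real.pi)) * ∫⁻ w, normSq (f w) ∂circ := by
  rw [lintegral_normSq hf, ← ENNReal.tsum_mul_left]
  refine tsum_congr fun i => tsum_enorm_sq_fcoef (memLp_of_lintegral_enorm_sq_lt_top (hf i) ?_)
  exact (lintegral_mono fun w => enorm_sq_le_normSq (f w) i).trans_lt hfin

lemma _root_.MeasureTheory.MemLp.integrable_circ {f : ℝ → ℂ} (hf : MemLp f 2 circ) :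
    Integrable f circ :=
  hf.integrable (by norm_num)

lemma enorm_sq_fcoef_le {f : ℝ → ℂ} (hf : MemLp f 2 circ) (q : ℤ) :
    ‖fcoef f q‖ₑ ^ 2 ≤ ENNReal.ofReal (1 / (2 * Real.pi)) * ∫⁻ w, ‖f w‖ₑ ^ 2 ∂circ := by
  rw [← tsum_enorm_sq_fcoef hf]
  exact ENNReal.le_tsum (f := fun q => ‖fcoef f q‖ₑ ^ 2) q

lemma aemeasurable_expI (q : ℤ) {μ : Measure ℝ} : AEMeasurable (expI q) μ :=
  (continuous_expI q).measurable.aemeasurable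

namespace IsFourierSum

variable {κ : Type*} {e : ℕ → ℤ} {c : ℕ → κ → ℂ} {f : ℝ → κ → ℂ}

lemma aemeasurable_sub (h : IsFourierSum e c f) (N : ℕ) (i : κ) :
    AEMeasurable (fun w => f w i - ∑ u ∈ Finset.range N, c u i * expI (e u) w) circ :=
  (h.aemeasurable i).sub <| Finset.aemeasurable_fun_sum _ fun _ _ =>
    (aemeasurable_expI _).const_mul _

lemma memLp_partialSum (N : ℕ) (i : κ) :
    MemLp (fun w => ∑ u ∈ Finset.range N, c u i * expI (e u) w) 2 circ :=
  memLp_finsetSum _ fun _ _ => (memLp_expI _).const_mul _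

lemma eventually_memLp_sub (h : IsFourierSum e c f) (i : κ) : ∀ᶠ N in atTop,
    MemLp (fun w => f w i - ∑ u ∈ Finset.range N, c u i * expI (e u) w) 2 circ := by
  filter_upwards [h.tendsto.eventually_lt_const ENNReal.zero_lt_top] with N hN
  exact memLp_of_lintegral_enorm_sq_lt_top (h.aemeasurable_sub N i)
    ((lintegral_mono fun w => enorm_sq_le_normSq _ i).trans_lt hN)

/-- A null sequence of remainders has a finite member, and the partial sums are bounded functions.
-/
lemma memLp (h : IsFourierSum e c f) (i : κ) : MemLp (fun w => f w i) 2 circ := by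
  obtain ⟨N, hN⟩ := (h.eventually_memLp_sub i).exists
  have := hN.add (memLp_partialSum (e := e) (c := c) N i)
  convert this using 1
  funext w
  simp

lemma fcoef_partialSum (N : ℕ) (i : κ) (q : ℤ) :
    fcoef (fun w => ∑ u ∈ Finset.range N, c u i * expI (e u) w) q =
      ∑ u ∈ Finset.range N, if e u = q then c u i else 0 := by
  rw [fcoef_sum _ fun u _ => (MemLp.integrable_circ (memLp_expI (e u))).const_mul (c u i)]
  refine Finset.sum_congr rfl fun u _ => ?_
  rw [fcoef_const_mul, fcoef_expI, mul_ite, mul_one, mul_zero]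

/-- The Fourier coefficients of the sum of a Fourier series. -/
lemma tendsto_fcoef (h : IsFourierSum e c f) (i : κ) (q : ℤ) :
    Tendsto (fun N : ℕ => ∑ u ∈ Finset.range N, if e u = q then c u i else 0) atTop
      (𝓝 (fcoef (fun w => f w i) q)) := by
  rw [tendsto_iff_enorm_sub_tendsto_zero]
  have hC : Tendsto (fun N : ℕ => (ENNReal.ofReal (1 / (2 * Real.pi)) * ∫⁻ w,
      normSq (fun i => f w i - ∑ u ∈ Finset.range N, c u i * expI (e u) w) ∂circ) ^ (1 / 2 : ℝ))
      atTop (𝓝 0) := by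
    have := ENNReal.Tendsto.const_mul (a := ENNReal.ofReal (1 / (2 * Real.pi))) h.tendsto
      (.inr ENNReal.ofReal_ne_top)
    rw [mul_zero] at this
    have := (ENNReal.continuous_rpow_const (y := 1 / 2)).tendsto 0 |>.comp this
    rw [ENNReal.zero_rpow_of_pos (by norm_num)] at this
    exact this
  refine tendsto_of_tendsto_of_tendsto_of_le_of_le' tendsto_const_nhds hC
    (.of_forall fun _ => zero_le) ?_
  filter_upwards [h.eventually_memLp_sub i] with N hN
  rw [← ENNReal.pow_le_pow_left_iff two_ne_zero, rpow_half_sq, ← fcoef_partialSum, enorm_sub_rev,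
    ← fcoef_sub (h.memLp i).integrable_circ (memLp_partialSum N i).integrable_circ]
  refine (enorm_sq_fcoef_le hN q).trans ?_
  gcongr
  exact enorm_sq_le_normSq (fun i => f _ i - ∑ u ∈ Finset.range N, c u i * expI (e u) _) i

lemma fcoef_eq_of_injective (h : IsFourierSum e c f) (he : Function.Injective e) (i : κ) (u : ℕ) :
    fcoef (fun w => f w i) (e u) = c u i := by
  refine tendsto_nhds_unique (h.tendsto_fcoef i (e u)) (tendsto_atTop_of_eventually_const
    (i₀ := u + 1) fun N hN => ?_)
  simp only [he.eq_iff]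
  rw [Finset.sum_ite_eq' , if_pos (Finset.mem_range.2 hN)]

lemma fcoef_eq_zero (h : IsFourierSum e c f) (i : κ) {q : ℤ} (hq : ∀ u, e u ≠ q) :
    fcoef (fun w => f w i) q = 0 := by
  refine tendsto_nhds_unique (h.tendsto_fcoef i q) ?_
  simp only [hq, if_false, Finset.sum_const_zero, tendsto_const_nhds_iff]

end IsFourierSum

lemma tsum_int_eq_of_lt {g : ℤ → ℝ≥0∞} (N : ℕ) (hg : ∀ q : ℤ, q < N → g q = 0) :
    ∑' q, g q = ∑' u : ℕ, g ((u + N : ℕ) : ℤ) := by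
  have hi : Function.Injective fun u : ℕ => ((u + N : ℕ) : ℤ) := fun u v h => by
    simp only at h
    omega
  refine (hi.tsum_eq fun q hq => ?_).symm
  have : (N : ℤ) ≤ q := by
    by_contra h
    exact hq (hg q (not_le.1 h))
  exact ⟨(q - N).toNat, by simp only; omega⟩

/-- A series with square summable coefficients converges in mean square. -/
lemma exists_isFourierSum {κ : Type*} [Countable κ] {c : ℕ → κ → ℂ}
    (hc : ∑' u, normSq (c u) < ∞) : ∃ f, IsFourierSum (fun j => (j : ℤ)) c f := by
  let b (i : κ) (q : ℤ) : ℂ := if q < 0 then 0 else c q.toNat i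
  have hb (i : κ) : ∑' q, ‖b i q‖ₑ ^ 2 < ∞ := by
    rw [tsum_int_eq_of_lt 0 fun q hq => by simp only [b, if_pos (show q < 0 from hq)]; simp]
    refine lt_of_le_of_lt (ENNReal.tsum_le_tsum fun u => ?_) hc
    simpa [b, show ¬ ((u : ℤ) < 0) by omega] using enorm_sq_le_normSq (c u) i
  choose f hf hfb using fun i => exists_fcoef_eq (hb i)
  have hsub (N : ℕ) (i : κ) :
      MemLp (fun w => f i w - ∑ u ∈ Finset.range N, c u i * expI (u : ℤ) w) 2 circ :=
    (hf i).sub (IsFourierSum.memLp_partialSum (e := fun j => (j : ℤ)) (c := c) N i)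
  refine ⟨fun w i => f i w, fun i => (hf i).1.aemeasurable, ?_⟩
  -- By Parseval the remainder after `N` terms has squared norm `2π` times the tail of the
  -- coefficient series.
  have key (N : ℕ) : ∫⁻ w, normSq (fun i => f i w -
      ∑ u ∈ Finset.range N, c u i * expI (u : ℤ) w) ∂circ =
      ENNReal.ofReal (2 * Real.pi) * ∑' u : ℕ, normSq (c (u + N)) := by
    rw [lintegral_normSq fun i => (hsub N i).1.aemeasurable]
    simp only [normSq]
    rw [ENNReal.tsum_comm, ← ENNReal.tsum_mul_left]
    refine tsum_congr fun i => ?_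
    have h := tsum_enorm_sq_fcoef (hsub N i)
    have hq (q : ℤ) : fcoef (fun w => f i w - ∑ u ∈ Finset.range N, c u i * expI (u : ℤ) w) q =
        if q < N then 0 else c q.toNat i := by
      refine (fcoef_sub (hf i).integrable_circ (IsFourierSum.memLp_partialSum
        (e := fun j => (j : ℤ)) (c := c) N i).integrable_circ q).trans ?_
      rw [hfb, IsFourierSum.fcoef_partialSum]
      simp only [b]
      rcases lt_or_ge q 0 with h0 | h0
      · rw [if_pos h0, if_pos (by omega), Finset.sum_eq_zero, sub_zero]
        exact fun u _ => if_neg (by omega)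
      · lift q to ℕ using h0
        rw [if_neg (by omega)]
        by_cases h : q < N <;> simp [Finset.sum_ite_eq', h]
    rw [tsum_int_eq_of_lt N fun q hN => by rw [hq, if_pos hN]; simp] at h
    have h2 : ENNReal.ofReal (2 * Real.pi) * ENNReal.ofReal (1 / (2 * Real.pi)) = 1 := by
      rw [← ENNReal.ofReal_mul two_pi_pos.le, mul_one_div_cancel two_pi_pos.ne', ENNReal.ofReal_one]
    have h3 := congrArg (ENNReal.ofReal (2 * Real.pi) * ·) h
    simp only [← mul_assoc, h2, one_mul] at h3
    rw [← h3]
    congr 1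
    refine tsum_congr fun u => ?_
    rw [hq, if_neg (by omega), Int.toNat_natCast]
  simp only [key]
  have := ENNReal.Tendsto.const_mul (a := ENNReal.ofReal (2 * Real.pi))
    (ENNReal.tendsto_sum_nat_add _ hc.ne) (.inr ENNReal.ofReal_ne_top)
  rwa [mul_zero] at this

/-! ### The isometry between `L₂(F)` and square summable noise coordinates -/

lemma memℓp_two_iff {κ : Type*} {v : κ → ℂ} : Memℓp v 2 ↔ normSq v < ∞ := by
  rw [memℓp_gen_iff (by norm_num), normSq, tsum_enorm_sq_lt_top_iff]
  simp

lemma enorm_lp_sq {κ : Type*} (x : lp (fun _ : κ => ℂ) 2) : ‖x‖ₑ ^ 2 = normSq x := by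
  have h := lp.hasSum_norm (p := 2) (by norm_num) x
  simp only [ENNReal.toReal_ofNat, Real.rpow_two] at h
  rw [normSq, tsum_enorm_sq h, ← ofReal_norm, ENNReal.ofReal_pow (norm_nonneg _)]

lemma summable_mul_of_normSq {κ : Type*} {v w : κ → ℂ} (hv : normSq v < ∞) (hw : normSq w < ∞) :
    Summable fun k => ‖v k * w k‖ := by
  rw [← tsum_enorm_ne_top_iff_summable_norm]
  simp only [enorm_mul]
  have h := (tsum_mul_sq_le (fun k => ‖v k‖ₑ) fun k => ‖w k‖ₑ).trans_lt (ENNReal.mul_lt_top hv hw)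
  intro h0
  rw [h0] at h
  simp at h

lemma enorm_tsum_mul_sq_le {κ : Type*} {v w : κ → ℂ} :
    ‖∑' k, v k * w k‖ₑ ^ 2 ≤ normSq v * normSq w := by
  refine le_trans ?_ (tsum_mul_sq_le _ _)
  gcongr
  refine (enorm_tsum_le_tsum_enorm).trans_eq ?_
  simp only [enorm_mul]

/-- If `G = D D^*` with a Hilbert–Schmidt matrix `D`, then `v^⊤ G \overline{v} = ‖D^⊤ v‖²`. -/
lemma ofReal_quadForm {κ : Type*} {D : ℕ → κ → ℂ} {G : ℕ → ℕ → ℂ}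
    (hG : ∀ k k', HasSum (fun r => D k r * conj (D k' r)) (G k k'))
    (hD : normSq (fun i : ℕ × κ => D i.1 i.2) < ∞) {v : ℕ → ℂ} (hv : normSq v < ∞) :
    ENNReal.ofReal (quadForm G v).re = normSq fun r => ∑' k, D k r * v k := by
  have hD' : ∑' r, normSq (fun k => D k r) < ∞ := by
    simpa only [normSq, ENNReal.tsum_prod (f := fun k r => ‖D k r‖ₑ ^ 2),
      ENNReal.tsum_comm (f := fun r k => ‖D k r‖ₑ ^ 2)] using hD
  have hr (r : κ) : normSq (fun k => D k r) < ∞ :=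
    (ENNReal.le_tsum (f := fun r => normSq fun k => D k r) r).trans_lt hD'
  let f : (ℕ × ℕ) × κ → ℂ := fun i => v i.1.1 * (D i.1.1 i.2 * conj (D i.1.2 i.2)) * conj (v i.1.2)
  let e : κ × (ℕ × ℕ) ≃ (ℕ × ℕ) × κ := Equiv.prodComm _ _
  -- The triple series converges absolutely, by Cauchy–Schwarz in `k` and the Hilbert–Schmidt bound
  -- in `r`. It can then be summed over `r` first, giving the form, or last, giving the squared
  -- norm.
  have hsum : Summable f := by
    refine Summable.of_norm ?_
    rw [← tsum_enorm_ne_top_iff_summable_norm, ← e.tsum_eq, ENNReal.tsum_prod']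
    have : ∀ r : κ, ∑' i : ℕ × ℕ, ‖f (e (r, i))‖ₑ = (∑' k, ‖D k r‖ₑ * ‖v k‖ₑ) ^ 2 := fun r => by
      rw [ENNReal.tsum_prod', sq, ← ENNReal.tsum_mul_right]
      refine tsum_congr fun k => ?_
      rw [← ENNReal.tsum_mul_left]
      refine tsum_congr fun k' => ?_
      simp only [f, e, Equiv.prodComm_apply, Prod.swap_prod_mk, enorm_mul, RCLike.enorm_conj]
      ring
    refine ne_of_lt ?_
    calc _ ≤ ∑' r, normSq (fun k => D k r) * normSq v := by
          refine ENNReal.tsum_le_tsum fun r => ?_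
          rw [this]
          exact tsum_mul_sq_le _ _
      _ < ∞ := by
          rw [ENNReal.tsum_mul_right]
          exact ENNReal.mul_lt_top hD' hv
  have h1 : ∑' i, f i = quadForm G v := by
    rw [hsum.tsum_prod, hsum.prod.tsum_prod]
    refine tsum_congr fun k => tsum_congr fun k' => ?_
    have := ((hG k k').mul_left (v k)).mul_right (conj (v k'))
    exact this.tsum_eq
  have h2 : HasSum (fun r => ∑' i : ℕ × ℕ, f (e (r, i))) (quadForm G v) := by
    rw [← h1, ← e.tsum_eq]
    exact (e.summable_iff.2 hsum).hasSum.prod_fiberwise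
      fun r => ((e.summable_iff.2 hsum).prod_factor r).hasSum
  have h3 (r : κ) : ∑' i : ℕ × ℕ, f (e (r, i)) = ((‖∑' k, D k r * v k‖ ^ 2 : ℝ) : ℂ) := by
    have hs := summable_mul_of_normSq (hr r) hv
    have hs' : Summable fun k => ‖conj (D k r * v k)‖ := by simpa only [RCLike.norm_conj] using hs
    rw [Complex.ofReal_pow, ← Complex.mul_conj', Complex.conj_tsum,
      tsum_mul_tsum_of_summable_norm hs hs']
    refine tsum_congr fun i => ?_
    simp only [f, e, Equiv.prodComm_apply, Prod.swap_prod_mk, map_mul]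
    ring
  simp only [h3] at h2
  exact (tsum_enorm_sq (Complex.hasSum_re h2)).symm

variable {Ω : Type*} [MeasurableSpace Ω] {P : Measure Ω} {n : ℕ} {z : HIdx n → ℤ → ℕ → Lp ℂ 2 P}
  {F : ℕ → ℝ → ℕ → ℕ → ℂ} {ι : ℕ → Type} {d : (m : ℕ) → ℕ → ℕ → ι m → ℂ}
  {D : (m : ℕ) → ℝ → ℕ → ι m → ℂ}

/-- A family of mutually uncorrelated vector stationary sequences with canonically factorized
spectral densities and summable variances. -/
structure IsFactorized (z : HIdx n → ℤ → ℕ → Lp ℂ 2 P) (F : ℕ → ℝ → ℕ → ℕ → ℂ)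
    (d : (m : ℕ) → ℕ → ℕ → ι m → ℂ) (D : (m : ℕ) → ℝ → ℕ → ι m → ℂ) : Prop where
  density : IsSpectralDensity z F
  canonical : ∀ m, IsCanonicalFactorization (F m) (d m) (D m)
  sum_variance : ∑' (p) (k), ‖z p 0 k‖ₑ ^ 2 < ∞
  uncorrelated : ∀ p p', p ≠ p' → ∀ i j k k', inner ℂ (z p i k) (z p' j k') = 0

/-- `D^⊤ h`. -/
def noiseSymbol (D : (m : ℕ) → ℝ → ℕ → ι m → ℂ) (h : HIdx n → ℝ → ℕ → ℂ) (p : HIdx n) (w : ℝ)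
    (r : ι p.1) : ℂ :=
  ∑' k, D p.1 w k r * h p w k

/-- The indices of the coordinates with respect to the white noises. -/
abbrev NoiseIdx (n : ℕ) (ι : ℕ → Type) : Type := (p : HIdx n) × (ι p.1 × ℤ)

/-- The Fourier coefficients of a family of functions. -/
def noiseCoef (g : (p : HIdx n) → ℝ → ι p.1 → ℂ) (i : NoiseIdx n ι) : ℂ :=
  fcoef (fun w => g i.1 w i.2.1) i.2.2

/-- The norm of `⨁ L₂([-π, π); ℓ₂)`. -/
def noiseNormSq (g : (p : HIdx n) → ℝ → ι p.1 → ℂ) : ℝ≥0∞ :=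
  ∑' p, ENNReal.ofReal (1 / (2 * Real.pi)) * ∫⁻ w, normSq (g p w) ∂circ

lemma ofReal_inv_two_pi_ne_zero : ENNReal.ofReal (1 / (2 * Real.pi)) ≠ 0 := by
  rw [ne_eq, ENNReal.ofReal_eq_zero, not_le]
  positivity

lemma lintegral_lt_top_of_noiseNormSq {g : (p : HIdx n) → ℝ → ι p.1 → ℂ}
    (h : noiseNormSq g < ∞) (p : HIdx n) : ∫⁻ w, normSq (g p w) ∂circ < ∞ := by
  have := (ENNReal.le_tsum (f := fun p => ENNReal.ofReal (1 / (2 * Real.pi)) *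
    ∫⁻ w, normSq (g p w) ∂circ) p).trans_lt h
  exact ENNReal.lt_top_of_mul_ne_top_right this.ne ofReal_inv_two_pi_ne_zero

lemma noiseNormSq_congr {f g : (p : HIdx n) → ℝ → ι p.1 → ℂ}
    (h : ∀ p, ∀ᵐ w ∂circ, ∀ r, f p w r = g p w r) : noiseNormSq f = noiseNormSq g := by
  unfold noiseNormSq
  refine tsum_congr fun p => ?_
  congr 1
  refine lintegral_congr_ae ?_
  filter_upwards [h p] with w hw
  rw [funext hw]

lemma noiseCoef_congr {f g : (p : HIdx n) → ℝ → ι p.1 → ℂ}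
    (h : ∀ p, ∀ᵐ w ∂circ, ∀ r, f p w r = g p w r) : noiseCoef f = noiseCoef g := by
  funext i
  refine fcoef_congr ?_ _
  filter_upwards [h i.1] with w hw
  exact hw _

lemma aemeasurable_tsum {X I : Type*} [Countable I] [MeasurableSpace X] {μ : Measure X}
    {f : I → X → ℂ} (hf : ∀ i, AEMeasurable (f i) μ) (hs : ∀ᵐ x ∂μ, Summable fun i => f i x) :
    AEMeasurable (fun x => ∑' i, f i x) μ := by
  refine aemeasurable_of_tendsto_metrizable_ae (atTop : Filter (Finset I))
    (f := fun s x => ∑ i ∈ s, f i x) (fun s => Finset.aemeasurable_fun_sum s fun i _ => hf i) ?_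
  filter_upwards [hs] with x hx
  exact hx.hasSum

namespace IsFactorized

lemma inner_eq (M : IsFactorized z F d D) (p : HIdx n) (i j : ℤ) (k k' : ℕ) :
    inner ℂ (z p j k') (z p i k) =
    ((1 / (2 * Real.pi) : ℝ) : ℂ) * ∫ w, expI (i - j) w * F p.1 w k k' ∂circ := by
  rw [← corr_eq_inner, M.density.corr_eq]

/-- Both sides are `∫ F_kk`: on the left by the factorization, on the right by the spectral
representation of the variance, which is the same for every `j`. -/
lemma lintegral_row (M : IsFactorized z F d D) (p : HIdx n) (j : ℤ) (k : ℕ) :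
    ∫⁻ w, normSq (fun r => D p.1 w k r) ∂circ = ENNReal.ofReal (2 * Real.pi) * ‖z p j k‖ₑ ^ 2 := by
  have hF := (M.canonical p.1).factor
  have hsum : ∀ᵐ w ∂circ, HasSum (fun r => ‖D p.1 w k r‖ ^ 2) (F p.1 w k k).re := by
    filter_upwards [hF] with w hw
    have := hw k k
    simp only [Complex.mul_conj'] at this
    exact_mod_cast Complex.hasSum_re this
  have h1 : ∫⁻ w, normSq (fun r => D p.1 w k r) ∂circ =
      ∫⁻ w, ENNReal.ofReal (F p.1 w k k).re ∂circ := by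
    refine lintegral_congr_ae ?_
    filter_upwards [hsum] with w hw
    exact tsum_enorm_sq hw
  have h2 : ‖z p j k‖ ^ 2 = 1 / (2 * Real.pi) * ∫ w, (F p.1 w k k).re ∂circ := by
    have h := congrArg Complex.re (M.inner_eq p j j k k)
    simp only [sub_self, expI_zero, one_mul, Complex.re_ofReal_mul] at h
    rw [← RCLike.re_eq_complex_re, ← norm_sq_eq_re_inner, RCLike.re_eq_complex_re,
      ← RCLike.re_eq_complex_re, ← integral_re (M.density.integrable p.1 k k)] at h
    exact h
  have h3 := ofReal_integral_eq_lintegral_ofReal (M.density.integrable p.1 k k).re (by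
    filter_upwards [hsum] with w hw
    exact hw.nonneg fun _ => by positivity)
  simp only [RCLike.re_eq_complex_re] at h3
  rw [h1, ← h3, ← ofReal_norm,
    ← ENNReal.ofReal_pow (norm_nonneg _), h2, ← ENNReal.ofReal_mul two_pi_pos.le, ← mul_assoc,
    mul_one_div_cancel two_pi_pos.ne', one_mul]

lemma aemeasurable (M : IsFactorized z F d D) (p : HIdx n) (k : ℕ) (r : ι p.1) :
    AEMeasurable (fun w => D p.1 w k r) circ :=
  (M.canonical p.1).series.aemeasurable (k, r)

lemma memLp (M : IsFactorized z F d D) (p : HIdx n) (k : ℕ) (r : ι p.1) :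
    MemLp (fun w => D p.1 w k r) 2 circ :=
  (M.canonical p.1).series.memLp (k, r)

end IsFactorized

variable [∀ m, Countable (ι m)]

lemma noiseNormSq_add_const_mul_le {f g : (p : HIdx n) → ℝ → ι p.1 → ℂ} (b : ℂ)
    (hf : ∀ p r, AEMeasurable (fun w => f p w r) circ) :
    noiseNormSq (fun p w r => f p w r + b * g p w r) ≤
      2 * noiseNormSq f + 2 * (‖b‖ₑ ^ 2 * noiseNormSq g) := by
  unfold noiseNormSq
  simp only [← ENNReal.tsum_mul_left, ← ENNReal.tsum_add]
  refine ENNReal.tsum_le_tsum fun p => ?_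
  calc _ ≤ ENNReal.ofReal (1 / (2 * Real.pi)) *
        ∫⁻ w, (2 * normSq (f p w) + 2 * (‖b‖ₑ ^ 2 * normSq (g p w))) ∂circ := by
        gcongr with w
        rw [← normSq_const_mul]
        exact normSq_add_le _ _
    _ = _ := by
        rw [lintegral_add_left' ((aemeasurable_normSq (hf p)).const_mul 2),
          lintegral_const_mul' _ _ (by simp), lintegral_const_mul' _ _ (by simp),
          lintegral_const_mul' _ _ (by simp)]
        ring

lemma normSq_noiseCoef {g : (p : HIdx n) → ℝ → ι p.1 → ℂ}
    (hg : ∀ p r, AEMeasurable (fun w => g p w r) circ) (h : noiseNormSq g < ∞) :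
    normSq (noiseCoef g) = noiseNormSq g := by
  rw [normSq, ENNReal.tsum_sigma', noiseNormSq]
  refine tsum_congr fun p => ?_
  rw [← tsum_normSq_fcoef (hg p) (lintegral_lt_top_of_noiseNormSq h p), ENNReal.tsum_prod']
  rfl

namespace IsFactorized

/-- Summing the rows relates the Hilbert–Schmidt norm of the factor to the variances. Summable
variances therefore make the factor Hilbert–Schmidt at almost every frequency. -/
lemma lintegral_hilbertSchmidt (M : IsFactorized z F d D) (p : HIdx n) :
    ∫⁻ w, normSq (fun i : ℕ × ι p.1 => D p.1 w i.1 i.2) ∂circ =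
      ENNReal.ofReal (2 * Real.pi) * ∑' k, ‖z p 0 k‖ₑ ^ 2 := by
  rw [← ENNReal.tsum_mul_left]
  simp only [← M.lintegral_row p 0]
  rw [← lintegral_tsum fun k => aemeasurable_normSq (M.aemeasurable p k)]
  exact lintegral_congr fun w => ENNReal.tsum_prod'

lemma ae_hilbertSchmidt (M : IsFactorized z F d D) (p : HIdx n) :
    ∀ᵐ w ∂circ, normSq (fun i : ℕ × ι p.1 => D p.1 w i.1 i.2) < ∞ := by
  refine ae_lt_top' (aemeasurable_normSq fun i => M.aemeasurable p i.1 i.2) ?_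
  rw [M.lintegral_hilbertSchmidt]
  exact (ENNReal.mul_lt_top ENNReal.ofReal_lt_top
    ((ENNReal.le_tsum (f := fun p => ∑' k, ‖z p 0 k‖ₑ ^ 2) p).trans_lt M.sum_variance)).ne

lemma ae_column (M : IsFactorized z F d D) (p : HIdx n) :
    ∀ᵐ w ∂circ, ∑' r, normSq (fun k => D p.1 w k r) < ∞ := by
  filter_upwards [M.ae_hilbertSchmidt p] with w hw
  simpa only [normSq, ENNReal.tsum_prod (f := fun k r => ‖D p.1 w k r‖ₑ ^ 2),
      ENNReal.tsum_comm (f := fun r k => ‖D p.1 w k r‖ₑ ^ 2)] using hw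

variable {h g : HIdx n → ℝ → ℕ → ℂ}

lemma ae_summable (M : IsFactorized z F d D) (hh : ∀ p, ∀ᵐ w ∂circ, Memℓp (h p w) 2) (p : HIdx n) :
    ∀ᵐ w ∂circ, ∀ r, Summable fun k => D p.1 w k r * h p w k := by
  filter_upwards [M.ae_column p, hh p] with w h1 h2 r
  exact (summable_mul_of_normSq ((ENNReal.le_tsum (f := fun r => normSq fun k => D p.1 w k r)
    r).trans_lt h1) (memℓp_two_iff.1 h2)).of_norm

lemma aemeasurable_noiseSymbol (M : IsFactorized z F d D)
    (hm : ∀ p k, AEMeasurable (fun w => h p w k) circ)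
    (hh : ∀ p, ∀ᵐ w ∂circ, Memℓp (h p w) 2) (p : HIdx n) (r : ι p.1) :
    AEMeasurable (fun w => noiseSymbol D h p w r) circ :=
  aemeasurable_tsum (fun k => (M.aemeasurable p k r).mul (hm p k)) <| by
    filter_upwards [M.ae_summable hh p] with w hw
    exact hw r

/-- Pointwise `F = D D^*` turns the quadratic form of `h` into `‖D^⊤ h‖²`; the weighted norm becomes
an unweighted one. -/
lemma specNormSq_eq (M : IsFactorized z F d D) (hh : ∀ p, ∀ᵐ w ∂circ, Memℓp (h p w) 2) :
    specNormSq F h = noiseNormSq (noiseSymbol D h) := by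
  refine tsum_congr fun p => ?_
  congr 1
  refine lintegral_congr_ae ?_
  filter_upwards [(M.canonical p.1).factor, M.ae_hilbertSchmidt p, hh p] with w h1 h2 h3
  exact ofReal_quadForm h1 h2 (memℓp_two_iff.1 h3)

lemma noiseSymbol_add_const_mul (M : IsFactorized z F d D) (hh : ∀ p, ∀ᵐ w ∂circ, Memℓp (h p w) 2)
    (hg : ∀ p, ∀ᵐ w ∂circ, Memℓp (g p w) 2) (b : ℂ) (p : HIdx n) : ∀ᵐ w ∂circ, ∀ r,
    noiseSymbol D (fun p w k => h p w k + b * g p w k) p w r =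
      noiseSymbol D h p w r + b * noiseSymbol D g p w r := by
  filter_upwards [M.ae_summable hh p, M.ae_summable hg p] with w h1 h2 r
  unfold noiseSymbol
  rw [← tsum_mul_left, ← (h1 r).tsum_add ((h2 r).mul_left b)]
  exact tsum_congr fun k => by ring

lemma noiseNormSq_lt_top (M : IsFactorized z F d D) (hh : MemL2 F h) :
    noiseNormSq (noiseSymbol D h) < ∞ :=
  M.specNormSq_eq hh.memℓp ▸ hh.finite

lemma memLp_noiseSymbol (M : IsFactorized z F d D) (hh : MemL2 F h) (p : HIdx n) (r : ι p.1) :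
    MemLp (fun w => noiseSymbol D h p w r) 2 circ :=
  memLp_of_lintegral_enorm_sq_lt_top (M.aemeasurable_noiseSymbol hh.aemeasurable hh.memℓp p r)
    ((lintegral_mono fun w => enorm_sq_le_normSq (noiseSymbol D h p w) r).trans_lt
      (lintegral_lt_top_of_noiseNormSq (M.noiseNormSq_lt_top hh) p))

/-- Parseval's identity in `L₂(F)`. -/
lemma specNormSq_eq_normSq (M : IsFactorized z F d D) (hh : MemL2 F h) :
    specNormSq F h = normSq (noiseCoef (noiseSymbol D h)) := by
  rw [normSq_noiseCoef (M.aemeasurable_noiseSymbol hh.aemeasurable hh.memℓp)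
    (M.noiseNormSq_lt_top hh), M.specNormSq_eq hh.memℓp]

lemma memL2_add_const_mul (M : IsFactorized z F d D) (hh : MemL2 F h) (hg : MemL2 F g) (b : ℂ) :
    MemL2 F fun p w k => h p w k + b * g p w k := by
  have hm : ∀ p, ∀ᵐ w ∂circ, Memℓp (fun k => h p w k + b * g p w k) 2 := fun p => by
    filter_upwards [hh.memℓp p, hg.memℓp p] with w h1 h2
    exact h1.add (h2.const_mul b)
  refine ⟨fun p k => (hh.aemeasurable p k).add ((hg.aemeasurable p k).const_mul b), hm, ?_⟩
  rw [M.specNormSq_eq hm, noiseNormSq_congr (M.noiseSymbol_add_const_mul hh.memℓp hg.memℓp b)]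
  refine (noiseNormSq_add_const_mul_le b
    (M.aemeasurable_noiseSymbol hh.aemeasurable hh.memℓp)).trans_lt (ENNReal.add_lt_top.2 ⟨?_, ?_⟩)
  · exact ENNReal.mul_lt_top (by simp) (M.noiseNormSq_lt_top hh)
  · exact ENNReal.mul_lt_top (by simp) (ENNReal.mul_lt_top (by simp) (M.noiseNormSq_lt_top hg))

lemma noiseCoef_add_const_mul (M : IsFactorized z F d D) (hh : MemL2 F h) (hg : MemL2 F g) (b : ℂ)
    (i : NoiseIdx n ι) :
    noiseCoef (noiseSymbol D fun p w k => h p w k + b * g p w k) i =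
      noiseCoef (noiseSymbol D h) i + b * noiseCoef (noiseSymbol D g) i := by
  rw [noiseCoef_congr (M.noiseSymbol_add_const_mul hh.memℓp hg.memℓp b)]
  have h1 := (M.memLp_noiseSymbol hh i.1 i.2.1).integrable_circ
  have h2 := (M.memLp_noiseSymbol hg i.1 i.2.1).integrable_circ
  have h3 := fcoef_sub h1 (h2.const_mul (-b)) i.2.2
  simp only [neg_mul, sub_neg_eq_add] at h3
  unfold noiseCoef
  rw [h3, ← sub_neg_eq_add, ← neg_mul, ← fcoef_const_mul]
  simp only [neg_mul]

lemma memL2_sub (M : IsFactorized z F d D) (hh : MemL2 F h) (hg : MemL2 F g) :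
    MemL2 F fun p w k => h p w k - g p w k := by
  simpa only [neg_one_mul, ← sub_eq_add_neg] using M.memL2_add_const_mul hh hg (-1)

lemma noiseCoef_sub (M : IsFactorized z F d D) (hh : MemL2 F h) (hg : MemL2 F g) (i : NoiseIdx n ι) :
    noiseCoef (noiseSymbol D fun p w k => h p w k - g p w k) i =
      noiseCoef (noiseSymbol D h) i - noiseCoef (noiseSymbol D g) i := by
  simpa only [neg_one_mul, ← sub_eq_add_neg] using M.noiseCoef_add_const_mul hh hg (-1) i

end IsFactorized

variable {Ω : Type*} [MeasurableSpace Ω] {P : Measure Ω} {n : ℕ} {z : HIdx n → ℤ → ℕ → Lp ℂ 2 P}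
  {F : ℕ → ℝ → ℕ → ℕ → ℂ} {ι : ℕ → Type} {d : (m : ℕ) → ℕ → ℕ → ι m → ℂ}
  {D : (m : ℕ) → ℝ → ℕ → ι m → ℂ}

/-! ### The noise coordinates of trigonometric polynomials -/

lemma trigPoly_add (c c' : (HIdx n × ℤ × ℕ) →₀ ℂ) (p : HIdx n) (w : ℝ) (k : ℕ) :
    trigPoly (c + c') p w k = trigPoly c p w k + trigPoly c' p w k :=
  Finsupp.sum_add_index' (fun _ => by simp) fun _ _ _ => by split_ifs <;> simp [add_mul]

lemma trigPoly_single (i : HIdx n × ℤ × ℕ) (b : ℂ) (p : HIdx n) (w : ℝ) (k : ℕ) :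
    trigPoly (Finsupp.single i b) p w k =
      if i.1 = p ∧ i.2.2 = k then b * expI i.2.1 w else 0 :=
  Finsupp.sum_single_index (by simp)

lemma memℓp_trigPoly (c : (HIdx n × ℤ × ℕ) →₀ ℂ) (p : HIdx n) (w : ℝ) :
    Memℓp (trigPoly c p w) 2 := by
  rw [memℓp_two_iff]
  induction c using Finsupp.induction_linear with
  | zero => simp [normSq, trigPoly]
  | add f g hf hg =>
    rw [show trigPoly (f + g) p w = fun k => trigPoly f p w k + trigPoly g p w k from
      funext fun k => trigPoly_add f g p w k]
    exact (normSq_add_le _ _).trans_lt (ENNReal.add_lt_top.2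
      ⟨ENNReal.mul_lt_top (by simp) hf, ENNReal.mul_lt_top (by simp) hg⟩)
  | single i b =>
    rw [normSq, tsum_eq_single i.2.2]
    · simp
    · intro k hk
      rw [trigPoly_single, if_neg fun h => hk h.2.symm]
      simp

lemma aemeasurable_trigPoly (c : (HIdx n × ℤ × ℕ) →₀ ℂ) (p : HIdx n) (k : ℕ) :
    AEMeasurable (fun w => trigPoly c p w k) circ := by
  refine Finset.aemeasurable_fun_sum _ fun i _ => ?_
  dsimp only
  split_ifs
  · exact (aemeasurable_expI _).const_mul _
  · exact aemeasurable_const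

lemma noiseSymbol_single (p : HIdx n) (j : ℤ) (k : ℕ) (b : ℂ) (p' : HIdx n) (w : ℝ)
    (r : ι p'.1) : noiseSymbol D (trigPoly (Finsupp.single (p, j, k) b)) p' w r =
      if p = p' then b * (expI j w * D p'.1 w k r) else 0 := by
  unfold noiseSymbol
  simp only [trigPoly_single]
  rw [tsum_eq_single k]
  · simp only [and_true, mul_ite, mul_zero]
    congr 1
    ring
  · intro k' hk
    rw [if_neg fun h => hk h.2.symm, mul_zero]

/-- The coordinates of `e^{i j w} δ_k`, placed at `p`. -/
lemma noiseCoef_single (p : HIdx n) (j : ℤ) (k : ℕ) (b : ℂ) (i : NoiseIdx n ι) :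
    noiseCoef (noiseSymbol D (trigPoly (Finsupp.single (p, j, k) b))) i =
      if p = i.1 then b * fcoef (fun w => D i.1.1 w k i.2.1) (i.2.2 - j) else 0 := by
  unfold noiseCoef
  simp only [noiseSymbol_single]
  split_ifs
  · rw [fcoef_const_mul, fcoef_expI_mul]
  · simp [fcoef]

namespace IsFactorized

lemma fcoef_symbol_nonpos (M : IsFactorized z F d D) (p : HIdx n) (k : ℕ) (r : ι p.1) (u : ℕ) :
    fcoef (fun w => D p.1 w k r) (-(u : ℤ)) = d p.1 u k r :=
  (M.canonical p.1).series.fcoef_eq_of_injective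
    (fun u v h => by simpa using h) (k, r) u

/-- The factor is a series in `e^{-i u w}` with `u ≥ 0`. This absence of positive frequencies is the
causality of the representation. -/
lemma fcoef_symbol_pos (M : IsFactorized z F d D) (p : HIdx n) (k : ℕ) (r : ι p.1) {q : ℤ}
    (hq : 0 < q) : fcoef (fun w => D p.1 w k r) q = 0 :=
  (M.canonical p.1).series.fcoef_eq_zero (k, r) fun u => by omega

end IsFactorized

variable [∀ m, Countable (ι m)]

namespace IsFactorized

lemma memL2_single (M : IsFactorized z F d D) (i : HIdx n × ℤ × ℕ) (b : ℂ) :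
    MemL2 F (trigPoly (Finsupp.single i b)) := by
  refine ⟨aemeasurable_trigPoly _, fun p => .of_forall (memℓp_trigPoly _ p), ?_⟩
  obtain ⟨p, j, k⟩ := i
  rw [M.specNormSq_eq fun p => .of_forall (memℓp_trigPoly _ p), noiseNormSq, tsum_eq_single p]
  · refine ENNReal.mul_lt_top ENNReal.ofReal_lt_top ?_
    calc _ = ∫⁻ w, ‖b‖ₑ ^ 2 * normSq (fun r => D p.1 w k r) ∂circ := by
          refine lintegral_congr fun w => ?_
          rw [← normSq_const_mul]
          refine tsum_congr fun r => ?_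
          rw [noiseSymbol_single, if_pos rfl, enorm_mul, enorm_mul, enorm_mul, enorm_expI, one_mul]
      _ < ∞ := by
          rw [lintegral_const_mul' _ _ (by simp), M.lintegral_row p 0]
          exact ENNReal.mul_lt_top (by simp) (ENNReal.mul_lt_top ENNReal.ofReal_lt_top (by simp))
  · intro p' hp
    simp [noiseSymbol_single, hp.symm, normSq]

lemma memL2_trigPoly (M : IsFactorized z F d D) (c : (HIdx n × ℤ × ℕ) →₀ ℂ) :
    MemL2 F (trigPoly c) := by
  induction c using Finsupp.induction_linear with
  | zero =>
    refine ⟨aemeasurable_trigPoly _, fun p => .of_forall (memℓp_trigPoly _ p), ?_⟩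
    rw [M.specNormSq_eq fun p => .of_forall (memℓp_trigPoly _ p)]
    simp [noiseNormSq, noiseSymbol, normSq, trigPoly]
  | add f g hf hg =>
    simpa only [one_mul, ← trigPoly_add] using M.memL2_add_const_mul hf hg 1
  | single i b => exact M.memL2_single i b

variable {h g : HIdx n → ℝ → ℕ → ℂ}

/-- The vector of the noise coordinates of an element of `L₂(F)`. -/
def coefVec (M : IsFactorized z F d D) (hh : MemL2 F h) : lp (fun _ : NoiseIdx n ι => ℂ) 2 :=
  ⟨noiseCoef (noiseSymbol D h), memℓp_two_iff.2 (M.specNormSq_eq_normSq hh ▸ hh.finite)⟩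

lemma coefVec_apply (M : IsFactorized z F d D) (hh : MemL2 F h) (i : NoiseIdx n ι) :
    M.coefVec hh i = noiseCoef (noiseSymbol D h) i := rfl

lemma enorm_coefVec_sq (M : IsFactorized z F d D) (hh : MemL2 F h) :
    ‖M.coefVec hh‖ₑ ^ 2 = specNormSq F h := by
  rw [enorm_lp_sq, M.specNormSq_eq_normSq hh]
  rfl

lemma coefVec_sub (M : IsFactorized z F d D) (hh : MemL2 F h) (hg : MemL2 F g) :
    M.coefVec (M.memL2_sub hh hg) = M.coefVec hh - M.coefVec hg :=
  lp.ext <| funext fun i => M.noiseCoef_sub hh hg i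

/-- The coordinates of `e^{i j w} δ_k`, placed at `p`. -/
def vec (M : IsFactorized z F d D) (p : HIdx n) (j : ℤ) (k : ℕ) :
    lp (fun _ : NoiseIdx n ι => ℂ) 2 :=
  M.coefVec (M.memL2_single (p, j, k) 1)

lemma vec_apply (M : IsFactorized z F d D) (p : HIdx n) (j : ℤ) (k : ℕ) (i : NoiseIdx n ι) :
    M.vec p j k i = if p = i.1 then fcoef (fun w => D i.1.1 w k i.2.1) (i.2.2 - j) else 0 := by
  rw [vec, coefVec_apply, noiseCoef_single]
  simp only [one_mul]

lemma coefVec_trigPoly (M : IsFactorized z F d D) (c : (HIdx n × ℤ × ℕ) →₀ ℂ) :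
    M.coefVec (M.memL2_trigPoly c) = c.sum fun i b => b • M.vec i.1 i.2.1 i.2.2 := by
  induction c using Finsupp.induction_linear with
  | zero =>
    refine lp.ext (funext fun i => ?_)
    simp [coefVec_apply, noiseCoef, noiseSymbol, trigPoly, fcoef]
  | add f g hf hg =>
    rw [Finsupp.sum_add_index' (by simp) (by simp [add_smul]), ← hf, ← hg]
    refine lp.ext (funext fun i => ?_)
    have := M.noiseCoef_add_const_mul (M.memL2_trigPoly f) (M.memL2_trigPoly g) 1 i
    simp only [one_mul, ← trigPoly_add] at this
    exact this
  | single i b =>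
    rw [Finsupp.sum_single_index (by simp)]
    refine lp.ext (funext fun s => ?_)
    rw [lp.coeFn_smul, Pi.smul_apply, vec_apply, coefVec_apply, noiseCoef_single]
    simp

/-- Multiplying the factor by `e^{i j w}` shifts its frequencies to at most `j`: the sequence at
time `j` does not involve later noise. -/
lemma vec_apply_eq_zero (M : IsFactorized z F d D) (p : HIdx n) {j : ℤ} (k : ℕ)
    (i : NoiseIdx n ι) (hi : j < i.2.2) : M.vec p j k i = 0 := by
  rw [vec_apply, M.fcoef_symbol_pos _ _ _ (by omega), ite_self]

end IsFactorized

variable {Ω : Type*} [MeasurableSpace Ω] {P : Measure Ω} {n : ℕ} {z : HIdx n → ℤ → ℕ → Lp ℂ 2 P}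
  {F : ℕ → ℝ → ℕ → ℕ → ℂ} {ι : ℕ → Type} {d : (m : ℕ) → ℕ → ℕ → ι m → ℂ}
  {D : (m : ℕ) → ℝ → ℕ → ι m → ℂ}

/-! ### The isometry from the noise coordinates to `L₂(Ω)` -/

lemma hasSum_of_fiber {κ : Type*} {β : κ → Type*} {E : Type*} [AddCommMonoid E]
    [TopologicalSpace E] (p : κ) {f : (Σ p, β p) → E} {a : E}
    (h0 : ∀ i, i.1 ≠ p → f i = 0) (h : HasSum (fun b => f ⟨p, b⟩) a) : HasSum f a := by
  refine (Function.Injective.hasSum_iff (f := f) (g := fun b : β p => (⟨p, b⟩ : Σ p, β p))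
    sigma_mk_injective fun i hi => h0 i fun hp => hi ?_).1 h
  obtain ⟨p', b⟩ := i
  obtain rfl : p' = p := hp
  exact ⟨b, rfl⟩

lemma tsum_fiber {κ : Type*} {β : κ → Type*} (p : κ) {f : (Σ p, β p) → ℝ≥0∞}
    (h0 : ∀ i, i.1 ≠ p → f i = 0) : ∑' i, f i = ∑' b, f ⟨p, b⟩ :=
  (hasSum_of_fiber p h0 ENNReal.summable.hasSum).tsum_eq

lemma hasSum_conj_mul_lp {κ : Type*} (x y : lp (fun _ : κ => ℂ) 2) :
    HasSum (fun i => conj (x i) * y i) (inner ℂ x y) := by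
  simpa only [RCLike.inner_apply'] using lp.hasSum_inner (𝕜 := ℂ) x y

namespace IsFactorized

lemma summable_integral_sq (M : IsFactorized z F d D) (p : HIdx n) (k : ℕ) [Countable (ι p.1)] :
    Summable fun r => ∫ w, ‖D p.1 w k r‖ ^ 2 ∂circ := by
  have h := M.lintegral_row p 0 k
  rw [lintegral_normSq (M.aemeasurable p k)] at h
  have h2 : ∑' r, ∫⁻ w, ‖D p.1 w k r‖ₑ ^ 2 ∂circ ≠ ∞ := by
    rw [h]
    exact (ENNReal.mul_lt_top ENNReal.ofReal_lt_top (by simp)).ne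
  refine (ENNReal.summable_toReal h2).congr fun r => ?_
  simp only [enorm_sq_eq_ofReal]
  rw [← integral_eq_lintegral_of_nonneg_ae (.of_forall fun w => by positivity)]
  exact ((M.memLp p k r).norm.aestronglyMeasurable).pow 2

/-- `∑_r (1/2π) ∫ e^{i q w} D_{k'r} \overline{D_{kr}} dw = (1/2π) ∫ e^{i q w} F_{k'k} dw`. -/
lemma hasSum_integral_factor (M : IsFactorized z F d D) (p : HIdx n) [Countable (ι p.1)]
    (q : ℤ) (k k' : ℕ) :
    HasSum (fun r => ∫ w, expI q w * (D p.1 w k' r * conj (D p.1 w k r)) ∂circ)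
      (∫ w, expI q w * F p.1 w k' k ∂circ) := by
  have hint (k : ℕ) (r : ι p.1) : Integrable (fun w => ‖D p.1 w k r‖ ^ 2) circ := by
    simpa using (M.memLp p k r).integrable_norm_rpow (by norm_num) (by norm_num)
  have hI (r : ι p.1) :
      Integrable (fun w => expI q w * (D p.1 w k' r * conj (D p.1 w k r))) circ := by
    have := (integrable_conj_mul (M.memLp p k r) (M.memLp p k' r)).bdd_mul (c := 1)
      (continuous_expI q).aestronglyMeasurable (.of_forall fun w => (norm_expI q w).le)
    simpa only [mul_comm (conj _)] using this
  -- Termwise integration is justified by `|x y| ≤ |x|² + |y|²` and the finite squared norms of the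
  -- two rows.
  have h := hasSum_integral_of_summable_integral_norm hI (by
    refine Summable.of_nonneg_of_le (fun r => by positivity) (fun r => ?_)
      ((M.summable_integral_sq p k').add (M.summable_integral_sq p k))
    rw [← integral_add (hint k' r) (hint k r)]
    refine integral_mono (hI r).norm ((hint k' r).add (hint k r)) fun w => ?_
    simp only [norm_mul, norm_expI, one_mul, RCLike.norm_conj]
    nlinarith [sq_nonneg (‖D p.1 w k' r‖ - ‖D p.1 w k r‖), sq_nonneg (‖D p.1 w k' r‖),
      sq_nonneg ‖D p.1 w k r‖])
  have e : ∫ w, expI q w * F p.1 w k' k ∂circ =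
      ∫ w, ∑' r, expI q w * (D p.1 w k' r * conj (D p.1 w k r)) ∂circ := by
    refine integral_congr_ae ?_
    filter_upwards [(M.canonical p.1).factor] with w hw
    rw [tsum_mul_left, (hw k' k).tsum_eq]
  rwa [e]

variable [∀ m, Countable (ι m)]

/-- The vectors `vec p j k` and the random variables `z p j k` have the same Gram matrix. -/
lemma inner_vec (M : IsFactorized z F d D) (p p' : HIdx n) (j j' : ℤ) (k k' : ℕ) :
    inner ℂ (M.vec p j k) (M.vec p' j' k') = inner ℂ (z p j k) (z p' j' k') := by
  have h := hasSum_conj_mul_lp (M.vec p j k) (M.vec p' j' k')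
  by_cases hp : p = p'
  · subst hp
    refine h.unique (hasSum_of_fiber p (fun i hi => ?_) ?_)
    · simp [vec_apply, hi.symm]
    · have hm (j : ℤ) (k : ℕ) (r : ι p.1) :
          MemLp (fun w => expI j w * D p.1 w k r) 2 circ := by
        refine (M.memLp p k r).of_le ?_ (.of_forall fun w => ?_)
        · exact (continuous_expI j).aestronglyMeasurable.mul (M.memLp p k r).1
        · rw [norm_mul, norm_expI, one_mul]
      have hv (j : ℤ) (k : ℕ) (b : ι p.1 × ℤ) :
          M.vec p j k ⟨p, b⟩ = fcoef (fun w => expI j w * D p.1 w k b.1) b.2 := by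
        rw [vec_apply, if_pos rfl, fcoef_expI_mul]
      have hs : Summable fun b : ι p.1 × ℤ =>
          conj (fcoef (fun w => expI j w * D p.1 w k b.1) b.2) *
            fcoef (fun w => expI j' w * D p.1 w k' b.1) b.2 := by
        have := h.summable.comp_injective (i := fun b : ι p.1 × ℤ => (⟨p, b⟩ : NoiseIdx n ι))
          fun a b hab => by simpa using hab
        simpa only [Function.comp_def, hv] using this
      rw [M.inner_eq]
      -- For each noise `r` Parseval sums over the times; the sum over `r` then reconstitutes the
      -- entry of `F`.
      have h1 := hs.hasSum.prod_fiberwise (g := fun r => ((1 / (2 * Real.pi) : ℝ) : ℂ) *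
        ∫ w, expI (j' - j) w * (D p.1 w k' r * conj (D p.1 w k r)) ∂circ) fun r => by
          have := hasSum_fcoef (hm j k r) (hm j' k' r)
          have e (w : ℝ) : conj (expI j w * D p.1 w k r) * (expI j' w * D p.1 w k' r) =
              expI (j' - j) w * (D p.1 w k' r * conj (D p.1 w k r)) := by
            rw [map_mul, conj_expI, sub_eq_add_neg, expI_add]
            ring
          simpa only [e] using this
      have h2 := (M.hasSum_integral_factor p (j' - j) k k').mul_left ((1 / (2 * Real.pi) : ℝ) : ℂ)
      rw [← h1.unique h2]
      simp only [hv]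
      exact hs.hasSum
  · rw [M.uncorrelated p p' hp]
    refine h.unique ?_
    convert hasSum_zero with i
    rw [vec_apply, vec_apply]
    split_ifs with h1 h2
    · exact absurd (h1.trans h2.symm) hp
    all_goals simp

lemma norm_sum_smul (M : IsFactorized z F d D) (c : (HIdx n × ℤ × ℕ) →₀ ℂ) :
    ‖c.sum fun i b => b • z i.1 i.2.1 i.2.2‖ = ‖c.sum fun i b => b • M.vec i.1 i.2.1 i.2.2‖ := by
  have h : (inner ℂ (c.sum fun i b => b • z i.1 i.2.1 i.2.2)
      (c.sum fun i b => b • z i.1 i.2.1 i.2.2) : ℂ) =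
      inner ℂ (c.sum fun i b => b • M.vec i.1 i.2.1 i.2.2)
        (c.sum fun i b => b • M.vec i.1 i.2.1 i.2.2) := by
    simp only [Finsupp.sum, sum_inner, inner_sum, inner_smul_left, inner_smul_right, M.inner_vec]
  rw [@norm_eq_sqrt_re_inner ℂ, h, ← @norm_eq_sqrt_re_inner ℂ]

open Classical in
-- This is where canonicality is used. The condition approximates constant unit vectors, that is,
-- noise at time `0`; multiplying by `e^{i q w}` preserves norms and moves the approximation to time
-- `q`, with vectors at times at most `q`.
lemma single_mem_closure (M : IsFactorized z F d D) (p : HIdx n) (r : ι p.1) (q : ℤ) :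
    lp.single 2 (⟨p, r, q⟩ : NoiseIdx n ι) (1 : ℂ) ∈
      (Submodule.span ℂ {x | ∃ p j k, j ≤ q ∧ x = M.vec p j k}).topologicalClosure := by
  rw [← SetLike.mem_coe, Submodule.topologicalClosure_coe, EMetric.mem_closure_iff]
  intro ε hε
  obtain ⟨c, hc⟩ := (M.canonical p.1).canonical r (ε ^ 2) (by positivity)
  refine ⟨c.sum fun i b => b • M.vec p (q - i.1) i.2, ?_, ?_⟩
  · refine Submodule.sum_mem _ fun i _ => Submodule.smul_mem _ _ (Submodule.subset_span ?_)
    exact ⟨p, q - i.1, i.2, by omega, rfl⟩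
  rw [edist_eq_enorm_sub, ← ENNReal.pow_lt_pow_left_iff two_ne_zero, enorm_lp_sq]
  refine lt_of_le_of_lt ?_ hc
  -- `g` is the error function of the canonical approximation. The coordinates of the vector error
  -- at `p` are the Fourier coefficients of `e^{i q w} g`, and the others vanish.
  let g (w : ℝ) (s : ι p.1) : ℂ := Set.indicator {r} (fun _ => (1 : ℂ)) s -
    c.sum fun i b => b * expI (-(i.1 : ℤ)) w * D p.1 w i.2 s
  have hD (i : ℕ × ℕ) (s : ι p.1) : MemLp (fun w => c i * expI (-(i.1 : ℤ)) w * D p.1 w i.2 s)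
      2 circ := by
    refine ((M.memLp p i.2 s).const_mul (c i)).of_le ?_ (.of_forall fun w => ?_)
    · exact ((continuous_expI _).aestronglyMeasurable.const_mul _).mul (M.memLp p i.2 s).1
    · simp [norm_expI]
  have hsum (s : ι p.1) : MemLp (fun w => c.sum fun i b => b * expI (-(i.1 : ℤ)) w * D p.1 w i.2 s)
      2 circ := memLp_finsetSum _ fun i _ => hD i s
  have hg (s : ι p.1) : MemLp (fun w => g w s) 2 circ := (memLp_const _).sub (hsum s)
  have hcoef (s : ι p.1) (q' : ℤ) : (lp.single 2 (⟨p, r, q⟩ : NoiseIdx n ι) (1 : ℂ) -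
      c.sum fun i b => b • M.vec p (q - i.1) i.2 : lp (fun _ : NoiseIdx n ι => ℂ) 2) ⟨p, s, q'⟩ =
        fcoef (fun w => expI q w * g w s) q' := by
    rw [fcoef_expI_mul, fcoef_sub (integrable_const _) (hsum s).integrable_circ]
    simp only [Finsupp.sum]
    rw [fcoef_sum _ fun i _ => (hD i s).integrable_circ, lp.coeFn_sub, Pi.sub_apply, lp.coeFn_sum,
      Finset.sum_apply]
    congr 1
    · have := fcoef_const_mul (Set.indicator {r} (fun _ => (1 : ℂ)) s) (expI 0) (q' - q)
      simp only [expI_zero, mul_one, fcoef_expI] at this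
      rw [this]
      by_cases hs : s = r
      · subst hs
        by_cases hq : q' = q
        · subst hq
          simp
        · rw [if_neg (by omega), lp.single_apply_ne _ _ _ (by simpa using hq), mul_zero]
      · rw [lp.single_apply_ne _ _ _ (by simp [hs])]
        simp [hs]
    · refine Finset.sum_congr rfl fun i _ => ?_
      simp only [mul_assoc]
      rw [fcoef_const_mul, fcoef_expI_mul, lp.coeFn_smul, Pi.smul_apply, vec_apply, if_pos rfl,
        smul_eq_mul, show q' - (q - (i.1 : ℤ)) = q' - q - -(i.1 : ℤ) by ring]
  have h0 (i : NoiseIdx n ι) (hi : i.1 ≠ p) : (lp.single 2 (⟨p, r, q⟩ : NoiseIdx n ι) (1 : ℂ) -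
      c.sum fun i b => b • M.vec p (q - i.1) i.2 : lp (fun _ : NoiseIdx n ι => ℂ) 2) i = 0 := by
    rw [lp.coeFn_sub, Pi.sub_apply, lp.single_apply_ne _ _ _ (fun h => hi (by rw [h])),
      Finsupp.sum, lp.coeFn_sum, Finset.sum_apply, Finset.sum_eq_zero, sub_zero]
    intro i' _
    rw [lp.coeFn_smul, Pi.smul_apply, vec_apply, if_neg hi.symm, smul_zero]
  have hnorm (w : ℝ) : normSq (fun s => expI q w * g w s) = normSq (g w) := by
    rw [normSq_const_mul, enorm_expI, one_pow, one_mul]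
  rw [normSq, tsum_fiber p fun i hi => by rw [h0 i hi]; simp, ENNReal.tsum_prod']
  simp only [hcoef]
  rw [tsum_normSq_fcoef (f := fun w s => expI q w * g w s)
    (fun s => (aemeasurable_expI q).mul (hg s).1.aemeasurable)
    (by simp only [hnorm]; exact lt_top_of_lt hc)]
  simp only [hnorm]
  -- Parseval contributes a factor `1/(2π) ≤ 1`, so the tolerance `ε ^ 2` chosen for the
  -- unnormalized integral suffices.
  refine mul_le_of_le_one_left zero_le ?_
  rw [ENNReal.ofReal_le_one, div_le_one two_pi_pos]
  linarith [Real.pi_gt_three]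

/-- A vector without coordinates at nonnegative times is a limit of linear combinations of the
vectors `vec p j k`, `j < 0`. -/
lemma mem_closure_of_apply_eq_zero (M : IsFactorized z F d D)
    {x : lp (fun _ : NoiseIdx n ι => ℂ) 2} {S : Set ℤ} (hS : ∀ q ∈ S, ∀ j ≤ q, j ∈ S)
    (hx : ∀ i, i.2.2 ∉ S → x i = 0) :
    x ∈ (Submodule.span ℂ {y | ∃ p j k, j ∈ S ∧ y = M.vec p j k}).topologicalClosure := by
  classical
  have h := lp.hasSum_single (E := fun _ : NoiseIdx n ι => ℂ) (p := 2) (by norm_num) x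
  refine (Submodule.isClosed_topologicalClosure _).mem_of_tendsto h (.of_forall fun s =>
    Submodule.sum_mem _ fun i _ => ?_)
  by_cases hi : i.2.2 ∈ S
  · rw [← mul_one (x i), ← smul_eq_mul, lp.single_smul]
    refine Submodule.smul_mem _ _ (Submodule.topologicalClosure_mono (Submodule.span_mono ?_)
      (M.single_mem_closure i.1 i.2.1 i.2.2))
    rintro _ ⟨p, j, k, hj, rfl⟩
    exact ⟨p, j, k, hS _ hi j hj, rfl⟩
  · rw [hx i hi, lp.single_zero]
    exact Submodule.zero_mem _

/-- The linear isometry with `vec p j k ↦ z p j k`. -/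
lemma exists_linearIsometry (M : IsFactorized z F d D) :
    ∃ V : lp (fun _ : NoiseIdx n ι => ℂ) 2 →ₗᵢ[ℂ] Lp ℂ 2 P, ∀ p j k, V (M.vec p j k) = z p j k := by
  let e : ((HIdx n × ℤ × ℕ) →₀ ℂ) →ₗ[ℂ] lp (fun _ : NoiseIdx n ι => ℂ) 2 :=
    Finsupp.linearCombination ℂ fun i => M.vec i.1 i.2.1 i.2.2
  let f : ((HIdx n × ℤ × ℕ) →₀ ℂ) →ₗ[ℂ] Lp ℂ 2 P :=
    Finsupp.linearCombination ℂ fun i => z i.1 i.2.1 i.2.2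
  have hfe (c : (HIdx n × ℤ × ℕ) →₀ ℂ) : ‖f c‖ = ‖e c‖ := M.norm_sum_smul c
  have he : DenseRange e := by
    intro x
    -- With `S` the set of all times there is no support condition, so the span of all the vectors
    -- is dense.
    have h := M.mem_closure_of_apply_eq_zero (x := x) (S := Set.univ) (by simp) (by simp)
    rw [← SetLike.mem_coe, Submodule.topologicalClosure_coe] at h
    convert h using 2
    rw [← LinearMap.coe_range, Finsupp.range_linearCombination]
    congr 2
    ext y
    simp [eq_comm]
  have hC : ∀ c, ‖f c‖ ≤ 1 * ‖e c‖ := fun c => by rw [hfe, one_mul]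
  have hV (c) : f.extendOfNorm e (e c) = f c := f.extendOfNorm_eq he ⟨1, hC⟩ c
  refine ⟨⟨(f.extendOfNorm e).toLinearMap, fun x => ?_⟩, fun p j k => ?_⟩
  · refine he.induction_on (p := fun x => ‖f.extendOfNorm e x‖ = ‖x‖) x
      (isClosed_eq (by fun_prop) (by fun_prop)) fun c => ?_
    rw [hV, hfe]
  · have := hV (Finsupp.single (p, j, k) 1)
    simpa [e, f] using this

end IsFactorized

variable {Ω : Type*} [MeasurableSpace Ω] {P : Measure Ω} {n : ℕ} {z : HIdx n → ℤ → ℕ → Lp ℂ 2 P}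
  {F : ℕ → ℝ → ℕ → ℕ → ℂ} {ι : ℕ → Type} {d : (m : ℕ) → ℕ → ℕ → ι m → ℂ}
  {D : (m : ℕ) → ℝ → ℕ → ι m → ℂ}

/-! ### The noise coordinates of the functional and its symbol -/

lemma hasSum_lp_apply {κ I : Type*} {f : I → lp (fun _ : κ => ℂ) 2}
    {x : lp (fun _ : κ => ℂ) 2} (h : HasSum f x) (i : κ) : HasSum (fun s => f s i) (x i) := by
  classical
  have := h.mapL (innerSL ℂ (lp.single (E := fun _ : κ => ℂ) 2 i (1 : ℂ)))
  simpa [lp.inner_single_left] using this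

lemma enorm_lp_eq {κ : Type*} (x : lp (fun _ : κ => ℂ) 2) : ‖x‖ₑ = normSq x ^ (1 / 2 : ℝ) := by
  rw [← enorm_lp_sq, ← ENNReal.rpow_natCast, ← ENNReal.rpow_mul]
  simp

section Symbol

variable {a : HIdx n → ℕ → ℕ → ℂ}

/-- For each `w` the series converges absolutely in `ℓ₂`, with a norm bound independent of `w`;
evaluation at `k` is continuous there. -/
lemma exists_hasSum_aSymbol (p : HIdx n) (h : ∑' j, normSq (a p j) ^ (1 / 2 : ℝ) < ∞) (w : ℝ) :
    (∀ k, Summable fun j : ℕ => a p j k * expI j w) ∧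
      normSq (aSymbol a p w) ≤ (∑' j, normSq (a p j) ^ (1 / 2 : ℝ)) ^ 2 := by
  have hm (j : ℕ) : Memℓp (a p j) 2 := by
    rw [memℓp_two_iff]
    by_contra h0
    have := (ENNReal.le_tsum (f := fun j => normSq (a p j) ^ (1 / 2 : ℝ)) j).trans_lt h
    rw [not_lt_top_iff.1 h0] at this
    simp at this
  let x (j : ℕ) : lp (fun _ : ℕ => ℂ) 2 := expI j w • ⟨a p j, hm j⟩
  have hx (j : ℕ) : ‖x j‖ₑ = normSq (a p j) ^ (1 / 2 : ℝ) := by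
    rw [enorm_smul, enorm_expI, one_mul, enorm_lp_eq]
  have hs : Summable x := .of_norm <| tsum_enorm_ne_top_iff_summable_norm.1 <| by
    simp only [hx]
    exact h.ne
  have hc (k : ℕ) : HasSum (fun j : ℕ => a p j k * expI j w) ((∑' j, x j : lp _ 2) k) := by
    convert hasSum_lp_apply hs.hasSum k using 2 with j
    exact mul_comm _ _
  refine ⟨fun k => (hc k).summable, ?_⟩
  have e : aSymbol a p w = (∑' j, x j : lp (fun _ : ℕ => ℂ) 2) := funext fun k => (hc k).tsum_eq
  rw [e, ← enorm_lp_sq]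
  gcongr
  exact enorm_tsum_le_tsum_enorm.trans_eq (tsum_congr hx)

namespace IsFactorized

lemma lintegral_enorm_le (M : IsFactorized z F d D) (p : HIdx n) (j : ℤ) (k : ℕ) (r : ι p.1) :
    ∫⁻ w, ‖D p.1 w k r‖ₑ ∂circ ≤ ENNReal.ofReal (2 * Real.pi) * ‖z p j k‖ₑ := by
  have h := lintegral_mul_sq_le (μ := circ) (M.aemeasurable p k r).enorm
    (aemeasurable_const (b := (1 : ℝ≥0∞)))
  have hc : circ Set.univ = ENNReal.ofReal (2 * Real.pi) := by
    rw [circ, Measure.restrict_apply_univ, Real.volume_Ico]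
    congr 1
    ring
  simp only [mul_one, one_pow, lintegral_const, one_mul, hc] at h
  rw [← ENNReal.pow_le_pow_left_iff two_ne_zero, mul_pow, sq (ENNReal.ofReal _), mul_right_comm,
    ← M.lintegral_row p j k]
  exact h.trans (mul_le_mul' (lintegral_mono fun w => enorm_sq_le_normSq (D p.1 w k) r) le_rfl)

end IsFactorized

variable [∀ m, Countable (ι m)]

namespace IsFactorized

/-- By Cauchy–Schwarz `‖D^⊤ A‖²` is at most the Hilbert–Schmidt norm squared times the uniform bound
on `‖A‖²`. Integration replaces the former by the summed variances. -/
lemma memL2_aSymbol (M : IsFactorized z F d D)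
    (h : ∑' p, ∑' j, normSq (a p j) ^ (1 / 2 : ℝ) < ∞) : MemL2 F (aSymbol a) := by
  have hp (p : HIdx n) : ∑' j, normSq (a p j) ^ (1 / 2 : ℝ) < ∞ :=
    (ENNReal.le_tsum (f := fun p => ∑' j, normSq (a p j) ^ (1 / 2 : ℝ)) p).trans_lt h
  have hm (p : HIdx n) : ∀ᵐ w ∂circ, Memℓp (aSymbol a p w) 2 := .of_forall fun w =>
    memℓp_two_iff.2 ((exists_hasSum_aSymbol p (hp p) w).2.trans_lt (by simpa using hp p))
  refine ⟨fun p k => aemeasurable_tsum (fun j => (aemeasurable_expI _).const_mul _)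
    (.of_forall fun w => (exists_hasSum_aSymbol p (hp p) w).1 k), hm, ?_⟩
  rw [M.specNormSq_eq hm]
  have hpi : ENNReal.ofReal (1 / (2 * Real.pi)) * ENNReal.ofReal (2 * Real.pi) = 1 := by
    rw [← ENNReal.ofReal_mul (by positivity), one_div_mul_cancel two_pi_pos.ne', ENNReal.ofReal_one]
  calc noiseNormSq (noiseSymbol D (aSymbol a))
      ≤ ∑' p, (∑' j, normSq (a p j) ^ (1 / 2 : ℝ)) ^ 2 * ∑' k, ‖z p 0 k‖ₑ ^ 2 := by
        refine ENNReal.tsum_le_tsum fun p => ?_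
        calc _ ≤ ENNReal.ofReal (1 / (2 * Real.pi)) *
              ∫⁻ w, (∑' j, normSq (a p j) ^ (1 / 2 : ℝ)) ^ 2 *
                normSq (fun i : ℕ × ι p.1 => D p.1 w i.1 i.2) ∂circ := by
              gcongr with w
              rw [normSq, normSq, ENNReal.tsum_prod (f := fun k r => ‖D p.1 w k r‖ₑ ^ 2),
                ENNReal.tsum_comm, ← ENNReal.tsum_mul_left]
              refine ENNReal.tsum_le_tsum fun r => enorm_tsum_mul_sq_le.trans ?_
              rw [mul_comm]
              exact mul_le_mul' (exists_hasSum_aSymbol p (hp p) w).2 le_rfl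
          _ = _ := by
              rw [lintegral_const_mul' _ _ (by simpa using (hp p).ne), M.lintegral_hilbertSchmidt,
                mul_left_comm, ← mul_assoc (ENNReal.ofReal _), hpi, one_mul]
    _ ≤ ∑' p, (∑' j, normSq (a p j) ^ (1 / 2 : ℝ)) * ((∑' p, ∑' j, normSq (a p j) ^ (1 / 2 : ℝ)) *
          ∑' p, ∑' k, ‖z p 0 k‖ₑ ^ 2) := by
        refine ENNReal.tsum_le_tsum fun p => ?_
        rw [sq, mul_assoc]
        gcongr
        · exact ENNReal.le_tsum (f := fun p => ∑' j, normSq (a p j) ^ (1 / 2 : ℝ)) p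
        · exact ENNReal.le_tsum (f := fun p => ∑' k, ‖z p 0 k‖ₑ ^ 2) p
    _ < ∞ := by
        rw [ENNReal.tsum_mul_right]
        exact ENNReal.mul_lt_top h (ENNReal.mul_lt_top h M.sum_variance)

lemma norm_vec (M : IsFactorized z F d D) (p : HIdx n) (j : ℤ) (k : ℕ) :
    ‖M.vec p j k‖ = ‖z p j k‖ := by
  rw [@norm_eq_sqrt_re_inner ℂ, M.inner_vec, ← @norm_eq_sqrt_re_inner ℂ]

/-- The noise coordinates of `∑ a(p, j, k) z(p, j, k)`. -/
def functionalVec (M : IsFactorized z F d D) (a : HIdx n → ℕ → ℕ → ℂ) :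
    lp (fun _ : NoiseIdx n ι => ℂ) 2 :=
  ∑' i : ℕ × HIdx n × ℕ, a i.2.1 i.1 i.2.2 • M.vec i.2.1 i.1 i.2.2

lemma hasSum_functionalVec (M : IsFactorized z F d D)
    (hs : Summable fun i : ℕ × HIdx n × ℕ => ‖a i.2.1 i.1 i.2.2 • z i.2.1 i.1 i.2.2‖) :
    HasSum (fun i : ℕ × HIdx n × ℕ => a i.2.1 i.1 i.2.2 • M.vec i.2.1 i.1 i.2.2)
      (M.functionalVec a) := by
  refine (Summable.of_norm ?_).hasSum
  simpa only [norm_smul, M.norm_vec] using hs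

lemma hasSum_functionalVec_apply (M : IsFactorized z F d D)
    (hs : Summable fun i : ℕ × HIdx n × ℕ => ‖a i.2.1 i.1 i.2.2 • z i.2.1 i.1 i.2.2‖)
    (p : HIdx n) (r : ι p.1) (q : ℤ) :
    HasSum (fun i : ℕ × ℕ => a p i.2 i.1 * fcoef (fun w => D p.1 w i.1 r) (q - i.2))
      (M.functionalVec a ⟨p, r, q⟩) := by
  have h := hasSum_lp_apply (M.hasSum_functionalVec hs) ⟨p, r, q⟩
  have hi : Function.Injective fun i : ℕ × ℕ => (i.2, p, i.1) := fun i i' h => by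
    simp only [Prod.mk.injEq, true_and] at h
    exact Prod.ext h.2 h.1
  rw [← hi.hasSum_iff] at h
  · convert h using 2 with i
    simp [vec_apply]
  · rintro ⟨j, p', k⟩ hp
    have : p' ≠ p := fun h => hp ⟨(k, j), by simp [h]⟩
    simp [vec_apply, this]

/-- The coordinates of the functional at nonnegative times. -/
lemma functionalVec_apply_natCast (M : IsFactorized z F d D)
    (hs : Summable fun i : ℕ × HIdx n × ℕ => ‖a i.2.1 i.1 i.2.2 • z i.2.1 i.1 i.2.2‖)
    (p : HIdx n) (r : ι p.1) (q : ℕ) : M.functionalVec a ⟨p, r, (q : ℤ)⟩ = aConv a d p q r := by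
  have h := M.hasSum_functionalVec_apply hs p r q
  -- Substitution `j = u + q`. Terms with `j < q` drop out by causality, since they would need noise
  -- later than `j`.
  have hi : Function.Injective fun i : ℕ × ℕ => (i.2, i.1 + q) := fun i i' h => by
    simp only [Prod.mk.injEq, add_left_inj] at h
    exact Prod.ext h.2 h.1
  rw [← hi.hasSum_iff] at h
  · rw [← h.tsum_eq, h.summable.tsum_prod]
    refine tsum_congr fun u => tsum_congr fun k => ?_
    simp only [Function.comp_apply, Nat.cast_add, sub_add_cancel_right, M.fcoef_symbol_nonpos]
    exact mul_comm _ _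
  · rintro ⟨k, j⟩ hj
    have : j < q := by
      by_contra h
      exact hj ⟨(j - q, k), by simp; omega⟩
    rw [M.fcoef_symbol_pos _ _ _ (by simp only; omega), mul_zero]

/-- The coordinates of the symbol of the functional. -/
lemma noiseCoef_aSymbol (M : IsFactorized z F d D)
    (h : ∑' p, ∑' j, normSq (a p j) ^ (1 / 2 : ℝ) < ∞)
    (hs : Summable fun i : ℕ × HIdx n × ℕ => ‖a i.2.1 i.1 i.2.2 • z i.2.1 i.1 i.2.2‖) :
    M.coefVec (M.memL2_aSymbol h) = M.functionalVec a := by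
  refine lp.ext (funext fun ⟨p, r, q⟩ => ?_)
  let f (i : ℕ × ℕ) (w : ℝ) : ℂ := expI (-q) w * (D p.1 w i.1 r * (a p i.2 i.1 * expI i.2 w))
  have hf (i : ℕ × ℕ) : AEStronglyMeasurable (f i) circ :=
    (continuous_expI _).aestronglyMeasurable.mul
    ((M.memLp p i.1 r).1.mul ((continuous_expI _).aestronglyMeasurable.const_mul _))
  -- The `L₁` norms of the terms are dominated by the absolutely convergent series of the
  -- functional, so Fourier coefficients may be taken term by term.
  have hfin : ∑' i, ∫⁻ w, ‖f i w‖ₑ ∂circ ≠ ∞ := by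
    refine ne_of_lt ?_
    have hi : Function.Injective fun i : ℕ × ℕ => (i.2, p, i.1) := fun i i' h => by
      simp only [Prod.mk.injEq, true_and] at h
      exact Prod.ext h.2 h.1
    calc _ ≤ ∑' i : ℕ × ℕ, ENNReal.ofReal (2 * Real.pi) * ‖a p i.2 i.1 • z p i.2 i.1‖ₑ := by
          refine ENNReal.tsum_le_tsum fun i => ?_
          simp only [f, enorm_mul, enorm_expI, one_mul, mul_one]
          rw [lintegral_mul_const'' _ (M.aemeasurable p i.1 r).enorm, enorm_smul, mul_left_comm,
            mul_comm]
          gcongr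
          exact M.lintegral_enorm_le p i.2 i.1 r
      _ ≤ ENNReal.ofReal (2 * Real.pi) *
            ∑' i : ℕ × HIdx n × ℕ, ‖a i.2.1 i.1 i.2.2 • z i.2.1 i.1 i.2.2‖ₑ := by
          rw [ENNReal.tsum_mul_left]
          gcongr
          exact ENNReal.tsum_comp_le_tsum_of_injective hi
            fun i : ℕ × HIdx n × ℕ => ‖a i.2.1 i.1 i.2.2 • z i.2.1 i.1 i.2.2‖ₑ
      _ < ∞ := ENNReal.mul_lt_top ENNReal.ofReal_lt_top
          (tsum_enorm_ne_top_iff_summable_norm.2 hs).lt_top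
  have hsum : ∀ᵐ w ∂circ, Summable fun i => f i w := by
    rw [← lintegral_tsum fun i => (hf i).enorm] at hfin
    filter_upwards [ae_lt_top' (AEMeasurable.tsum fun i => (hf i).enorm) hfin] with w hw
    exact .of_norm (tsum_enorm_ne_top_iff_summable_norm.1 hw.ne)
  rw [coefVec_apply, ← (M.hasSum_functionalVec_apply hs p r q).tsum_eq]
  have e : ∫ w, expI (-q) w * noiseSymbol D (aSymbol a) p w r ∂circ = ∫ w, ∑' i, f i w ∂circ := by
    refine integral_congr_ae ?_
    filter_upwards [hsum] with w hw
    rw [hw.tsum_prod]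
    simp only [f, noiseSymbol, aSymbol, tsum_mul_left]
  rw [noiseCoef, fcoef, e, integral_tsum hf hfin, ← tsum_mul_left]
  refine tsum_congr fun i => ?_
  rw [← fcoef_expI_mul, ← fcoef_const_mul, fcoef]
  congr 1
  refine integral_congr_ae (.of_forall fun w => ?_)
  simp only [f]
  ring

end IsFactorized

end Symbol

variable {Ω : Type*} [MeasurableSpace Ω] {P : Measure Ω} {n : ℕ} {z : HIdx n → ℤ → ℕ → Lp ℂ 2 P}
  {F : ℕ → ℝ → ℕ → ℕ → ℂ} {ι : ℕ → Type} {d : (m : ℕ) → ℕ → ℕ → ι m → ℂ}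
  {D : (m : ℕ) → ℝ → ℕ → ι m → ℂ} {a : HIdx n → ℕ → ℕ → ℂ}

/-! ### The optimal estimate and its spectral characteristic -/

/-- The coordinates at negative times. -/
def pastPart (x : lp (fun _ : NoiseIdx n ι => ℂ) 2) : lp (fun _ : NoiseIdx n ι => ℂ) 2 :=
  ⟨fun i => if i.2.2 < 0 then x i else 0, memℓp_two_iff.2 <|
    (ENNReal.tsum_le_tsum fun i => by dsimp only; split_ifs <;> simp).trans_lt
      (memℓp_two_iff.1 (lp.memℓp x))⟩

lemma pastPart_apply (x : lp (fun _ : NoiseIdx n ι => ℂ) 2) (i : NoiseIdx n ι) :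
    pastPart x i = if i.2.2 < 0 then x i else 0 := rfl

lemma enorm_sub_pastPart_sq (x : lp (fun _ : NoiseIdx n ι => ℂ) 2) :
    ‖x - pastPart x‖ₑ ^ 2 = ∑' (p) (j : ℕ), normSq fun r => x ⟨p, r, (j : ℤ)⟩ := by
  rw [enorm_lp_sq, normSq, ENNReal.tsum_sigma']
  refine tsum_congr fun p => ?_
  simp only [normSq]
  rw [ENNReal.tsum_prod', ENNReal.tsum_comm (α := ℕ)]
  refine tsum_congr fun r => ?_
  rw [tsum_int_eq_of_lt 0 fun q hq => by
    rw [lp.coeFn_sub, Pi.sub_apply, pastPart_apply, if_pos (show q < 0 from hq)]; simp]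
  refine tsum_congr fun j => ?_
  rw [lp.coeFn_sub, Pi.sub_apply, pastPart_apply, if_neg (by simp only; omega), sub_zero, add_zero]

variable {s : (p : HIdx n) → ℝ → ι p.1 → ℂ} {Q : (m : ℕ) → ℝ → ι m → lp (fun _ : ℕ => ℂ) 2}
  {c : (p : HIdx n) → ℕ → ι p.1 → ℂ}

lemma noiseCoef_fourierSum
    (hs : ∀ p, IsFourierSum (fun j => (j : ℤ)) (c p) (s p)) (i : NoiseIdx n ι) :
    noiseCoef s i = if i.2.2 < 0 then 0 else c i.1 i.2.2.toNat i.2.1 := by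
  obtain ⟨p, r, q⟩ := i
  split_ifs with h
  · have hq : q < 0 := h
    exact (hs p).fcoef_eq_zero r fun u => by omega
  · lift q to ℕ using not_lt.1 h
    exact (hs p).fcoef_eq_of_injective Nat.cast_injective r q

variable [∀ m, Countable (ι m)]

lemma noiseNormSq_fourierSum
    (hs : ∀ p, IsFourierSum (fun j => (j : ℤ)) (c p) (s p)) :
    noiseNormSq s = ∑' (p) (j : ℕ), normSq (c p j) := by
  refine tsum_congr fun p => ?_
  rw [lintegral_normSq (hs p).aemeasurable, ← ENNReal.tsum_mul_left]
  simp only [normSq]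
  rw [ENNReal.tsum_comm (α := ℕ)]
  refine tsum_congr fun r => ?_
  rw [← tsum_enorm_sq_fcoef ((hs p).memLp r)]
  have h (q : ℤ) := noiseCoef_fourierSum hs ⟨p, r, q⟩
  simp only [noiseCoef] at h
  simp only [h]
  rw [tsum_int_eq_of_lt 0 fun q hq => by rw [if_pos (show q < 0 from hq)]; simp]
  refine tsum_congr fun j => ?_
  rw [if_neg (by omega), Int.toNat_natCast, add_zero]

namespace IsFactorized

/-- A vector without coordinates at nonnegative times is approximated by trigonometric polynomials
with negative frequencies. -/
lemma exists_trigPoly_approx (M : IsFactorized z F d D) {x : lp (fun _ : NoiseIdx n ι => ℂ) 2}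
    (hx : ∀ i, ¬ i.2.2 < 0 → x i = 0) {ε : ℝ≥0∞} (hε : 0 < ε) :
    ∃ c : (HIdx n × ℤ × ℕ) →₀ ℂ, (∀ i ∈ c.support, i.2.1 < 0) ∧
      ‖x - c.sum fun i b => b • M.vec i.1 i.2.1 i.2.2‖ₑ < ε := by
  have h := M.mem_closure_of_apply_eq_zero (x := x) (S := {j | j < 0})
    (fun q hq j hj => lt_of_le_of_lt hj hq) hx
  rw [← SetLike.mem_coe, Submodule.topologicalClosure_coe, EMetric.mem_closure_iff] at h
  obtain ⟨y, hy, hxy⟩ := h ε hε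
  have hset : {y | ∃ p j k, j ∈ {j : ℤ | j < 0} ∧ y = M.vec p j k} =
      (fun i : HIdx n × ℤ × ℕ => M.vec i.1 i.2.1 i.2.2) '' {i | i.2.1 < 0} := by
    ext y
    constructor
    · rintro ⟨p, j, k, hj, rfl⟩
      exact ⟨(p, j, k), hj, rfl⟩
    · rintro ⟨i, hi, rfl⟩
      exact ⟨i.1, i.2.1, i.2.2, hi, rfl⟩
  rw [hset, SetLike.mem_coe, Finsupp.mem_span_image_iff_linearCombination] at hy
  obtain ⟨c, hc, rfl⟩ := hy
  refine ⟨c, fun i hi => hc hi, ?_⟩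
  rwa [← edist_eq_enorm_sub]

/-- Canonicality makes a vector supported at negative times a limit of combinations of `vec p j k`
with `j < 0`; the isometry carries that limit into the past. -/
lemma map_pastPart_mem (M : IsFactorized z F d D)
    {V : lp (fun _ : NoiseIdx n ι => ℂ) 2 →ₗᵢ[ℂ] Lp ℂ 2 P} (hV : ∀ p j k, V (M.vec p j k) = z p j k)
    (x : lp (fun _ : NoiseIdx n ι => ℂ) 2) : V (pastPart x) ∈
      (Submodule.span ℂ {η | ∃ p j k, j < 0 ∧ η = z p j k}).topologicalClosure := by
  rw [← SetLike.mem_coe, Submodule.topologicalClosure_coe]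
  have h := M.mem_closure_of_apply_eq_zero (x := pastPart x) (S := {j | j < 0})
    (fun q hq j hj => lt_of_le_of_lt hj hq) fun i hi => if_neg hi
  rw [← SetLike.mem_coe, Submodule.topologicalClosure_coe] at h
  refine map_mem_closure V.continuous h fun y hy => ?_
  have := Submodule.mem_map_of_mem (f := V.toLinearMap) hy
  rw [Submodule.map_span] at this
  refine Submodule.span_mono ?_ this
  rintro _ ⟨_, ⟨p, j, k, hj, rfl⟩, rfl⟩
  exact ⟨p, j, k, hj, hV p j k⟩

/-- The projection onto the past discards the noise coordinates at nonnegative times. -/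
lemma starProjection_map (M : IsFactorized z F d D)
    {V : lp (fun _ : NoiseIdx n ι => ℂ) 2 →ₗᵢ[ℂ] Lp ℂ 2 P} (hV : ∀ p j k, V (M.vec p j k) = z p j k)
    {K : Submodule ℂ (Lp ℂ 2 P)} [K.HasOrthogonalProjection]
    (hK : K = (Submodule.span ℂ {η | ∃ p j k, j < 0 ∧ η = z p j k}).topologicalClosure)
    (x : lp (fun _ : NoiseIdx n ι => ℂ) 2) : K.starProjection (V x) = V (pastPart x) := by
  subst hK
  refine Submodule.eq_starProjection_of_mem_orthogonal (M.map_pastPart_mem hV x) ?_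
  -- The residual lives at nonnegative times, while the vectors with `j < 0` live, by causality, at
  -- negative times only; their inner products have disjoint supports.
  rw [Submodule.orthogonal_closure, mem_orthogonal_span_iff]
  rintro _ ⟨p, j, k, hj, rfl⟩
  rw [← hV p j k, ← map_sub, V.inner_map_map]
  refine (hasSum_conj_mul_lp _ _).unique ?_
  convert hasSum_zero with i
  rw [lp.coeFn_sub, Pi.sub_apply, pastPart_apply]
  split_ifs with hi
  · simp
  · rw [M.vec_apply_eq_zero p k i (by omega), mul_zero]

/-- The error of the prediction from the past. -/
lemma enorm_sub_starProjection_sq (M : IsFactorized z F d D)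
    {V : lp (fun _ : NoiseIdx n ι => ℂ) 2 →ₗᵢ[ℂ] Lp ℂ 2 P} (hV : ∀ p j k, V (M.vec p j k) = z p j k)
    {K : Submodule ℂ (Lp ℂ 2 P)} [K.HasOrthogonalProjection]
    (hK : K = (Submodule.span ℂ {η | ∃ p j k, j < 0 ∧ η = z p j k}).topologicalClosure)
    (x : lp (fun _ : NoiseIdx n ι => ℂ) 2) :
    ‖V x - K.starProjection (V x)‖ₑ ^ 2 = ∑' (p) (j : ℕ), normSq fun r => x ⟨p, r, (j : ℤ)⟩ := by
  rw [M.starProjection_map hV hK, ← map_sub, V.enorm_map, enorm_sub_pastPart_sq]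

/-- Formally `D^⊤ Q^⊤ s = (Q D)^⊤ s = s`. The interchange of sums is legitimate because a column of
`D` is in `ℓ₂`, so pairing with it is continuous and passes through the series of rows of `Q`. -/
lemma noiseSymbol_tsum_smul (M : IsFactorized z F d D) (hQ : ∀ m, IsLeftInverse (D m) (Q m))
    (hs : ∀ p : HIdx n, ∀ᵐ w ∂circ, Summable fun r => s p w r • Q p.1 w r) (p : HIdx n) :
    ∀ᵐ w ∂circ, ∀ r, noiseSymbol D (fun p w k => (∑' r, s p w r • Q p.1 w r) k) p w r =
      s p w r := by
  classical
  filter_upwards [M.ae_column p, hs p, (hQ p.1).mul_eq_one] with w h1 h2 h3 r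
  have hr : normSq (fun k => conj (D p.1 w k r)) < ∞ := by
    refine lt_of_le_of_lt ?_ h1
    simp only [normSq, RCLike.enorm_conj]
    exact ENNReal.le_tsum (f := fun r => ∑' k, ‖D p.1 w k r‖ₑ ^ 2) r
  let y : lp (fun _ : ℕ => ℂ) 2 := ⟨fun k => conj (D p.1 w k r), memℓp_two_iff.2 hr⟩
  have hy (x : lp (fun _ : ℕ => ℂ) 2) : HasSum (fun k => D p.1 w k r * x k) (inner ℂ y x) := by
    simpa [y] using hasSum_conj_mul_lp y x
  have h4 := h2.hasSum.mapL (innerSL ℂ y)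
  have h5 (r' : ι p.1) : innerSL ℂ y (s p w r' • Q p.1 w r') = if r' = r then s p w r else 0 := by
    have := (hy (Q p.1 w r')).unique (by simpa only [mul_comm] using h3 r' r)
    rw [innerSL_apply_apply, inner_smul_right, this]
    by_cases hrr : r' = r
    · subst hrr
      simp
    · simp [hrr, Ne.symm hrr]
  simp only [h5] at h4
  rw [noiseSymbol, (hy _).tsum_eq, ← innerSL_apply_apply, h4.unique (hasSum_ite_eq r _)]

lemma memL2_tsum_smul (M : IsFactorized z F d D) (hQ : ∀ m, IsLeftInverse (D m) (Q m))
    (hs : ∀ p : HIdx n, ∀ᵐ w ∂circ, Summable fun r => s p w r • Q p.1 w r)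
    (hm : ∀ p r, AEMeasurable (fun w => s p w r) circ) (hfin : noiseNormSq s < ∞) :
    MemL2 F fun p w k => (∑' r, s p w r • Q p.1 w r) k := by
  have hp (p : HIdx n) : ∀ᵐ w ∂circ, Memℓp (fun k => (∑' r, s p w r • Q p.1 w r) k) 2 :=
    .of_forall fun w => lp.memℓp _
  refine ⟨fun p k => ?_, hp, ?_⟩
  · refine (aemeasurable_tsum (f := fun r w => s p w r * Q p.1 w r k)
      (fun r => (hm p r).mul ((hQ p.1).aemeasurable r k)) ?_).congr ?_
    all_goals filter_upwards [hs p] with w hw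
    · exact (hasSum_lp_apply hw.hasSum k).summable
    · exact (hasSum_lp_apply hw.hasSum k).tsum_eq
  · rwa [M.specNormSq_eq hp, noiseNormSq_congr (M.noiseSymbol_tsum_smul hQ hs)]

/-- An element of `L₂⁻(F)` has no noise coordinates at nonnegative times. -/
lemma coefVec_apply_eq_zero (M : IsFactorized z F d D) {g : HIdx n → ℝ → ℕ → ℂ}
    (hg : MemL2Minus F g) (i : NoiseIdx n ι) (hi : ¬ i.2.2 < 0) : M.coefVec hg.memL2 i = 0 := by
  rw [← enorm_eq_zero, ← sq_eq_zero_iff]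
  refine le_antisymm (le_of_forall_gt fun ε hε => ?_) zero_le
  -- The approximating polynomial has no coordinate at time `i.2.2 ≥ 0`, so the squared coordinate
  -- of `g` is bounded by the squared approximation error.
  obtain ⟨c, hc, h⟩ := hg.approx ε hε
  refine lt_of_le_of_lt ?_ h
  have hsub := M.coefVec_sub hg.memL2 (M.memL2_trigPoly c)
  rw [← M.enorm_coefVec_sq (M.memL2_sub hg.memL2 (M.memL2_trigPoly c)), enorm_lp_sq]
  refine le_trans (le_of_eq ?_) (enorm_sq_le_normSq _ i)
  rw [hsub, lp.coeFn_sub, Pi.sub_apply, M.coefVec_trigPoly, Finsupp.sum, lp.coeFn_sum,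
    Finset.sum_apply, Finset.sum_eq_zero, sub_zero]
  intro i' hi'
  rw [lp.coeFn_smul, Pi.smul_apply, M.vec_apply_eq_zero _ _ _ (by have := hc i' hi'; omega),
    smul_zero]

/-- The properties of the spectral characteristic of the optimal estimate. -/
theorem specChar_properties (M : IsFactorized z F d D)
    {V : lp (fun _ : NoiseIdx n ι => ℂ) 2 →ₗᵢ[ℂ] Lp ℂ 2 P} (hV : ∀ p j k, V (M.vec p j k) = z p j k)
    (ha : ∑' p, ∑' j, normSq (a p j) ^ (1 / 2 : ℝ) < ∞)
    (haz : Summable fun i : ℕ × HIdx n × ℕ => ‖a i.2.1 i.1 i.2.2 • z i.2.1 i.1 i.2.2‖)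
    (hs : ∀ p, IsFourierSum (fun j => (j : ℤ)) (aConv a d p) (s p))
    (hQ : ∀ m, IsLeftInverse (D m) (Q m))
    (hsQ : ∀ p : HIdx n, ∀ᵐ w ∂circ, Summable fun r => s p w r • Q p.1 w r)
    (hfin : ∑' (p : HIdx n) (j : ℕ), normSq (aConv a d p j) < ∞) :
    MemL2Minus F (specChar (aSymbol a) Q s) ∧
      IsSpectralIntegral z F (specChar (aSymbol a) Q s) (V (pastPart (M.functionalVec a))) ∧
      specNormSq F (fun p w k => aSymbol a p w k - specChar (aSymbol a) Q s p w k) =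
        ∑' (p : HIdx n) (j : ℕ), normSq (aConv a d p j) ∧
      ∀ g : HIdx n → ℝ → ℕ → ℂ, MemL2Minus F g →
        ∑' (p : HIdx n) (j : ℕ), normSq (aConv a d p j) ≤
          specNormSq F (fun p w k => aSymbol a p w k - g p w k) := by
  have hA := M.memL2_aSymbol ha
  have hs0 := noiseNormSq_fourierSum hs
  have hG := M.memL2_tsum_smul hQ hsQ (fun p => (hs p).aemeasurable) (hs0.trans_lt hfin)
  have hh : MemL2 F (specChar (aSymbol a) Q s) := M.memL2_sub hA hG
  -- The symbol of the functional has all its noise coordinates, and `Q^⊤ S` has exactly those at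
  -- nonnegative times; the difference is the truncation.
  have hcoef : M.coefVec hh = pastPart (M.functionalVec a) := by
    refine (M.coefVec_sub hA hG).trans (lp.ext (funext fun i => ?_))
    rw [lp.coeFn_sub, Pi.sub_apply, M.noiseCoef_aSymbol ha haz, pastPart_apply, coefVec_apply,
      noiseCoef_congr (M.noiseSymbol_tsum_smul hQ hsQ), noiseCoef_fourierSum hs]
    obtain ⟨p, r, q⟩ := i
    split_ifs with hq
    · rw [sub_zero]
    · lift q to ℕ using not_lt.1 hq
      rw [M.functionalVec_apply_natCast haz, Int.toNat_natCast, sub_self]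
  have happrox (ε : ℝ≥0∞) (hε : 0 < ε) : ∃ c : (HIdx n × ℤ × ℕ) →₀ ℂ,
      (∀ i ∈ c.support, i.2.1 < 0) ∧
      specNormSq F (fun p w k => specChar (aSymbol a) Q s p w k - trigPoly c p w k) < ε ∧
      ‖V (pastPart (M.functionalVec a)) - c.sum fun i b => b • z i.1 i.2.1 i.2.2‖ₑ < ε := by
    -- One of the two estimates concerns the squared error; keeping the error below `1` bounds its
    -- square by the error itself.
    obtain ⟨c, hc, hlt⟩ := M.exists_trigPoly_approx (x := pastPart (M.functionalVec a))
      (fun i hi => if_neg hi) (lt_min one_pos hε)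
    refine ⟨c, hc, ?_, ?_⟩
    · rw [← M.enorm_coefVec_sq (M.memL2_sub hh (M.memL2_trigPoly c)),
        M.coefVec_sub hh (M.memL2_trigPoly c), hcoef,
        M.coefVec_trigPoly, sq]
      exact (mul_le_of_le_one_left zero_le (hlt.trans_le (min_le_left _ _)).le).trans_lt
        (hlt.trans_le (min_le_right _ _))
    · have : (c.sum fun i b => b • z i.1 i.2.1 i.2.2) =
          V (c.sum fun i b => b • M.vec i.1 i.2.1 i.2.2) := by
        simp only [Finsupp.sum, map_sum, map_smul, hV]
      rw [this, ← map_sub, V.enorm_map]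
      exact hlt.trans_le (min_le_right _ _)
  refine ⟨⟨hh, fun ε hε => ?_⟩, fun ε hε => ?_, ?_, fun g hg => ?_⟩
  · obtain ⟨c, hc, h, -⟩ := happrox ε hε
    exact ⟨c, hc, h⟩
  · obtain ⟨c, -, h⟩ := happrox ε hε
    exact ⟨c, h⟩
  · simp only [specChar, sub_sub_cancel]
    rw [M.specNormSq_eq hG.memℓp, noiseNormSq_congr (M.noiseSymbol_tsum_smul hQ hsQ), hs0]
  · have h1 := enorm_sub_pastPart_sq (M.functionalVec a)
    simp only [M.functionalVec_apply_natCast haz] at h1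
    refine h1.symm.le.trans ?_
    rw [← M.enorm_coefVec_sq (M.memL2_sub hA hg.memL2), M.coefVec_sub hA hg.memL2,
      enorm_lp_sq, enorm_lp_sq, M.noiseCoef_aSymbol ha haz]
    -- The comparison is coordinatewise: at negative times the left side is zero, and at nonnegative
    -- times `g` has no coordinates, so both sides agree.
    refine ENNReal.tsum_le_tsum fun i => ?_
    simp only [lp.coeFn_sub, Pi.sub_apply, pastPart_apply]
    split_ifs with hi
    · simp
    · rw [M.coefVec_apply_eq_zero hg i hi]

end IsFactorized

end SphereField

end

/-! ### The prediction theorem for the field -/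

open MeasureTheory SphereField
open scoped ENNReal
theorem theorem2 {Ω : Type*} [MeasurableSpace Ω] (P : Measure Ω) [IsProbabilityMeasure P]
    (n : ℕ) (hn : 2 ≤ n) (T : ℝ) (hT : 0 < T)
    (Y : (m : ℕ) → Fin (harmonicCount n m) → Sph n → ℝ) (hY : IsHarmonicBasis Y)
    (ζ : ℝ → Sph n → Lp ℂ 2 P) (hζ : IsPCIsotropic T ζ)
    (a : ℝ → Sph n → ℂ) (ha : IsWeight T Y a)
    (F : ℕ → ℝ → ℕ → ℕ → ℂ) (hF : IsSpectralDensity (fieldSeq T Y ζ) F)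
    (ι : ℕ → Type) [∀ m, Countable (ι m)]
    (d : (m : ℕ) → ℕ → ℕ → ι m → ℂ) (D : (m : ℕ) → ℝ → ℕ → ι m → ℂ)
    (hd : ∀ m, IsCanonicalFactorization (F m) (d m) (D m)) :
    -- the functional is well defined
    Integrable (fun q : ℝ × Sph n => a q.1 q.2 • ζ q.1 q.2)
      ((volume.restrict (Set.Ici (0 : ℝ))).prod (surf n)) ∧
    -- the mean square error of the optimal estimate
    ∫⁻ ω, ‖(functional a ζ - optimalEstimate a ζ : Lp ℂ 2 P) ω‖ₑ ^ 2 ∂P =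
      ∑' (p : HIdx n) (j : ℕ), normSq (aConv (aVec T Y a) d p j) ∧
    ∑' (p : HIdx n) (j : ℕ), normSq (aConv (aVec T Y a) d p j) < ∞ ∧
    -- the functions `S_m^l` exist
    (∃ s : (p : HIdx n) → ℝ → ι p.1 → ℂ,
      ∀ p, IsFourierSum (fun j => (j : ℤ)) (aConv (aVec T Y a) d p) (s p)) ∧
    -- the spectral characteristic of the optimal estimate
    ∀ s : (p : HIdx n) → ℝ → ι p.1 → ℂ,
      (∀ p, IsFourierSum (fun j => (j : ℤ)) (aConv (aVec T Y a) d p) (s p)) →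
    ∀ Q : (m : ℕ) → ℝ → ι m → lp (fun _ : ℕ => ℂ) 2,
      (∀ m, IsLeftInverse (D m) (Q m)) →
      (∀ p : HIdx n, ∀ᵐ w ∂circ, Summable fun r => s p w r • Q p.1 w r) →
      MemL2Minus F (specChar (aSymbol (aVec T Y a)) Q s) ∧
      IsSpectralIntegral (fieldSeq T Y ζ) F (specChar (aSymbol (aVec T Y a)) Q s)
        (optimalEstimate a ζ) ∧
      specNormSq F (fun p w k => aSymbol (aVec T Y a) p w k -
          specChar (aSymbol (aVec T Y a)) Q s p w k) =
        ∑' (p : HIdx n) (j : ℕ), normSq (aConv (aVec T Y a) d p j) ∧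
      ∀ g : HIdx n → ℝ → ℕ → ℂ, MemL2Minus F g →
        specNormSq F (fun p w k => aSymbol (aVec T Y a) p w k -
            specChar (aSymbol (aVec T Y a)) Q s p w k) ≤
          specNormSq F (fun p w k => aSymbol (aVec T Y a) p w k - g p w k) := by
  have hn0 : 0 < n := by omega
  obtain ⟨K, hK, hz⟩ := exists_tsum_fieldSeq_le hY hζ hT hn0
  have M : IsFactorized (fieldSeq T Y ζ) F d D := by
    refine ⟨hF, hd, ?_, fun p p' hp i j k k' => inner_fieldSeq_eq_zero hn hY hζ hp.symm j i k' k⟩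
    -- The variances are read off at `j = 0`, where the uniform Bessel bound gives their summability
    -- over all harmonics and frequencies.
    rw [← ENNReal.tsum_prod (f := fun p k => ‖fieldSeq T Y ζ p 0 k‖ₑ ^ 2)]
    exact (hz 0).trans_lt hK
  obtain ⟨V, hV⟩ := M.exists_linearIsometry
  have haz := summable_norm_weight_smul_fieldSeq hn0 hT hY hζ ha
  have hfun : functional a ζ = V (M.functionalVec (aVec T Y a)) := by
    have h := (M.hasSum_functionalVec haz).map V V.continuous
    simp only [Function.comp_def, map_smul, hV] at h
    exact (hasSum_functional hn0 hT hY hζ ha).unique h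
  have hpast := pastSpace_eq hn0 hT hY hζ
  have hest : optimalEstimate a ζ = V (pastPart (M.functionalVec (aVec T Y a))) := by
    rw [optimalEstimate, hfun, M.starProjection_map hV hpast]
  have herr : ‖functional a ζ - optimalEstimate a ζ‖ₑ ^ 2 =
      ∑' (p : HIdx n) (j : ℕ), normSq (aConv (aVec T Y a) d p j) := by
    rw [optimalEstimate, hfun, M.enorm_sub_starProjection_sq hV hpast]
    simp only [M.functionalVec_apply_natCast haz]
  -- The sum is finite because it equals the squared norm of an element of `L₂(Ω)`.
  have hfin : ∑' (p : HIdx n) (j : ℕ), normSq (aConv (aVec T Y a) d p j) < ∞ := by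
    rw [← herr]
    exact ENNReal.pow_lt_top enorm_lt_top
  refine ⟨integrable_functional hn0 hT hY hζ ha, ?_, hfin, ?_, fun s hs Q hQ hsQ => ?_⟩
  · rw [← herr, Lp.enorm_def, eLpNorm_two_sq]
  · choose s hs using fun p : HIdx n => exists_isFourierSum (c := aConv (aVec T Y a) d p)
      ((ENNReal.le_tsum (f := fun p : HIdx n => ∑' j : ℕ, normSq (aConv (aVec T Y a) d p j))
        p).trans_lt hfin)
    exact ⟨s, hs⟩
  · obtain ⟨h1, h2, h3, h4⟩ := M.specChar_properties hV ha.sum_norm haz hs hQ hsQ hfin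
    refine ⟨h1, hest ▸ h2, h3, fun g hg => ?_⟩
    rw [h3]
    exact h4 g hg
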